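/- **Setting.** Let $\mathcal V$ be a descent category: a category with finite limits together with a subcategory of *covers* (containing all objects and identities), such that pullbacks of covers are covers, and such that if $f$ and $gf$ are covers then $g$ is a cover. A simplicial space is a simplicial object of $\mathcal V$. For a simplicial set $T$ and a simplicial space $X$, $\mathrm{Map}(T,X)$ denotes the space of simplicial morphisms from $T$ to $X$, i.e. the object of $\mathcal V$ representing $U\mapsto \mathrm{Hom}_{\mathrm{sSet}}(T,\mathrm{Hom}(U,X_\bullet))$; for $S\hookrightarrow T$ and $f:X\to Y$ put $\mathrm{Map}(S\hookrightarrow T,f)=\mathrm{Map}(S,X)\times_{\mathrm{Map}(S,Y)}\mathrm{Map}(T,Y)$. The thick simplex $\mathbf\Delta^n$ is the simplicial set whose $m$-simplices are all functions $\{0,\dots,m\}\to\{0,\dots,n\}$. A $k$-groupoid ($k\ge 0$) is a simplicial space $X$ such that $X_n\to\mathrm{Map}(\Lambda^n_i,X)$ is a cover for all $n>0$, $0\le i\le n$, and an isomorphism for $n>k$. A $k$-category ($k>0$) is a simplicial space $X$ such that $X_n\to\mathrm{Map}(\Lambda^n_i,X)$ is a cover for $0<i<n$, and an isomorphism if moreover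 $n>k$, and such that the two morphisms $\mathrm{Map}(\mathbf\Delta^1,X)\to X_0$ given by the vertices of $\mathbf\Delta^1$ are covers. Both form full subcategories of the category of simplicial spaces. A morphism $f:X\to Y$ is * a *fibration* (of $k$-groupoids) if $X_n\to\mathrm{Map}(\Lambda^n_i\hookrightarrow\Delta^n,f)$ is a cover for $n>0$, $0\le i\le n$; * a *quasi-fibration* (of $k$-categories) if $X_n\to\mathrm{Map}(\Lambda^n_i\hookrightarrow\Delta^n,f)$ is a cover for $0<i<n$ and, for both vertices of $\mathbf\Delta^1$, $\mathrm{Map}(\mathbf\Delta^1,X)\to X_0\times_{Y_0}\mathrm{Map}(\mathbf\Delta^1,Y)$ is a cover; * a *hypercover* if $X_n\to\mathrm{Map}(\partial\Delta^n\hookrightarrow\Delta^n,f)$ is a cover for all $n\ge0$; * a *weak equivalence* of $k$-categories (resp. $k$-groupoids) if there are a $k$-category (resp. $k$-groupoid) $P$ and hypercovers $p:P\to X$, $q:P\to Y$ such that $f=qs$ with $s$ a section of $p$. A *category of fibrant objects* is a category with a subcategory of weak equivalences containing all isomorphisms and such that, whenever $gf$ is a weak equivalence, $f$ is one if and only if $g$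 is, and a subcategory of fibrations, such that: there is a terminal object and every morphism to it is a fibration; pullbacks of fibrations exist and are fibrations; pullbacks of trivial fibrations (fibrations that are weak equivalences) are trivial fibrations; every morphism factors as a weak equivalence followed by a fibration. **Theorem.** Let $\mathcal V$ be a descent category and $k>0$. 1. With quasi-fibrations as fibrations and the weak equivalences above, the category of $k$-categories in $\mathcal V$ is a category of fibrant objects, and its trivial fibrations are exactly the hypercovers. 2. There is a functor $\mathbb G$ from $k$-categories to $k$-groupoids with $\mathbb G(X)_n=\mathrm{Map}(\mathbf\Delta^n,X)$, naturally in $n$ and $X$ (in particular these spaces exist in $\mathcal V$, and they form a $k$-groupoid). It is exact: it takes quasi-fibrations to fibrations, pullbacks of quasi-fibrations to pullbacks, and hypercovers to hypercovers. 3. $\mathbb G$ takes weak equivalences of $k$-categories to weak equivalences of $k$-groupoids. -/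

import Mathlib

open CategoryTheory Limits Opposite
open scoped Simplicial

universe v u

/-! ### Categories of fibrant objects -/

/-- `C` with weak equivalences `W` and fibrations `F` is a category of fibrant objects. -/
structure IsCategoryOfFibrantObjects {C : Type u} [Category.{v} C]
    (W F : MorphismProperty C) : Prop where
  /-- the weak equivalences form a subcategory -/
  weq_multiplicative : W.IsMultiplicative
  /-- every isomorphism is a weak equivalence -/
  weq_of_isIso : ∀ {X Y : C} (f : X ⟶ Y), IsIso f → W f
  /-- if `g ∘ f` is a weak equivalence, then `f` is one if and only if `g` is -/
  weq_iff : ∀ {X Y Z : C} (f : X ⟶ Y) (g : Y ⟶ Z), W (f ≫ g) → (W f ↔ W g)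
  /-- the fibrations form a subcategory -/
  fib_multiplicative : F.IsMultiplicative
  /-- there is a terminal object -/
  hasTerminal : HasTerminal C
  /-- every object is fibrant -/
  fibrant : ∀ {X e : C}, IsTerminal e → ∀ f : X ⟶ e, F f
  /-- pullbacks of fibrations along arbitrary morphisms exist -/
  hasPullback : ∀ {X Y Z : C} (f : X ⟶ Y) (g : Z ⟶ Y), F f → HasPullback f g
  /-- pullbacks of fibrations are fibrations -/
  fib_pullback : F.IsStableUnderBaseChange
  /-- pullbacks of trivial fibrations are trivial fibrations -/
  trivialFib_pullback : (F ⊓ W).IsStableUnderBaseChange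
  /-- every morphism is a weak equivalence followed by a fibration -/
  factor : ∀ {X Y : C} (f : X ⟶ Y),
    ∃ (P : C) (r : X ⟶ P) (q : P ⟶ Y), W r ∧ F q ∧ r ≫ q = f

/-! ### Descent categories -/

/-- A descent category: a category `V` with finite limits and a subcategory `J` of covers,
stable under pullback, such that `g` is a cover whenever `f` and `g ∘ f` are covers. -/
class IsDescentCategory {V : Type u} [Category.{v} V] (J : MorphismProperty V) : Prop where
  hasFiniteLimits : HasFiniteLimits V
  isMultiplicative : J.IsMultiplicative
  isStableUnderBaseChange : J.IsStableUnderBaseChange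
  cancel : ∀ {X Y Z : V} (f : X ⟶ Y) (g : Y ⟶ Z), J f → J (f ≫ g) → J g

namespace HigherCat

/-! ### Simplicial sets -/

/-- The thick simplices: `(thick ⦋n⦌)_m` is the set of all functions
`{0, …, m} → {0, …, n}`. -/
def thick : CosimplicialObject SSet.{v} where
  obj n :=
    { obj := fun m => Fin (m.unop.len + 1) → ULift.{v} (Fin (n.len + 1))
      map := fun α => TypeCat.ofHom (fun s j => s (α.unop.toOrderHom j)) }
  map β :=
    { app := fun _ => TypeCat.ofHom (fun s j => ⟨β.toOrderHom (s j).down⟩) }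

/-- The inclusion of the vertex `i` in the thick `1`-simplex. -/
def thickVertex (i : Fin 2) : (Δ[0] : SSet.{v}) ⟶ thick.obj ⦋1⦌ where
  app m := TypeCat.ofHom (fun _ _ => ⟨i⟩)

/-! ### Mapping spaces -/

section Map

variable {V : Type u} [Category.{v} V]

/-- `Map(T, X)` for a simplicial set `T` and a simplicial space `X`, as a presheaf on `V`: its
value at `U` is the set of simplicial maps from `T` to the simplicial set `n ↦ Hom(U, X_n)`. An
object of `V` representing it is the space of simplicial morphisms from `T` to `X`; by Yoneda's
lemma, `Map(Δ[n], X)` is represented by `X_n`. -/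
def mapFunctor : SSet.{v}ᵒᵖ ⥤ SimplicialObject V ⥤ Vᵒᵖ ⥤ Type v where
  obj T :=
    { obj := fun X =>
        { obj := fun U => T.unop ⟶ X ⋙ coyoneda.obj U
          map := fun a => TypeCat.ofHom (fun t => t ≫ Functor.whiskerLeft X (coyoneda.map a)) }
      map := fun f =>
        { app := fun U =>
            TypeCat.ofHom (fun t => t ≫ Functor.whiskerRight f (coyoneda.obj U)) } }
  map i := { app := fun X => { app := fun U => TypeCat.ofHom (fun t => i.unop ≫ t) } }

/-- The presheaf `Map(T, X)`. -/
abbrev Map (T : SSet.{v}) (X : SimplicialObject V) : Vᵒᵖ ⥤ Type v :=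
  (mapFunctor.obj (op T)).obj X

/-- Restriction `Map(T, X) ⟶ Map(S, X)` along `i : S ⟶ T`. -/
abbrev Map.res {S T : SSet.{v}} (i : S ⟶ T) (X : SimplicialObject V) : Map T X ⟶ Map S X :=
  (mapFunctor.map i.op).app X

/-- Composition `Map(T, X) ⟶ Map(T, Y)` with `f : X ⟶ Y`. -/
abbrev Map.post (T : SSet.{v}) {X Y : SimplicialObject V} (f : X ⟶ Y) : Map T X ⟶ Map T Y :=
  (mapFunctor.obj (op T)).map f

/-- `Map(S ↪ T, f) = Map(S, X) ×_{Map(S, Y)} Map(T, Y)`. -/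
noncomputable abbrev RelMap {S T : SSet.{v}} (i : S ⟶ T) {X Y : SimplicialObject V} (f : X ⟶ Y) :
    Vᵒᵖ ⥤ Type v :=
  pullback (Map.post S f) (Map.res i Y)

/-- The canonical morphism `Map(T, X) ⟶ Map(S ↪ T, f)`. -/
noncomputable def toRelMap {S T : SSet.{v}} (i : S ⟶ T) {X Y : SimplicialObject V} (f : X ⟶ Y) :
    Map T X ⟶ RelMap i f :=
  pullback.lift (Map.res i X) (Map.post T f) ((mapFunctor.map i.op).naturality f).symm

/-- The functor sending a simplicial space `X` to the simplicial presheaf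
`n ↦ Map(thick ⦋n⦌, X)`. -/
def thickMap : SimplicialObject V ⥤ SimplicialObject (Vᵒᵖ ⥤ Type v) :=
  (thick.op ⋙ mapFunctor).flip

/-- The functor sending a simplicial space `G` to the simplicial representable presheaf
`n ↦ Hom(-, G_n)`. -/
def simplicialYoneda : SimplicialObject V ⥤ SimplicialObject (Vᵒᵖ ⥤ Type v) :=
  (SimplicialObject.whiskering V (Vᵒᵖ ⥤ Type v)).obj yoneda

/-! ### Groupoids, categories, fibrations and hypercovers

A morphism of presheaves satisfies `J.presheaf` if it is representable and its pullback to any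
representable presheaf is a cover; between representable presheaves, this says that it comes from
a cover in `V`. -/

variable (J : MorphismProperty V)

/-- `X` is a `k`-groupoid. -/
structure IsKGroupoid (k : ℕ) (X : SimplicialObject V) : Prop where
  cover : ∀ (n : ℕ) (i : Fin (n + 1)), 0 < n → J.presheaf (Map.res Λ[n, i].ι X)
  isIso : ∀ (n : ℕ) (i : Fin (n + 1)), 0 < n → k < n → IsIso (Map.res Λ[n, i].ι X)

/-- `X` is a `k`-category. -/
structure IsKCategory (k : ℕ) (X : SimplicialObject V) : Prop where
  cover : ∀ (n : ℕ) (i : Fin (n + 1)), 0 < i → i < Fin.last n →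
    J.presheaf (Map.res Λ[n, i].ι X)
  isIso : ∀ (n : ℕ) (i : Fin (n + 1)), 0 < i → i < Fin.last n → k < n →
    IsIso (Map.res Λ[n, i].ι X)
  vertex : ∀ i : Fin 2, J.presheaf (Map.res (thickVertex i) X)

/-- Fibrations. -/
def fibration : MorphismProperty (SimplicialObject V) := fun _ _ f =>
  ∀ (n : ℕ) (i : Fin (n + 1)), 0 < n → J.presheaf (toRelMap Λ[n, i].ι f)

/-- Quasi-fibrations. -/
def quasiFibration : MorphismProperty (SimplicialObject V) := fun _ _ f =>
  (∀ (n : ℕ) (i : Fin (n + 1)), 0 < i → i < Fin.last n → J.presheaf (toRelMap Λ[n, i].ι f)) ∧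
    ∀ i : Fin 2, J.presheaf (toRelMap (thickVertex i) f)

/-- Hypercovers. -/
def hypercover : MorphismProperty (SimplicialObject V) := fun _ _ f =>
  ∀ n : ℕ, J.presheaf (toRelMap ∂Δ[n].ι f)

/-- The category of `k`-groupoids, a full subcategory of the category of simplicial spaces. -/
abbrev KGpd (k : ℕ) := ObjectProperty.FullSubcategory (IsKGroupoid J k)

/-- The category of `k`-categories, a full subcategory of the category of simplicial spaces. -/
abbrev KCat (k : ℕ) := ObjectProperty.FullSubcategory (IsKCategory J k)

/-- The inclusion of `k`-groupoids in simplicial spaces. -/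
abbrev KGpd.incl (k : ℕ) : KGpd J k ⥤ SimplicialObject V := ObjectProperty.ι _

/-- The inclusion of `k`-categories in simplicial spaces. -/
abbrev KCat.incl (k : ℕ) : KCat J k ⥤ SimplicialObject V := ObjectProperty.ι _

/-- Fibrations of `k`-groupoids. -/
abbrev KGpd.fib (k : ℕ) : MorphismProperty (KGpd J k) :=
  (fibration J).inverseImage (KGpd.incl J k)

/-- Hypercovers of `k`-groupoids. -/
abbrev KGpd.hyper (k : ℕ) : MorphismProperty (KGpd J k) :=
  (hypercover J).inverseImage (KGpd.incl J k)

/-- Quasi-fibrations of `k`-categories. -/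
abbrev KCat.quasiFib (k : ℕ) : MorphismProperty (KCat J k) :=
  (quasiFibration J).inverseImage (KCat.incl J k)

/-- Hypercovers of `k`-categories. -/
abbrev KCat.hyper (k : ℕ) : MorphismProperty (KCat J k) :=
  (hypercover J).inverseImage (KCat.incl J k)

end Map

/-- For a class `H` of morphisms, the morphisms of the form `q ∘ s`, where `q : P ⟶ Y` and
`p : P ⟶ X` are in `H` and `s` is a section of `p`. -/
def spanWeq {C : Type u} [Category.{v} C] (H : MorphismProperty C) : MorphismProperty C :=
  fun X Y f => ∃ (P : C) (p : P ⟶ X) (q : P ⟶ Y) (s : X ⟶ P),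
    H p ∧ H q ∧ s ≫ p = 𝟙 X ∧ s ≫ q = f

/-- Weak equivalences of `k`-groupoids. -/
abbrev KGpd.weq {V : Type u} [Category.{v} V] (J : MorphismProperty V) (k : ℕ) :
    MorphismProperty (KGpd J k) :=
  spanWeq (KGpd.hyper J k)

/-- Weak equivalences of `k`-categories. -/
abbrev KCat.weq {V : Type u} [Category.{v} V] (J : MorphismProperty V) (k : ℕ) :
    MorphismProperty (KCat J k) :=
  spanWeq (KCat.hyper J k)

end HigherCat

/-! Everything reduces to attaching finitely many cells. For fixed `f`, the inclusions `i : S ⟶ T`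
for which Map(T, X) → Map(S ↪ T, f) lies in a given class of presheaf morphisms (`liftProp`) are
closed under composition and cobase change. A condition on boundaries or inner horns therefore
passes to every inclusion built from them in finitely many steps. A `k`-category is (k+1)-coskeletal
(`IsKCategory.cosk`), so cells of dimension above k+1 can be ignored. This keeps the filtrations
finite, although covers need not be stable under infinite composition, and it makes Map(T, X)
representable for every levelwise finite T (`Cosk.isRepresentable_map`).

The combinatorial core consists of three inclusions that are built from inner horns alone, up to
cells that coskeletality discards: Λ[n, i] ⊗ thick 1 ∪ Δ[n] ⊗ {0, 1} in Δ[n] ⊗ thick 1 for an inner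
horn (`Words.ι_of_hornPivot`), ∂Δ[n] ⊗ thick 1 ∪ Δ[n] ⊗ {e} in the same prism for n > 0
(`Words.ι_of_boundaryPivot`), and the thick horn in thick n for n ≥ 2 (`Words.ι_of_thickPivot`).
Each follows from an acyclic matching of nondegenerate simplices, written as words, by inserting or
deleting one interior letter (`ι_of_pairing`). The excluded cases n = 0 of the second and n = 1 of
the third are the vertex conditions in the definition of a quasi-fibration. In the first and third,
only horns of dimension at least n occur, so the isomorphism condition above `k` is inherited.

For part 1, the path object of X is its power by thick 1. Leibniz's rule
(`liftIn_iff_liftIn_unionProd`) and the first two inclusions show that it is a `k`-category, that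
its map to X × X is a quasi-fibration and that its evaluations are hypercovers. The remaining
argument is formal (`PathObjects`): `f` is a weak equivalence if and only if the projection of its
path space X ×_Y Y^(thick 1) to Y is a hypercover. With the cancellation property
`hypercover_cancel` this gives two-out-of-three, factorization and the description of trivial
fibrations.

For part 2, Map(A, 𝔾X) is Map(`thickSub A`, X) for A in Δ[n] (`Realization.thickSub`), so the third
inclusion shows that 𝔾X is a `k`-groupoid and that quasi-fibrations become fibrations. Hypercovers
are preserved because they have the cover property against every monomorphism into a levelwise
finite simplicial set. Part 3 follows because a functor preserves sections and spans of hypercovers.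
-/

set_option linter.unusedSectionVars false

namespace HigherCat

/-! ### Gap maps of commutative squares -/

section Gap

variable {D : Type*} [Category D] [HasPullbacks D] (C : MorphismProperty D)

/-- The gap map of a commutative square lies in `C`. -/
def GapIn {A B A' B' : D} (t : A ⟶ B) (l : A ⟶ A') (r : B ⟶ B') (b : A' ⟶ B') : Prop :=
  ∃ w : t ≫ r = l ≫ b, C (pullback.lift t l w)

variable {C}

/-- Any two pullbacks of the same cospan are isomorphic, so the gap map may be computed with
whichever one is at hand. -/
lemma gapIn_iff_of_isPullback [C.RespectsIso] {A B A' B' P : D} {t : A ⟶ B} {l : A ⟶ A'}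
    {r : B ⟶ B'} {b : A' ⟶ B'} {fst : P ⟶ B} {snd : P ⟶ A'} (h : IsPullback fst snd r b)
    {g : A ⟶ P} (h₁ : g ≫ fst = t) (h₂ : g ≫ snd = l) : GapIn C t l r b ↔ C g := by
  have w : t ≫ r = l ≫ b := by rw [← h₁, ← h₂, Category.assoc, Category.assoc, h.w]
  have e : g ≫ h.isoPullback.hom = pullback.lift t l w := by
    apply pullback.hom_ext <;> simp [h₁, h₂, pullback.lift_fst, pullback.lift_snd]
  rw [← C.cancel_right_of_respectsIso g h.isoPullback.hom, e]
  exact ⟨fun ⟨_, h⟩ => h, fun h => ⟨w, h⟩⟩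

lemma GapIn.of_isPullback [C.ContainsIdentities] [C.RespectsIso] {A B A' B' : D} {t : A ⟶ B}
    {l : A ⟶ A'} {r : B ⟶ B'} {b : A' ⟶ B'} (h : IsPullback t l r b) : GapIn C t l r b :=
  (gapIn_iff_of_isPullback h (Category.id_comp _) (Category.id_comp _)).2 (C.id_mem _)

lemma GapIn.flip [C.RespectsIso] {A B A' B' : D} {t : A ⟶ B} {l : A ⟶ A'}
    {r : B ⟶ B'} {b : A' ⟶ B'} (h : GapIn C t l r b) : GapIn C l t b r := by
  obtain ⟨w, h⟩ := h
  exact (gapIn_iff_of_isPullback (IsPullback.of_hasPullback r b).flip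
    (pullback.lift_snd _ _ w) (pullback.lift_fst _ _ w)).2 h

/-- The outer gap map is the gap map of the first square followed by a base change, `φ`, of the gap
map of the second. -/
lemma GapIn.paste_horiz [C.IsStableUnderBaseChange] [C.IsStableUnderComposition]
    {A B B₂ A' B' B₂' : D} {t : A ⟶ B} {t₂ : B ⟶ B₂} {l : A ⟶ A'} {m : B ⟶ B'} {r : B₂ ⟶ B₂'}
    {b : A' ⟶ B'} {b₂ : B' ⟶ B₂'} (h : GapIn C t l m b) (h₂ : GapIn C t₂ m r b₂) :
    GapIn C (t ≫ t₂) l r (b ≫ b₂) := by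
  obtain ⟨w, h⟩ := h
  obtain ⟨w₂, h₂⟩ := h₂
  let φ : pullback m b ⟶ pullback r (b ≫ b₂) :=
    pullback.lift (pullback.fst _ _ ≫ t₂) (pullback.snd _ _)
      (by rw [Category.assoc, w₂, pullback.condition_assoc])
  have hr := (IsPullback.of_hasPullback r (b ≫ b₂)).of_right' (IsPullback.of_hasPullback r b₂)
  have hφ : IsPullback (pullback.fst m b) φ (pullback.lift t₂ m w₂)
      ((IsPullback.of_hasPullback r b₂).lift (pullback.fst r (b ≫ b₂))
        (pullback.snd r (b ≫ b₂) ≫ b) (by rw [Category.assoc, pullback.condition])) := by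
    refine IsPullback.of_bot (v₂₁ := pullback.snd _ _) (v₂₂ := pullback.snd _ _) (h₃₁ := b)
      ?_ ?_ hr
    · simpa [φ, pullback.lift_snd] using IsPullback.of_hasPullback m b
    · apply (IsPullback.of_hasPullback r b₂).hom_ext <;>
        simp [φ, pullback.lift_fst, pullback.lift_snd, pullback.condition,
          pullback.lift_snd_assoc]
  refine ⟨by rw [Category.assoc, w₂, reassoc_of% w], ?_⟩
  have e : pullback.lift (t ≫ t₂) l (by rw [Category.assoc, w₂, reassoc_of% w]) =
      pullback.lift t l w ≫ φ := by
    apply pullback.hom_ext <;>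
      simp [φ, pullback.lift_fst, pullback.lift_snd, pullback.lift_fst_assoc]
  rw [e]
  exact C.comp_mem _ _ h (C.of_isPullback hφ h₂)

lemma GapIn.paste_vert [C.IsStableUnderBaseChange] [C.IsStableUnderComposition]
    {A B A' B' A₂ B₂ : D} {t : A ⟶ B} {l : A ⟶ A'} {r : B ⟶ B'} {m : A' ⟶ B'}
    {l₂ : A' ⟶ A₂} {r₂ : B' ⟶ B₂} {b : A₂ ⟶ B₂} (h : GapIn C t l r m) (h₂ : GapIn C m l₂ r₂ b) :
    GapIn C t (l ≫ l₂) (r ≫ r₂) b :=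
  (h.flip.paste_horiz h₂.flip).flip

/-- A square which is the base change of another one has its gap map in `C` if the other has. -/
lemma GapIn.base_change [C.IsStableUnderBaseChange]
    {A B A' B' A₀ B₀ A₀' B₀' : D} {t : A ⟶ B} {l : A ⟶ A'} {r : B ⟶ B'} {b : A' ⟶ B'}
    {t₀ : A₀ ⟶ B₀} {l₀ : A₀ ⟶ A₀'} {r₀ : B₀ ⟶ B₀'} {b₀ : A₀' ⟶ B₀'}
    {α : A₀ ⟶ A} {β : B₀ ⟶ B} {α' : A₀' ⟶ A'} {β' : B₀' ⟶ B'}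
    (h : GapIn C t l r b) (w₀ : t₀ ≫ r₀ = l₀ ≫ b₀)
    (hl : l₀ ≫ α' = α ≫ l) (hr : r₀ ≫ β' = β ≫ r)
    (hp : IsPullback t₀ α β t) (hp' : IsPullback b₀ α' β' b) :
    GapIn C t₀ l₀ r₀ b₀ := by
  obtain ⟨w, h⟩ := h
  have w₁ : (pullback.fst r₀ b₀ ≫ β) ≫ r = (pullback.snd r₀ b₀ ≫ α') ≫ b := by
    rw [Category.assoc, Category.assoc, ← hr, pullback.condition_assoc, hp'.w]
  have h₁ : IsPullback (pullback.fst r₀ b₀) (pullback.lift _ _ w₁) β (pullback.fst r b) := by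
    refine IsPullback.of_bot (v₂₁ := pullback.snd _ _) (v₂₂ := r) (h₃₁ := b) ?_
      (pullback.lift_fst _ _ _).symm (IsPullback.of_hasPullback r b).flip.flip
    rw [pullback.lift_snd, ← hr]
    exact (IsPullback.of_hasPullback r₀ b₀).paste_vert hp'
  refine ⟨w₀, C.of_isPullback (f' := α) (IsPullback.of_bot (v₂₁ := pullback.fst _ _)
    (v₂₂ := pullback.fst _ _) (h₃₁ := β) ?_ ?_ h₁.flip) h⟩
  · simpa [pullback.lift_fst] using hp.flip
  · apply pullback.hom_ext <;>
      simp [pullback.lift_fst, pullback.lift_snd, pullback.lift_fst_assoc,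
        pullback.lift_snd_assoc, hp.w, hl]

/-- The total gap map of a cube can be computed in two ways. -/
lemma gapIn_cube [C.RespectsIso]
    {X₁₁ X₀₁ X₁₀ X₀₀ Y₁₁ Y₀₁ Y₁₀ Y₀₀ PX PY E₁ E₀ : D}
    {xs : X₁₁ ⟶ X₀₁} {xj : X₁₁ ⟶ X₁₀} {xj' : X₀₁ ⟶ X₀₀} {xs' : X₁₀ ⟶ X₀₀}
    {ys : Y₁₁ ⟶ Y₀₁} {yj : Y₁₁ ⟶ Y₁₀} {yj' : Y₀₁ ⟶ Y₀₀} {ys' : Y₁₀ ⟶ Y₀₀}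
    {f₁₁ : X₁₁ ⟶ Y₁₁} {f₀₁ : X₀₁ ⟶ Y₀₁} {f₁₀ : X₁₀ ⟶ Y₁₀} {f₀₀ : X₀₀ ⟶ Y₀₀}
    {p₀₁ : PX ⟶ X₀₁} {p₁₀ : PX ⟶ X₁₀} {q₀₁ : PY ⟶ Y₀₁} {q₁₀ : PY ⟶ Y₁₀}
    {a₁ : E₁ ⟶ X₁₀} {b₁ : E₁ ⟶ Y₁₁} {a₀ : E₀ ⟶ X₀₀} {b₀ : E₀ ⟶ Y₀₁}
    {px : X₁₁ ⟶ PX} {py : Y₁₁ ⟶ PY} {pf : PX ⟶ PY}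
    {g₁ : X₁₁ ⟶ E₁} {g₀ : X₀₁ ⟶ E₀} {e : E₁ ⟶ E₀}
    (hPX : IsPullback p₀₁ p₁₀ xj' xs') (hPY : IsPullback q₀₁ q₁₀ yj' ys')
    (hE₁ : IsPullback a₁ b₁ f₁₀ yj) (hE₀ : IsPullback a₀ b₀ f₀₀ yj')
    (hpx₁ : px ≫ p₀₁ = xs) (hpx₂ : px ≫ p₁₀ = xj)
    (hpy₁ : py ≫ q₀₁ = ys) (hpy₂ : py ≫ q₁₀ = yj)
    (hpf₁ : pf ≫ q₀₁ = p₀₁ ≫ f₀₁) (hpf₂ : pf ≫ q₁₀ = p₁₀ ≫ f₁₀)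
    (hg₁ : g₁ ≫ a₁ = xj) (hg₁' : g₁ ≫ b₁ = f₁₁)
    (hg₀ : g₀ ≫ a₀ = xj') (hg₀' : g₀ ≫ b₀ = f₀₁)
    (he : e ≫ a₀ = a₁ ≫ xs') (he' : e ≫ b₀ = b₁ ≫ ys)
    (wX : xs ≫ xj' = xj ≫ xs') (wf : xs ≫ f₀₁ = f₁₁ ≫ ys) :
    GapIn C xs g₁ g₀ e ↔ GapIn C px f₁₁ pf py := by
  have wR : pullback.fst g₀ e ≫ xj' = (pullback.snd g₀ e ≫ a₁) ≫ xs' := by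
    rw [← hg₀, pullback.condition_assoc, he, Category.assoc]
  have w₁ : xs ≫ g₀ = g₁ ≫ e := by
    apply hE₀.hom_ext
    · simp only [Category.assoc, hg₀, he, reassoc_of% hg₁, wX]
    · simp only [Category.assoc, hg₀', he', reassoc_of% hg₁', wf]
  -- Both pullbacks compute the limit of the cube with its initial corner `X₁₁` removed.
  have hR : IsPullback (hPX.lift _ _ wR) (pullback.snd g₀ e ≫ b₁) pf py := by
    refine ⟨⟨?_⟩, ⟨PullbackCone.IsLimit.mk _
      (fun s => pullback.lift (s.fst ≫ p₀₁) (hE₁.lift (s.fst ≫ p₁₀) s.snd ?_) ?_) ?_ ?_ ?_⟩⟩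
    · apply hPY.hom_ext
      · simp only [Category.assoc, hpf₁, hpy₁, IsPullback.lift_fst_assoc]
        rw [← hg₀', pullback.condition_assoc, he']
      · simp only [Category.assoc, hpf₂, hpy₂, IsPullback.lift_snd_assoc, hE₁.w]
    · rw [Category.assoc, ← hpf₂, ← hpy₂, s.condition_assoc]
    · apply hE₀.hom_ext
      · simp only [Category.assoc, hg₀, he, IsPullback.lift_fst_assoc, hPX.w]
      · simp only [Category.assoc, hg₀', he', IsPullback.lift_snd_assoc]
        rw [← hpf₁, ← hpy₁, s.condition_assoc]
    · intro s
      apply hPX.hom_ext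
      · simp [pullback.lift_fst]
      · simp [pullback.lift_snd_assoc]
    · intro s
      simp [pullback.lift_snd_assoc]
    · intro s m hm₁ hm₂
      apply pullback.hom_ext
      · rw [pullback.lift_fst, ← hm₁]
        simp
      · rw [pullback.lift_snd]
        apply hE₁.hom_ext
        · rw [hE₁.lift_fst, ← hm₁]
          simp
        · rw [hE₁.lift_snd, ← hm₂]
          simp
  rw [gapIn_iff_of_isPullback (IsPullback.of_hasPullback g₀ e) (pullback.lift_fst _ _ w₁)
    (pullback.lift_snd _ _ w₁), gapIn_iff_of_isPullback hR]
  · apply hPX.hom_ext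
    · simp [pullback.lift_fst, hpx₁]
    · simp [pullback.lift_snd_assoc, hpx₂, hg₁]
  · simp [pullback.lift_snd_assoc, hg₁']

end Gap

/-! ### Covers of presheaves -/

section Descent

variable {V : Type u} [Category.{v} V]

lemma isRepresentable_of_iso {F G : Vᵒᵖ ⥤ Type v} (e : F ≅ G) [F.IsRepresentable] :
    G.IsRepresentable :=
  Functor.IsRepresentable.mk' (F.reprW ≪≫ e)

lemma isRepresentable_of_relativelyRepresentable {F G : Vᵒᵖ ⥤ Type v} {φ : F ⟶ G}
    (h : yoneda.relativelyRepresentable φ) [G.IsRepresentable] : F.IsRepresentable := by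
  obtain ⟨b, snd, fst, hp⟩ := h G.reprW.hom
  have := hp.isIso_fst_of_isIso
  exact Functor.IsRepresentable.mk' (asIso fst)

lemma relativelyRepresentable_of_isRepresentable [HasPullbacks V] {F G : Vᵒᵖ ⥤ Type v}
    (φ : F ⟶ G) [F.IsRepresentable] [G.IsRepresentable] : yoneda.relativelyRepresentable φ := by
  have e : φ = F.reprW.inv ≫ yoneda.map (yoneda.preimage (F.reprW.hom ≫ φ ≫ G.reprW.inv)) ≫
      G.reprW.hom := by simp
  rw [e]
  exact (MorphismProperty.cancel_left_of_respectsIso yoneda.relativelyRepresentable _ _).2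
    ((MorphismProperty.cancel_right_of_respectsIso yoneda.relativelyRepresentable _ _).2
      (Functor.relativelyRepresentable.map _ _))

lemma isRepresentable_of_isPullback [HasPullbacks V] {P F G H : Vᵒᵖ ⥤ Type v} {fst : P ⟶ F}
    {snd : P ⟶ G} {f : F ⟶ H} {g : G ⟶ H} (h : IsPullback fst snd f g)
    [F.IsRepresentable] [G.IsRepresentable] [H.IsRepresentable] : P.IsRepresentable :=
  isRepresentable_of_relativelyRepresentable (MorphismProperty.of_isPullback h.flip
    (relativelyRepresentable_of_isRepresentable g))

variable {J : MorphismProperty V} [hJ : IsDescentCategory J]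

instance : J.IsMultiplicative := hJ.isMultiplicative
instance : J.IsStableUnderBaseChange := hJ.isStableUnderBaseChange
instance : J.presheaf.IsStableUnderBaseChange :=
  MorphismProperty.relative_isStableUnderBaseChange _
instance : J.presheaf.IsMultiplicative := inferInstance

/-- Pull back to a representable presheaf, and once more to make the base change of `f` a morphism
of `V`; there it is the cancellation axiom of a descent category. -/
lemma presheaf_cancel {F G H : Vᵒᵖ ⥤ Type v} {f : F ⟶ G} {g : G ⟶ H}
    (hg : yoneda.relativelyRepresentable g) (hf : J.presheaf f) (hfg : J.presheaf (f ≫ g)) :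
    J.presheaf g := by
  refine ⟨hg, fun {a b} h fst snd hp => ?_⟩
  obtain ⟨d, snd', fst', hp'⟩ := hf.rep fst
  have h₁ := hf.property _ _ _ hp'
  have h₂ := hfg.property h fst' (snd' ≫ snd) (by
    rw [Functor.map_comp]
    exact hp'.flip.paste_horiz hp.flip |>.flip)
  exact hJ.cancel _ _ h₁ h₂

end Descent

end HigherCat

namespace HigherCat

/-! ### Mapping spaces and limits -/

section MapLimits

variable {V : Type u} [Category.{v} V]

lemma Map.res_post {S T : SSet.{v}} (i : S ⟶ T) {X Y : SimplicialObject V} (f : X ⟶ Y) :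
    Map.res i X ≫ Map.post S f = Map.post T f ≫ Map.res i Y :=
  ((mapFunctor.map i.op).naturality f).symm

lemma Map.post_comp (T : SSet.{v}) {X Y Z : SimplicialObject V} (f : X ⟶ Y) (g : Y ⟶ Z) :
    Map.post T (f ≫ g) = Map.post T f ≫ Map.post T g :=
  Functor.map_comp _ _ _

/-- At each `U`, Map(-, X) is Hom into a fixed simplicial set, so it turns colimits into limits. -/
lemma isPullback_res_of_isPushout {A B A' B' : SSet.{v}} {t : A ⟶ B} {l : A ⟶ A'} {r : B ⟶ B'}
    {b : A' ⟶ B'} (h : IsPushout t l r b) (X : SimplicialObject V) :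
    IsPullback (Map.res r X) (Map.res b X) (Map.res t X) (Map.res l X) := by
  refine IsPullback.of_forall_isPullback_app fun U => ?_
  rw [Types.isPullback_iff]
  refine ⟨?_, fun x y hxy => h.hom_ext hxy.1 hxy.2, fun x y hxy =>
    ⟨h.desc x y hxy, h.inl_desc _ _ _, h.inr_desc _ _ _⟩⟩
  rw [← NatTrans.comp_app, ← NatTrans.comp_app]
  exact congrArg (fun i => (Map.res i X).app U) h.w

lemma isPullback_post [HasPullbacks V] {P X Y Z : SimplicialObject V} {fst : P ⟶ X} {snd : P ⟶ Z}
    {f : X ⟶ Y} {g : Z ⟶ Y} (h : IsPullback fst snd f g) (T : SSet.{v}) :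
    IsPullback (Map.post T fst) (Map.post T snd) (Map.post T f) (Map.post T g) := by
  refine IsPullback.of_forall_isPullback_app fun U => ?_
  have h' : IsPullback (C := SimplexCategoryᵒᵖ ⥤ Type v)
    (((Functor.whiskeringRight _ _ _).obj (coyoneda.obj U)).map fst)
    (((Functor.whiskeringRight _ _ _).obj (coyoneda.obj U)).map snd)
    (((Functor.whiskeringRight _ _ _).obj (coyoneda.obj U)).map f)
    (((Functor.whiskeringRight _ _ _).obj (coyoneda.obj U)).map g) :=
    IsPullback.of_forall_isPullback_app fun n =>
      (IsPullback.map (C := SimplexCategoryᵒᵖ ⥤ V) ((CategoryTheory.evaluation _ _).obj n) h).map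
        (coyoneda.obj U)
  exact h'.map (coyoneda.obj (op T))

variable (C : MorphismProperty (Vᵒᵖ ⥤ Type v))

/-- The canonical morphism `Map(T, X) ⟶ Map(S ↪ T, f)` is in `C`. -/
def LiftIn {S T : SSet.{v}} (i : S ⟶ T) {X Y : SimplicialObject V} (f : X ⟶ Y) : Prop :=
  GapIn C (Map.res i X) (Map.post T f) (Map.post S f) (Map.res i Y)

variable {C}

lemma liftIn_iff {S T : SSet.{v}} {i : S ⟶ T} {X Y : SimplicialObject V} {f : X ⟶ Y} :
    LiftIn C i f ↔ C (toRelMap i f) :=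
  ⟨fun ⟨_, h⟩ => h, fun h => ⟨_, h⟩⟩

/-- The morphisms of simplicial sets whose relative mapping space for `f` is in `C`. -/
def liftProp (C : MorphismProperty (Vᵒᵖ ⥤ Type v)) {X Y : SimplicialObject V} (f : X ⟶ Y) :
    MorphismProperty SSet.{v} := fun _ _ i => LiftIn C i f

variable [C.IsStableUnderBaseChange]

lemma LiftIn.base_change [HasPullbacks V] {S T : SSet.{v}} {i : S ⟶ T}
    {P X Y Z : SimplicialObject V}
    {fst : P ⟶ X} {snd : P ⟶ Z} {f : X ⟶ Y} {g : Z ⟶ Y} (h : IsPullback fst snd f g)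
    (hf : LiftIn C i f) : LiftIn C i snd :=
  (GapIn.base_change hf.flip (Map.res_post i snd).symm (Map.res_post i fst).symm
    (Map.res_post i g).symm (isPullback_post h T).flip (isPullback_post h S).flip).flip

variable [C.IsMultiplicative]

lemma LiftIn.of_isIso_res {S T : SSet.{v}} {i : S ⟶ T} {X Y : SimplicialObject V} {f : X ⟶ Y}
    [IsIso (Map.res i X)] [IsIso (Map.res i Y)] : LiftIn C i f :=
  GapIn.of_isPullback (IsPullback.of_horiz_isIso ⟨Map.res_post i f⟩)

lemma LiftIn.of_isIso_post {S T : SSet.{v}} (i : S ⟶ T) {X Y : SimplicialObject V} (f : X ⟶ Y)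
    [IsIso f] : LiftIn C i f :=
  GapIn.of_isPullback (IsPullback.of_vert_isIso ⟨Map.res_post i f⟩)

lemma LiftIn.comp_right {S T : SSet.{v}} {i : S ⟶ T} {X Y Z : SimplicialObject V} {f : X ⟶ Y}
    {g : Y ⟶ Z} (hf : LiftIn C i f) (hg : LiftIn C i g) : LiftIn C i (f ≫ g) := by
  unfold LiftIn
  rw [Map.post_comp, Map.post_comp]
  exact GapIn.paste_vert hf hg

/-- With `f` fixed, closure under composition and, below, under cobase change is what allows cells
to be attached one at a time. -/
instance (priority := 900) liftProp_isMultiplicative {X Y : SimplicialObject V} (f : X ⟶ Y) :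
    (liftProp C f).IsMultiplicative where
  id_mem S := by
    have : IsIso (Map.res (𝟙 S) X) := inferInstanceAs (IsIso (𝟙 (Map S X)))
    have : IsIso (Map.res (𝟙 S) Y) := inferInstanceAs (IsIso (𝟙 (Map S Y)))
    exact LiftIn.of_isIso_res
  comp_mem _ _ hi hj := GapIn.paste_horiz hj hi

instance liftProp_isStableUnderCobaseChange {X Y : SimplicialObject V} (f : X ⟶ Y) :
    (liftProp C f).IsStableUnderCobaseChange where
  of_isPushout sq hi :=
    GapIn.base_change hi (Map.res_post _ f) (Map.res_post _ f).symm (Map.res_post _ f).symm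
      (isPullback_res_of_isPushout sq X) (isPullback_res_of_isPushout sq Y)

lemma liftIn_congr {X Y : SimplicialObject V} (f : X ⟶ Y) {S T S' T' : SSet.{v}}
    {i : S ⟶ T} {i' : S' ⟶ T'} (e : Arrow.mk i ≅ Arrow.mk i') : LiftIn C i f ↔ LiftIn C i' f :=
  (liftProp C f).arrow_mk_iso_iff e

end MapLimits

end HigherCat

namespace HigherCat

/-! ### Attaching simplices -/

section Attach

open SSet

/-- A subcomplex `C` and a morphism `f` which is injective on nondegenerate simplices outside of
`C` give a pushout square. -/
lemma isPushout_sup_range {X Y : SSet.{v}} (C : X.Subcomplex) (f : Y ⟶ X) {B : Y.Subcomplex}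
    (hB : C.preimage f = B)
    (hnd : ∀ s : B.N, f.app _ s.simplex ∈ X.nonDegenerate _)
    (hinj : ∀ s t : B.N, S.mk (f.app _ s.simplex) = S.mk (f.app _ t.simplex) → s = t)
    {C' : X.Subcomplex} (hC : C ≤ C') (hf : Subcomplex.range f ≤ C')
    (hC' : C' ≤ C ⊔ Subcomplex.range f) :
    IsPushout (Subcomplex.lift (B.ι ≫ f) (by
      subst hB
      rintro _ _ ⟨⟨x, hx⟩, rfl⟩
      exact hx) : (B : SSet) ⟶ C) B.ι (Subcomplex.homOfLE hC) (Subcomplex.lift f hf) where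
  w := rfl
  isColimit' := ⟨evaluationJointlyReflectsColimits _ (fun ⟨⟨d⟩⟩ ↦ by
    refine (isColimitMapCoconePushoutCoconeEquiv _ _).symm (IsPushout.isColimit ?_)
    refine Types.isPushout_of_isPullback_of_mono' ?_ ?_ (fun x₁ x₂ hx₁ hx₂ h ↦ ?_)
    · subst hB
      rw [Types.isPullback_iff]
      refine ⟨rfl, fun x y h => Subtype.ext h.2, fun x y h => ⟨⟨y, ?_⟩, ?_, rfl⟩⟩
      · have := congrArg Subtype.val h
        change f.app _ y ∈ C.obj _
        dsimp at this
        rw [← this]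
        exact x.2
      · exact Subtype.ext (congrArg Subtype.val h).symm
    · ext ⟨x, hx⟩
      refine ⟨fun _ => trivial, fun _ => ?_⟩
      obtain h | ⟨y, hy⟩ := hC' _ hx
      · exact Or.inl ⟨⟨x, h⟩, rfl⟩
      · exact Or.inr ⟨y, Subtype.ext hy⟩
    -- Eilenberg–Zilber: both simplices are degeneracies of nondegenerate ones outside of `B`. These
    -- coincide by `hinj`, and then the degeneracy operators coincide by uniqueness.
    · have hx₁' : x₁ ∉ B.obj _ := fun h => hx₁ ⟨⟨x₁, h⟩, rfl⟩
      have hx₂' : x₂ ∉ B.obj _ := fun h => hx₂ ⟨⟨x₂, h⟩, rfl⟩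
      replace h : f.app _ x₁ = f.app _ x₂ := congrArg Subtype.val h
      obtain ⟨s₁, g₁, _, hg₁⟩ := B.existsN x₁ hx₁'
      obtain ⟨s₂, g₂, _, hg₂⟩ := B.existsN x₂ hx₂'
      have e₁ : f.app _ x₁ = X.map g₁.op (f.app _ s₁.simplex) := by
        rw [← hg₁, NatTrans.naturality_apply]
      have e₂ : f.app _ x₁ = X.map g₂.op (f.app _ s₂.simplex) := by
        rw [h, ← hg₂, NatTrans.naturality_apply]
      obtain rfl : s₁ = s₂ := hinj _ _ (by
        rw [S.eq_iff_ofSimplex_eq _ _ (hnd _) (hnd _), ← Subcomplex.ofSimplex_map_of_epi g₁,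
          ← Subcomplex.ofSimplex_map_of_epi g₂, ← e₁, ← e₂])
      obtain rfl := X.unique_nonDegenerate_map _ g₁ ⟨_, hnd s₁⟩ e₁ g₂ ⟨_, hnd s₁⟩ e₂
      rw [← hg₁, hg₂])⟩

lemma yonedaEquiv_symm_app_objEquiv_symm {X : SSet.{v}} {n d : ℕ} (x : X _⦋n⦌) (g : ⦋d⦌ ⟶ ⦋n⦌) :
    (yonedaEquiv.symm x).app (op ⦋d⦌) (stdSimplex.objEquiv.symm g) = X.map g.op x := rfl

lemma nonDegenerate_of_mk_eq {X : SSet.{v}} {n m : ℕ} {x : X _⦋n⦌} {y : X _⦋m⦌}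
    (h : S.mk x = S.mk y) (hy : y ∈ X.nonDegenerate m) : x ∈ X.nonDegenerate n := by
  obtain rfl := S.dim_eq_of_mk_eq h
  rw [S.ext_iff] at h
  rwa [h]

lemma preimage_boundary {X : SSet.{v}} (C : X.Subcomplex) {n : ℕ} (x : X _⦋n⦌)
    (hx : x ∉ C.obj _) (h : ∀ d < n, ∀ g : ⦋d⦌ ⟶ ⦋n⦌, X.map g.op x ∈ C.obj _) :
    C.preimage (yonedaEquiv.symm x) = ∂Δ[n] := by
  rw [stdSimplex.eq_boundary_iff]
  refine ⟨?_, fun h' => hx ?_⟩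
  · rw [Subcomplex.le_iff_contains_nonDegenerate]
    rintro d ⟨y, hy⟩ hy'
    obtain ⟨g, rfl⟩ := stdSimplex.objEquiv.symm.surjective y
    have := dim_lt_of_nonDegenerate (X := (∂Δ[n] : SSet.{v}))
      ⟨⟨_, hy'⟩, (Subcomplex.mem_nonDegenerate_iff _ _).2 hy⟩ n
    exact h d this g
  · have : stdSimplex.objEquiv.symm (𝟙 ⦋n⦌) ∈
      (C.preimage (yonedaEquiv.symm x)).obj (op ⦋n⦌) := by rw [h']; trivial
    change X.map (𝟙 _) x ∈ C.obj _ at this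
    simpa using this

variable {P : MorphismProperty SSet.{v}} [P.IsStableUnderCobaseChange]

/-- The cell `x` need not be embedded: Δ[n] has a single nondegenerate simplex outside its boundary,
so injectivity there is automatic and the attaching square is a pushout. -/
lemma homOfLE_of_boundary {X : SSet.{v}} (C : X.Subcomplex) {n : ℕ} (x : X _⦋n⦌)
    (hx : x ∉ C.obj _) (hx' : x ∈ X.nonDegenerate n)
    (h : ∀ d < n, ∀ g : ⦋d⦌ ⟶ ⦋n⦌, X.map g.op x ∈ C.obj _) (hP : P ∂Δ[n].ι) :
    P (Subcomplex.homOfLE (le_sup_left : C ≤ C ⊔ Subcomplex.ofSimplex x)) := by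
  have key (s : (∂Δ[n] : (Δ[n] : SSet.{v}).Subcomplex).N) :
      S.mk s.simplex = S.mk (stdSimplex.objEquiv.symm (𝟙 ⦋n⦌)) := by
    obtain ⟨d, s, hs, hs', rfl⟩ := s.mk_surjective
    obtain ⟨g, rfl⟩ := stdSimplex.objEquiv.symm.surjective s
    rw [stdSimplex.objEquiv_symm_mem_nonDegenerate_iff_mono] at hs
    obtain hd | rfl := (SimplexCategory.le_of_mono g).lt_or_eq
    · exact (hs' (by simp [boundary_obj_eq_univ d n hd])).elim
    · obtain rfl := SimplexCategory.eq_id_of_mono g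
      rfl
  have key' (s : (∂Δ[n] : (Δ[n] : SSet.{v}).Subcomplex).N) :
      S.mk ((yonedaEquiv.symm x).app _ s.simplex) = S.mk x := by
    refine (congrArg (S.map (yonedaEquiv.symm x)) (key s)).trans ?_
    change S.mk (X.map (𝟙 _) x) = _
    simp
  refine P.of_isPushout (isPushout_sup_range C (yonedaEquiv.symm x) (preimage_boundary C x hx h)
    (fun s => ?_) (fun s t _ => ?_) le_sup_left ?_ ?_) hP
  · exact nonDegenerate_of_mk_eq (key' s) hx'
  · rw [Subcomplex.N.eq_iff_sMk_eq, key, key]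
  · rw [Subcomplex.range_eq_ofSimplex, Equiv.apply_symm_apply]
    exact le_sup_right
  · rw [Subcomplex.range_eq_ofSimplex, Equiv.apply_symm_apply]

lemma horn_N_cases {n : ℕ} {p : Fin (n + 2)}
    (s : (Λ[n + 1, p] : (Δ[n + 1] : SSet.{v}).Subcomplex).N) :
    S.mk s.simplex = S.mk (stdSimplex.objEquiv.symm (𝟙 ⦋n + 1⦌)) ∨
      S.mk s.simplex = S.mk (stdSimplex.objEquiv.symm (SimplexCategory.δ p)) := by
  obtain ⟨d, s, hs, hs', rfl⟩ := s.mk_surjective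
  obtain ⟨g, rfl⟩ := stdSimplex.objEquiv.symm.surjective s
  rw [stdSimplex.objEquiv_symm_mem_nonDegenerate_iff_mono] at hs
  obtain hd | rfl := (SimplexCategory.le_of_mono g).lt_or_eq
  · rw [Nat.lt_succ_iff] at hd
    obtain hd | rfl := hd.lt_or_eq
    · exact (hs' (by simp [horn_obj_eq_univ p d (by lia)])).elim
    · obtain ⟨i, rfl⟩ := SimplexCategory.eq_δ_of_mono g
      obtain rfl := (objEquiv_symm_δ_notMem_horn_iff _ _).mp hs'
      exact Or.inr rfl
  · obtain rfl := SimplexCategory.eq_id_of_mono g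
    exact Or.inl rfl

lemma preimage_horn {X : SSet.{v}} (C : X.Subcomplex) {n : ℕ} (x : X _⦋n + 1⦌) (p : Fin (n + 2))
    (hx : X.δ p x ∉ C.obj _) (h : ∀ j ≠ p, X.δ j x ∈ C.obj _) :
    C.preimage (yonedaEquiv.symm x) = Λ[n + 1, p] := by
  refine le_antisymm ?_ ?_
  · rw [subcomplex_le_horn_iff, stdSimplex.face_singleton_compl, Subcomplex.ofSimplex_le_iff]
    exact hx
  · rw [horn_eq_iSup, iSup_le_iff]
    rintro ⟨j, hj⟩
    rw [stdSimplex.face_singleton_compl, Subcomplex.ofSimplex_le_iff]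
    exact h j hj

/-- Only two nondegenerate simplices lie outside the horn, and their images `x` and `X.δ p x` are
nondegenerate of different dimensions, hence cannot be identified. -/
lemma homOfLE_of_horn {X : SSet.{v}} (C : X.Subcomplex) {n : ℕ} (x : X _⦋n + 1⦌) (p : Fin (n + 2))
    (hx₁ : x ∈ X.nonDegenerate _) (hx₂ : X.δ p x ∈ X.nonDegenerate _)
    (hx : X.δ p x ∉ C.obj _) (h : ∀ j ≠ p, X.δ j x ∈ C.obj _) (hP : P Λ[n + 1, p].ι) :
    P (Subcomplex.homOfLE (le_sup_left : C ≤ C ⊔ Subcomplex.ofSimplex x)) := by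
  have e₁ : S.mk ((yonedaEquiv.symm x).app _ (stdSimplex.objEquiv.symm (𝟙 ⦋n + 1⦌))) =
      S.mk x := by
    change S.mk (X.map (𝟙 _) x) = _
    simp
  have e₂ : S.mk ((yonedaEquiv.symm x).app _ (stdSimplex.objEquiv.symm (SimplexCategory.δ p))) =
      S.mk (X.δ p x) := rfl
  have key (s : (Λ[n + 1, p] : (Δ[n + 1] : SSet.{v}).Subcomplex).N) :
      S.mk ((yonedaEquiv.symm x).app _ s.simplex) = S.mk x ∧
        S.mk s.simplex = S.mk (stdSimplex.objEquiv.symm (𝟙 ⦋n + 1⦌)) ∨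
      S.mk ((yonedaEquiv.symm x).app _ s.simplex) = S.mk (X.δ p x) ∧
        S.mk s.simplex = S.mk (stdSimplex.objEquiv.symm (SimplexCategory.δ p)) := by
    obtain h | h := horn_N_cases s
    · exact Or.inl ⟨(congrArg (S.map (yonedaEquiv.symm x)) h).trans e₁, h⟩
    · exact Or.inr ⟨(congrArg (S.map (yonedaEquiv.symm x)) h).trans e₂, h⟩
  refine P.of_isPushout (isPushout_sup_range C (yonedaEquiv.symm x) (preimage_horn C x p hx h)
    (fun s => ?_) (fun s t hst => ?_) le_sup_left ?_ ?_) hP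
  · obtain h | h := key s
    · exact nonDegenerate_of_mk_eq h.1 hx₁
    · exact nonDegenerate_of_mk_eq h.1 hx₂
  · rw [Subcomplex.N.eq_iff_sMk_eq]
    obtain ⟨h₁, h₂⟩ | ⟨h₁, h₂⟩ := key s <;> obtain ⟨h₃, h₄⟩ | ⟨h₃, h₄⟩ := key t
    · rw [h₂, h₄]
    · have := S.dim_eq_of_mk_eq (h₁.symm.trans (hst.trans h₃))
      lia
    · have := S.dim_eq_of_mk_eq (h₁.symm.trans (hst.trans h₃))
      lia
    · rw [h₂, h₄]
  · rw [Subcomplex.range_eq_ofSimplex, Equiv.apply_symm_apply]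
    exact le_sup_right
  · rw [Subcomplex.range_eq_ofSimplex, Equiv.apply_symm_apply]

/-- Take the nondegenerate simplex outside of `A` of which `x` is a degeneracy. A section of the
degeneracy operator exhibits it as a face of `x`, so it stays in `B`. -/
lemma exists_nonDegenerate_notMem {X : SSet.{v}} {A B : X.Subcomplex} {n : ℕ} {x : X _⦋n⦌}
    (hB : x ∈ B.obj _) (hA : x ∉ A.obj _) :
    ∃ d ≤ n, ∃ y ∈ X.nonDegenerate d, y ∈ B.obj _ ∧ y ∉ A.obj _ := by
  obtain ⟨s, f, hf, rfl⟩ := A.existsN x hA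
  refine ⟨s.dim, SimplexCategory.len_le_of_epi f, s.simplex, s.nonDegenerate, ?_, s.notMem⟩
  have := isSplitEpi_of_epi f
  have h := B.map (section_ f).op hB
  have e : X.map (section_ f).op (X.map f.op s.simplex) = s.simplex := by
    rw [← Functor.map_comp_apply, ← op_comp, IsSplitEpi.id, op_id,
      Functor.map_id_apply]
  rw [← e]
  exact h

lemma homOfLE_of_le_of_le {X : SSet.{v}} [P.IsMultiplicative] {A B C : X.Subcomplex} (h : A ≤ B)
    (h' : B ≤ C) (hAB : P (Subcomplex.homOfLE h)) (hBC : P (Subcomplex.homOfLE h')) :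
    P (Subcomplex.homOfLE (h.trans h')) :=
  P.comp_mem _ _ hAB hBC

/-- An inclusion of subcomplexes is in `P` if the boundary inclusions of the attached cells
are, where the cells above some dimension can be ignored. -/
lemma homOfLE_of_cells [P.IsMultiplicative] {X : SSet.{v}} [∀ d, Finite (X _⦋d⦌)] (N : ℕ)
    (htr : ∀ (A B : X.Subcomplex) (h : A ≤ B),
      (∀ d ≤ N, B.obj (op ⦋d⦌) ⊆ A.obj _) → P (Subcomplex.homOfLE h))
    (A B : X.Subcomplex) (h : A ≤ B)
    (hP : ∀ d ≤ N, ∀ x ∈ X.nonDegenerate d, x ∈ B.obj _ → x ∉ A.obj _ → P ∂Δ[d].ι) :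
    P (Subcomplex.homOfLE h) := by
  -- Only cells of dimension at most `N` are counted, so the induction is finite even if `X` has
  -- nondegenerate simplices in every dimension. The remaining cells are left to `htr`.
  let S (A : X.Subcomplex) : Set (Σ d : Fin (N + 1), X _⦋d⦌) :=
    {x | x.2 ∈ X.nonDegenerate _ ∧ x.2 ∈ B.obj _ ∧ x.2 ∉ A.obj _}
  induction hn : (S A).ncard using Nat.strong_induction_on generalizing A with
  | _ n ih =>
    by_cases hS : ∃ d ≤ N, ∃ x ∈ X.nonDegenerate d, x ∈ B.obj _ ∧ x ∉ A.obj _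
    · classical
      obtain ⟨hd, x, hx, hxB, hxA⟩ := Nat.find_spec hS
      have hmin := fun m hm => Nat.find_min hS (m := m) hm
      generalize Nat.find hS = d at hd x hx hxB hxA hmin
      have hlow (e : ℕ) (he : e < d) (g : ⦋e⦌ ⟶ ⦋d⦌) : X.map g.op x ∈ A.obj _ := by
        by_contra hA
        obtain ⟨m, hm, y, hy⟩ := exists_nonDegenerate_notMem (B.map g.op hxB) hA
        exact hmin m (hm.trans_lt he) ⟨by lia, y, hy⟩
      have hle : A ⊔ Subcomplex.ofSimplex x ≤ B :=
        sup_le h ((Subcomplex.ofSimplex_le_iff _ _).2 hxB)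
      refine homOfLE_of_le_of_le le_sup_left hle
        (homOfLE_of_boundary A x hxA hx hlow (hP d hd x hx hxB hxA))
        (ih _ ?_ _ hle (fun e he y hy hyB hyA => hP e he y hy hyB fun h' => hyA (Or.inl h')) rfl)
      rw [← hn]
      refine Set.ncard_lt_ncard ⟨fun y hy => ⟨hy.1, hy.2.1, fun h' => hy.2.2 (Or.inl h')⟩,
        fun hsub => (hsub (a := ⟨⟨d, by lia⟩, x⟩) ⟨hx, hxB, hxA⟩).2.2
          (Or.inr (Subcomplex.mem_ofSimplex_obj x))⟩ (Set.toFinite _)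
    · refine htr A B h fun d hd x hx => ?_
      by_contra hA
      obtain ⟨m, hm, y, hy⟩ := exists_nonDegenerate_notMem hx hA
      exact hS ⟨m, hm.trans hd, y, hy⟩

lemma ι_of_homOfLE_top [P.IsMultiplicative] {X : SSet.{v}} (A : X.Subcomplex)
    (h : P (Subcomplex.homOfLE (le_top : A ≤ ⊤))) : P A.ι :=
  (P.arrow_mk_iso_iff (Arrow.isoMk (f := Arrow.mk (Subcomplex.homOfLE (le_top : A ≤ ⊤)))
    (g := Arrow.mk A.ι) (Iso.refl _) (Subcomplex.topIso X))).1 h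

/-- The inclusion of a subcomplex `A` is in `P` if the nondegenerate simplices outside of `A` are
matched in pairs `(δ p w, w)` with `I w p`, in such a way that the horn inclusions
`Λ[n + 1, p]` are in `P`. -/
lemma ι_of_pairing [P.IsMultiplicative] {X : SSet.{v}} [∀ d, Finite (X _⦋d⦌)] (N : ℕ)
    (htr : ∀ (A B : X.Subcomplex) (h : A ≤ B),
      (∀ d ≤ N, B.obj (op ⦋d⦌) ⊆ A.obj _) → P (Subcomplex.homOfLE h))
    (A : X.Subcomplex) (I : ∀ n, X _⦋n + 1⦌ → Fin (n + 2) → Prop)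
    (r : ∀ n, X _⦋n + 1⦌ → Fin (n + 2) → ℕ)
    (hI₁ : ∀ n w p, I n w p → w ∈ X.nonDegenerate _)
    (hI₂ : ∀ n w p, I n w p → X.δ p w ∈ X.nonDegenerate _)
    (hIA : ∀ n w p, I n w p → X.δ p w ∉ A.obj _)
    (hex : ∀ n, ∀ x ∈ X.nonDegenerate n, x ∉ A.obj _ →
      (∃ (m : ℕ) (e : n = m + 1) (p : Fin (m + 2)), I m (e ▸ x) p) ∨
        ∃ w p, I n w p ∧ X.δ p w = x)
    (hdis : ∀ n w p q, I (n + 1) w p → ¬ I n (X.δ p w) q)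
    (hinj : ∀ n w w' p p', I n w p → I n w' p' → X.δ p w = X.δ p' w' → w = w')
    (hr : ∀ n w p j w' p', I n w p → j ≠ p → I n w' p' → X.δ j w = X.δ p' w' →
      r n w' p' < r n w p)
    (hP : ∀ n w p, I n w p → n ≤ N → P Λ[n + 1, p].ι) : P A.ι := by
  apply ι_of_homOfLE_top
  -- The induction runs over subcomplexes that contain an upper cell as soon as they contain its
  -- matched face. For `A` this is vacuous, since matched faces lie outside of `A`.
  suffices H : ∀ C : X.Subcomplex, A ≤ C →
      (∀ n w p, I n w p → X.δ p w ∈ C.obj _ → w ∈ C.obj _) →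
      P (Subcomplex.homOfLE (le_top : C ≤ ⊤)) by
    exact H A le_rfl fun n w p h h' => (hIA n w p h h').elim
  let S (C : X.Subcomplex) : Set (Σ d : Fin (N + 1), X _⦋d + 1⦌ × Fin (d + 2)) :=
    {x | I _ x.2.1 x.2.2 ∧ X.δ x.2.2 x.2.1 ∉ C.obj _}
  intro C hAC hC
  induction hn : (S C).ncard using Nat.strong_induction_on generalizing C with
  | _ n ih =>
    by_cases hS : ∃ d ≤ N, ∃ w p, I d w p ∧ X.δ p w ∉ C.obj _
    · classical
      obtain ⟨hd, hS'⟩ := Nat.find_spec hS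
      have hmin := fun m hm => Nat.find_min hS (m := m) hm
      generalize Nat.find hS = d at hd hS' hmin
      -- Among the missing pairs of least dimension, one of least rank is filled first; all faces of
      -- `w` except the matched one are then already present.
      have hT : ∃ a, ∃ w p, I d w p ∧ X.δ p w ∉ C.obj _ ∧ r d w p = a :=
        let ⟨w, p, h, h'⟩ := hS'
        ⟨_, w, p, h, h', rfl⟩
      obtain ⟨w, p, hw, hwC, ha⟩ := Nat.find_spec hT
      have hmin' := fun m hm => Nat.find_min hT (m := m) hm
      rw [← ha] at hmin'
      have hlow (e : ℕ) (he : e < d) (x : X _⦋e⦌) : x ∈ C.obj _ := by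
        by_contra hx
        obtain ⟨m, hm, y, hy, -, hyC⟩ := exists_nonDegenerate_notMem (B := ⊤) trivial hx
        obtain ⟨m, rfl, q, hq⟩ | ⟨v, q, hv, rfl⟩ := hex m y hy fun h => hyC (hAC _ h)
        · refine hyC (hC _ _ _ hq ?_)
          by_contra h'
          exact hmin m (by lia) ⟨by lia, _, _, hq, h'⟩
        · exact hmin m (by lia) ⟨by lia, _, _, hv, hyC⟩
      -- A missing face would be nondegenerate of dimension `d`. As an upper cell it would have its
      -- partner in lower dimension, hence in `C`; as a lower cell it would belong to a missing pair
      -- of smaller rank.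
      have hface (j : Fin (d + 2)) (hj : j ≠ p) : X.δ j w ∈ C.obj _ := by
        by_contra hx
        obtain ⟨m, hm, y, hy, -, hyC⟩ := exists_nonDegenerate_notMem (B := ⊤) trivial hx
        obtain hm | rfl := hm.lt_or_eq
        · exact hyC (hlow _ hm _)
        obtain ⟨s, f, hf, hs⟩ := C.existsN _ hx
        obtain hs' | hs' := (SimplexCategory.len_le_of_epi f).lt_or_eq
        · exact s.notMem (hlow _ hs' _)
        have hnd : X.δ j w ∈ X.nonDegenerate _ := by
          obtain ⟨e, s, hs₁, hs₂, rfl⟩ := s.mk_surjective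
          obtain rfl : e = m := hs'
          obtain rfl := SimplexCategory.eq_id_of_epi f
          rw [← hs]
          simpa using! hs₁
        obtain ⟨m, rfl, q, hq⟩ | ⟨v, q, hv, e⟩ := hex _ _ hnd fun h => hx (hAC _ h)
        · exact hx (hC _ _ _ hq (hlow _ (by lia) _))
        · exact hmin' _ (hr _ _ _ _ _ _ hw hj hv e.symm) ⟨v, q, hv, e ▸ hx, rfl⟩
      refine homOfLE_of_le_of_le le_sup_left le_top
        (homOfLE_of_horn C w p (hI₁ _ _ _ hw) (hI₂ _ _ _ hw) hwC hface (hP _ _ _ hw hd))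
        (ih _ ?_ _ (hAC.trans le_sup_left) (fun m v q hv h => ?_) rfl)
      · rw [← hn]
        refine Set.ncard_lt_ncard ⟨fun y hy => ⟨hy.1, fun h' => hy.2 (Or.inl h')⟩,
          fun hsub => (hsub (a := ⟨⟨d, by lia⟩, w, p⟩) ⟨hw, hwC⟩).2
            (Or.inr ?_)⟩ (Set.toFinite _)
        exact ⟨_, rfl⟩
      -- The closure condition survives the attachment: a matched face that is newly present is
      -- either the matched face of `w`, and then `v = w` by `hinj`, or `w` itself, which `hdis`
      -- rules out.
      · by_cases hC' : X.δ q v ∈ C.obj _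
        · exact Or.inl (hC _ _ _ hv hC')
        · obtain ⟨g, hg⟩ : X.δ q v ∈ (Subcomplex.ofSimplex w).obj _ := h.resolve_left hC'
          obtain ⟨g⟩ := g
          change ⦋m⦌ ⟶ ⦋d + 1⦌ at g
          replace hg : X.map g.op w = X.δ q v := hg
          have := X.mono_of_nonDegenerate ⟨_, hI₂ _ _ _ hv⟩ g w hg
          obtain hm | hm := (SimplexCategory.len_le_of_mono g).lt_or_eq
          · obtain hm | hm := (Nat.lt_succ_iff.1 hm).lt_or_eq
            · exact (hC' (hlow _ hm _)).elim
            · obtain rfl : m = d := hm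
              obtain ⟨j, rfl⟩ := SimplexCategory.eq_δ_of_mono g
              by_cases hj : j = p
              · subst hj
                rw [hinj _ _ _ _ _ hv hw hg.symm]
                exact Or.inr (Subcomplex.mem_ofSimplex_obj w)
              · exact (hC' (hg ▸ hface j hj)).elim
          · obtain rfl : m = d + 1 := hm
            obtain rfl := SimplexCategory.eq_id_of_mono g
            refine (hdis _ _ _ p hv ?_).elim
            rw [← hg]
            simpa using! hw
    · refine htr C ⊤ le_top fun d hd x hx => ?_
      by_contra hA
      obtain ⟨m, hm, y, hy, -, hyC⟩ := exists_nonDegenerate_notMem (B := ⊤) trivial hA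
      obtain ⟨m, rfl, q, hq⟩ | ⟨v, q, hv, rfl⟩ := hex m y hy fun h => hyC (hAC _ h)
      · refine hyC (hC _ _ _ hq ?_)
        by_contra h'
        exact hS ⟨m, by lia, _, _, hq, h'⟩
      · exact hS ⟨m, by lia, _, _, hv, hyC⟩

end Attach

end HigherCat

namespace HigherCat

/-! ### Coskeletal simplicial spaces -/

section Coskeletal

open SSet

variable {V : Type u} [Category.{v} V]

instance isLocal_isStableUnderCobaseChange {C : Type*} [Category* C] (Q : ObjectProperty C) :
    Q.isLocal.IsStableUnderCobaseChange where
  of_isPushout sq hi Z hZ := by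
    refine ⟨fun a b h => sq.hom_ext h ((hi Z hZ).1 ?_), fun a => ?_⟩
    · dsimp at h ⊢
      rw [← sq.w_assoc, ← sq.w_assoc, h]
    · obtain ⟨c, hc⟩ := (hi Z hZ).2 (_ ≫ a)
      exact ⟨sq.desc a c hc.symm, sq.inl_desc _ _ _⟩

instance isLocal_isStableUnderColimitsOfShape {C : Type*} [Category* C] (Q : ObjectProperty C)
    (K : Type*) [Category* K] : Q.isLocal.IsStableUnderColimitsOfShape K where
  condition X₁ X₂ c₁ c₂ h₁ h₂ f hf φ hφ Z hZ := by
    refine ⟨fun a b h => h₂.hom_ext fun j => (hf j Z hZ).1 ?_, fun a => ?_⟩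
    · have := congrArg (fun x => c₁.ι.app j ≫ x) h
      simpa only [reassoc_of% hφ] using! this
    · choose b hb using fun j => (hf j Z hZ).2 (c₁.ι.app j ≫ a)
      dsimp at hb
      refine ⟨h₂.desc ⟨Z, ⟨b, fun j k g => (hf j Z hZ).1 ?_⟩⟩, h₁.hom_ext fun j => ?_⟩
      · simp [hb, ← f.naturality_assoc]
      · simp [reassoc_of% hφ, h₂.fac, hb]

instance isLocal_isStableUnderCoproducts {C : Type*} [Category* C] (Q : ObjectProperty C) :
    MorphismProperty.IsStableUnderCoproducts.{v} Q.isLocal where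

/-- The morphisms `i` of simplicial sets for which restriction along `i` is in `C`. -/
def resProp (C : MorphismProperty (Vᵒᵖ ⥤ Type v)) (X : SimplicialObject V) :
    MorphismProperty SSet.{v} := fun _ _ i => C (Map.res i X)

section

variable (C : MorphismProperty (Vᵒᵖ ⥤ Type v)) (X : SimplicialObject V)

instance [C.IsMultiplicative] : (resProp C X).IsMultiplicative where
  id_mem S := C.id_mem (Map S X)
  comp_mem _ _ hi hj := C.comp_mem _ _ hj hi

instance [C.IsStableUnderBaseChange] : (resProp C X).IsStableUnderCobaseChange where
  of_isPushout sq hi := C.of_isPullback (isPullback_res_of_isPushout sq X).flip hi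

end

/-- The simplicial space `X` is `N`-coskeletal. -/
def Cosk (N : ℕ) (X : SimplicialObject V) : Prop :=
  ∀ d, N < d → IsIso (Map.res ∂Δ[d].ι X)

lemma isIso_res_iff {X : SimplicialObject V} {S T : SSet.{v}} (i : S ⟶ T) :
    IsIso (Map.res i X) ↔
      (ObjectProperty.ofObj fun U => X ⋙ coyoneda.obj U).isLocal i := by
  rw [NatTrans.isIso_iff_isIso_app]
  simp only [isIso_iff_bijective]
  exact ⟨fun h _ ⟨U⟩ => h U, fun h U => h _ ⟨U⟩⟩

variable {N : ℕ} {X : SimplicialObject V}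

/-- Unlike covers, isomorphisms tolerate infinitely many cells: restriction is invertible exactly
when the inclusion is local for the simplicial sets Hom(U, X), and local maps are closed under
coproducts, pushouts and transfinite composition. All relative cells of `i` have dimension above
`N`. -/
lemma Cosk.isIso_res (hX : Cosk N X) {S T : SSet.{v}} (i : S ⟶ T) [Mono i]
    (hi : ∀ d ≤ N, Function.Surjective (i.app (op ⦋d⦌))) : IsIso (Map.res i X) := by
  rw [isIso_res_iff]
  let W := (ObjectProperty.ofObj fun U => X ⋙ coyoneda.obj U).isLocal
  have h := (relativeCellComplexOfMono i).transfiniteCompositionOfShape' (I := W) (fun s => by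
    refine (isIso_res_iff _).1 (hX _ ?_)
    by_contra hs
    obtain ⟨y, hy⟩ := hi _ (not_lt.1 hs) s.k.simplex
    exact s.k.notMem ⟨y, hy⟩)
  exact W.transfiniteCompositionsOfShape_le _ _
    ((h.ofLE ((MorphismProperty.pushouts_monotone W.coproducts_le).trans W.pushouts_le)).mem)

lemma Cosk.isIso_res_homOfLE (hX : Cosk N X) {T : SSet.{v}} (A B : T.Subcomplex) (h : A ≤ B)
    (h' : ∀ d ≤ N, B.obj (op ⦋d⦌) ⊆ A.obj _) : IsIso (Map.res (Subcomplex.homOfLE h) X) :=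
  hX.isIso_res _ fun d hd x => ⟨⟨x.1, h' d hd x.2⟩, rfl⟩

lemma isIso_of_comp_mono {D : Type*} [Category* D] {A B C : D} (f : A ⟶ B) (g : B ⟶ C)
    [Mono g] [IsIso (f ≫ g)] : IsIso f := by
  have : IsSplitEpi g := .mk' ⟨inv (f ≫ g) ≫ f, by simp⟩
  have := isIso_of_mono_of_isSplitEpi g
  exact IsIso.of_isIso_comp_right f g

lemma boundary_eq_horn_sup {n : ℕ} (p : Fin (n + 2)) :
    (∂Δ[n + 1] : (Δ[n + 1] : SSet.{v}).Subcomplex) =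
      Λ[n + 1, p] ⊔ Subcomplex.ofSimplex (stdSimplex.objEquiv.symm (SimplexCategory.δ p)) := by
  rw [← stdSimplex.face_singleton_compl, boundary_eq_iSup, horn_eq_iSup]
  refine le_antisymm (iSup_le fun i => ?_) (sup_le (iSup_le fun i => ?_) ?_)
  · by_cases hi : i = p
    · subst hi
      exact le_sup_right
    · exact (le_iSup (fun j : ({p}ᶜ : Set (Fin (n + 2))) => stdSimplex.face {j.1}ᶜ)
        ⟨i, hi⟩).trans le_sup_left
  · exact le_iSup (fun j : Fin (n + 2) => stdSimplex.face {j}ᶜ) i.1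
  · exact le_iSup (fun j : Fin (n + 2) => stdSimplex.face {j}ᶜ) p

/-- Since `d > k + 1 ≥ 2`, both Δ[d] and its facets have inner horns of dimension above `k`, with
invertible restriction. For the facet this makes restriction to its boundary a monomorphism. The
boundary of Δ[d] arises from an inner horn by attaching one facet, so restriction from boundary to
horn is a monomorphism too; its composite with restriction to the boundary is invertible, hence so
is the latter. -/
lemma IsKCategory.cosk {J : MorphismProperty V} {k : ℕ} (hk : 0 < k) (hX : IsKCategory J k X) :
    Cosk (k + 1) X := fun d hd => by
  obtain ⟨n, rfl⟩ : ∃ n, d = n + 3 := ⟨d - 3, by lia⟩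
  have h₁ : IsIso (Map.res Λ[n + 3, 1].ι X) :=
    hX.isIso _ _ (by simp) (by rw [Fin.lt_def]; simp) (by lia)
  have h₂ : IsIso (Map.res Λ[n + 2, 1].ι X) :=
    hX.isIso _ _ (by simp) (by rw [Fin.lt_def]; simp) (by lia)
  have h₃ : Mono (Map.res ∂Δ[n + 2].ι X) := by
    have : Map.res Λ[n + 2, 1].ι X = Map.res ∂Δ[n + 2].ι X ≫
      Map.res (Subcomplex.homOfLE (boundary_eq_horn_sup 1 ▸ le_sup_left)) X := rfl
    rw [this] at h₂
    exact mono_of_mono _ (Map.res (Subcomplex.homOfLE (boundary_eq_horn_sup 1 ▸ le_sup_left)) X)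
  have h₄ := homOfLE_of_boundary (P := resProp (MorphismProperty.monomorphisms _) X)
    Λ[n + 3, 1] (stdSimplex.objEquiv.symm (SimplexCategory.δ 1))
    ((objEquiv_symm_δ_notMem_horn_iff _ _).2 rfl)
    (by rw [stdSimplex.objEquiv_symm_mem_nonDegenerate_iff_mono]; infer_instance)
    (fun d hd g => by simp [horn_obj_eq_univ (1 : Fin (n + 4)) d (by lia)]) h₃
  rw [boundary_eq_horn_sup 1]
  have h₅ : Mono (Map.res (Subcomplex.homOfLE
    (le_sup_left : Λ[n + 3, 1] ≤ Λ[n + 3, 1] ⊔ Subcomplex.ofSimplex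
      (stdSimplex.objEquiv.symm (SimplexCategory.δ 1)))) X) := h₄
  have h₆ : Map.res Λ[n + 3, 1].ι X = Map.res (Λ[n + 3, 1] ⊔ Subcomplex.ofSimplex
      (stdSimplex.objEquiv.symm (SimplexCategory.δ 1))).ι X ≫
        Map.res (Subcomplex.homOfLE le_sup_left) X := rfl
  rw [h₆] at h₁
  exact isIso_of_comp_mono _ (Map.res (Subcomplex.homOfLE le_sup_left) X)

/-! ### Representability of mapping spaces -/

/-- By Yoneda's lemma, `Map(Δ[n], X)` is represented by `X_n`. -/
noncomputable def mapStdSimplexIso (X : SimplicialObject V) (n : ℕ) :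
    yoneda.obj (X _⦋n⦌) ≅ Map Δ[n] X :=
  NatIso.ofComponents (fun U => Equiv.toIso (SSet.yonedaEquiv (X := X ⋙ coyoneda.obj U)).symm)
    (fun a => by
      ext x
      refine SSet.yonedaEquiv.injective ((Equiv.apply_symm_apply _ _).trans ?_)
      change _ = a.unop ≫ x ≫ X.map (𝟙 (op ⦋n⦌))
      rw [X.map_id, Category.comp_id]
      rfl)

lemma isRepresentable_map_stdSimplex (X : SimplicialObject V) (n : ℕ) :
    (Map Δ[n] X).IsRepresentable :=
  .mk' (mapStdSimplexIso X n)

lemma isRepresentable_map_of_isInitial [HasTerminal V] (X : SimplicialObject V) {T : SSet.{v}}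
    (hT : IsInitial T) : (Map T X).IsRepresentable := by
  refine .mk' (X := ⊤_ V) (NatIso.ofComponents (fun U => Equiv.toIso
    { toFun := fun _ => hT.to _
      invFun := fun _ => terminal.from _
      left_inv := fun _ => terminal.hom_ext _ _
      right_inv := fun _ => hT.hom_ext _ _ }) ?_)
  intro U U' a
  ext
  exact hT.hom_ext _ _

variable [HasFiniteLimits V]

lemma Cosk.relativelyRepresentable_res_homOfLE_of_cells (hX : Cosk N X) {T : SSet.{v}}
    [∀ d, Finite (T _⦋d⦌)] (A B : T.Subcomplex) (h : A ≤ B)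
    (hP : ∀ d, ∀ x ∈ T.nonDegenerate d, x ∈ B.obj _ → (Map ∂Δ[d] X).IsRepresentable) :
    yoneda.relativelyRepresentable (Map.res (Subcomplex.homOfLE h) X) :=
  homOfLE_of_cells (P := resProp yoneda.relativelyRepresentable X) N
    (fun A B h h' => by
      have := hX.isIso_res_homOfLE A B h h'
      exact MorphismProperty.of_isIso yoneda.relativelyRepresentable (Map.res _ X)) A B h
    (fun d _ x hx hxB _ => by
      have := hP d x hx hxB
      have := isRepresentable_map_stdSimplex X d
      exact relativelyRepresentable_of_isRepresentable _)

lemma isInitial_bot (T : SSet.{v}) : Nonempty (IsInitial ((⊥ : T.Subcomplex) : SSet.{v})) :=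
  ⟨IsInitial.ofUniqueHom (fun Y =>
    { app := fun _ => TypeCat.ofHom fun x => x.2.elim
      naturality := fun _ _ _ => by ext x; exact x.2.elim })
    fun _ _ => by ext _ x; exact x.2.elim⟩

instance finite_stdSimplex (n d : ℕ) : Finite ((Δ[n] : SSet.{v}) _⦋d⦌) :=
  Finite.of_equiv _ (stdSimplex.objEquiv (n := ⦋n⦌) (m := op ⦋d⦌)).symm

/-- The boundary is built from the empty simplicial set, whose mapping space is the terminal object,
by cells of dimension below `n`. By induction each attachment is a base change of a morphism between
representable presheaves. -/
lemma Cosk.isRepresentable_map_boundary (hX : Cosk N X) (n : ℕ) :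
    (Map ∂Δ[n] X).IsRepresentable := by
  induction n using Nat.strong_induction_on with
  | _ n ih =>
    have h := hX.relativelyRepresentable_res_homOfLE_of_cells ⊥ ∂Δ[n] bot_le
      (fun d x hx hxB => ih d (by
        have := dim_lt_of_nonDegenerate (X := (∂Δ[n] : SSet.{v}))
          ⟨⟨_, hxB⟩, (Subcomplex.mem_nonDegenerate_iff _ _).2 hx⟩ n
        exact this))
    have := isRepresentable_map_of_isInitial X (isInitial_bot Δ[n]).some
    exact isRepresentable_of_relativelyRepresentable h

lemma Cosk.isRepresentable_map (hX : Cosk N X) (T : SSet.{v}) [∀ d, Finite (T _⦋d⦌)] :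
    (Map T X).IsRepresentable := by
  have h := hX.relativelyRepresentable_res_homOfLE_of_cells (T := T) ⊥ ⊤ bot_le
    (fun d _ _ _ => hX.isRepresentable_map_boundary d)
  have := isRepresentable_map_of_isInitial X (isInitial_bot T).some
  have := isRepresentable_of_relativelyRepresentable h
  exact isRepresentable_of_iso (((mapFunctor.mapIso (Subcomplex.topIso T).op).app X).symm)

end Coskeletal

end HigherCat

namespace HigherCat

/-! ### Hypercovers of coskeletal simplicial spaces -/

section Hypercover

open SSet

variable {V : Type u} [Category.{v} V] [HasFiniteLimits V] {J : MorphismProperty V}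
  [IsDescentCategory J] {N : ℕ} {X Y Z : SimplicialObject V}

instance finite_thick (n : SimplexCategory) (d : ℕ) : Finite ((thick.{v}.obj n) _⦋d⦌) :=
  inferInstanceAs (Finite (Fin (d + 1) → ULift.{v} (Fin (n.len + 1))))

instance mono_thickVertex (i : Fin 2) : Mono (thickVertex.{v} i) := by
  rw [NatTrans.mono_iff_mono_app]
  intro m
  rw [mono_iff_injective]
  exact fun a b _ => stdSimplex.objEquiv.injective (SimplexCategory.isTerminalZero.hom_ext _ _)

instance finite_subcomplex {T : SSet.{v}} [∀ d, Finite (T _⦋d⦌)] (A : T.Subcomplex) (d : ℕ) :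
    Finite ((A : SSet.{v}) _⦋d⦌) :=
  inferInstanceAs (Finite (A.obj (op ⦋d⦌)))

lemma liftIn_homOfLE_of_cells {f : X ⟶ Y} {C : MorphismProperty (Vᵒᵖ ⥤ Type v)}
    [C.IsMultiplicative] [C.IsStableUnderBaseChange] (hX : Cosk N X) (hY : Cosk N Y)
    {T : SSet.{v}} [∀ d, Finite (T _⦋d⦌)] (A B : T.Subcomplex) (h : A ≤ B)
    (hP : ∀ d, ∀ x ∈ T.nonDegenerate d, x ∈ B.obj _ → x ∉ A.obj _ → LiftIn C ∂Δ[d].ι f) :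
    LiftIn C (Subcomplex.homOfLE h) f :=
  homOfLE_of_cells (P := liftProp C f) N
    (fun A B h h' => by
      have := hX.isIso_res_homOfLE A B h h'
      have := hY.isIso_res_homOfLE A B h h'
      exact LiftIn.of_isIso_res) A B h
    fun d _ x hx hxB hxA => hP d x hx hxB hxA

lemma liftIn_of_mono {C : MorphismProperty (Vᵒᵖ ⥤ Type v)}
    [C.IsMultiplicative] [C.IsStableUnderBaseChange] {f : X ⟶ Y} {S T : SSet.{v}} (i : S ⟶ T)
    [Mono i] (h : LiftIn C (Subcomplex.homOfLE (le_top : Subcomplex.range i ≤ ⊤)) f) :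
    LiftIn C i f :=
  (liftIn_congr f (Arrow.isoMk (f := Arrow.mk i)
    (g := Arrow.mk (Subcomplex.homOfLE (le_top : Subcomplex.range i ≤ ⊤)))
    (asIso (Subcomplex.toRange i)) (Subcomplex.topIso T).symm)).2 h

/-- Every monomorphism is obtained by attaching simplices along their boundaries, and coskeletality
leaves finitely many of them. -/
lemma hypercover.liftIn {f : X ⟶ Y} (hf : hypercover J f) (hX : Cosk N X) (hY : Cosk N Y)
    {S T : SSet.{v}} [∀ d, Finite (T _⦋d⦌)] (i : S ⟶ T) [Mono i] : LiftIn J.presheaf i f :=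
  liftIn_of_mono i (liftIn_homOfLE_of_cells hX hY _ _ _ fun d _ _ _ _ => liftIn_iff.2 (hf d))

lemma liftIn_bot_iff {f : X ⟶ Y} {C : MorphismProperty (Vᵒᵖ ⥤ Type v)} [C.RespectsIso]
    {T : SSet.{v}} : LiftIn C (⊥ : T.Subcomplex).ι f ↔ C (Map.post T f) := by
  have : IsIso (Map.post ((⊥ : T.Subcomplex) : SSet.{v}) f) := by
    rw [NatTrans.isIso_iff_isIso_app]
    intro U
    rw [isIso_iff_bijective]
    exact ⟨fun a b _ => (isInitial_bot T).some.hom_ext a b,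
      fun a => ⟨(isInitial_bot T).some.to _, (isInitial_bot T).some.hom_ext _ _⟩⟩
  refine gapIn_iff_of_isPullback (fst := Map.res (⊥ : T.Subcomplex).ι Y ≫ inv (Map.post _ f))
    (snd := 𝟙 _)
    (g := Map.post T f)
    (IsPullback.of_vert_isIso ⟨?_⟩) ?_ (Category.comp_id _)
  · rw [Category.assoc, IsIso.inv_hom_id, Category.comp_id, Category.id_comp]
  rw [← Category.assoc, ← Map.res_post, Category.assoc, IsIso.hom_inv_id, Category.comp_id]

lemma hypercover.post {f : X ⟶ Y} (hf : hypercover J f) (hX : Cosk N X) (hY : Cosk N Y)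
    (T : SSet.{v}) [∀ d, Finite (T _⦋d⦌)] : J.presheaf (Map.post T f) :=
  liftIn_bot_iff.1 (hf.liftIn hX hY _)

lemma hypercover.quasiFibration {f : X ⟶ Y} (hf : hypercover J f) (hX : Cosk N X)
    (hY : Cosk N Y) : quasiFibration J f := by
  refine ⟨fun n i _ _ => liftIn_iff.1 (hf.liftIn hX hY _), fun i => ?_⟩
  exact liftIn_iff.1 (hf.liftIn hX hY _)

/-- Map(Δ[n], X) → Map(∂Δ[n] ↪ Δ[n], g) is the relative map of `f ≫ g` followed by `φ`, a base
change of Map(∂Δ[n], f). It is thus a cover, and it factors through the cover Map(Δ[n], f), so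
`presheaf_cancel` applies. -/
lemma hypercover_cancel {f : X ⟶ Y} {g : Y ⟶ Z} (hX : Cosk N X) (hY : Cosk N Y) (hZ : Cosk N Z)
    (hf : hypercover J f) (hfg : hypercover J (f ≫ g)) : hypercover J g := by
  intro n
  have h₁ : J.presheaf (Map.post Δ[n] f) := hf.post hX hY _
  have h₂ : J.presheaf (Map.post ∂Δ[n] f) := hf.post hX hY _
  have := isRepresentable_map_stdSimplex Y n
  have := isRepresentable_map_stdSimplex Z n
  have := hY.isRepresentable_map_boundary n
  have := hZ.isRepresentable_map_boundary n
  have : (RelMap ∂Δ[n].ι g).IsRepresentable :=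
    isRepresentable_of_isPullback (IsPullback.of_hasPullback _ _)
  refine presheaf_cancel (relativelyRepresentable_of_isRepresentable _) h₁ ?_
  let φ : RelMap ∂Δ[n].ι (f ≫ g) ⟶ RelMap ∂Δ[n].ι g :=
    pullback.lift (pullback.fst _ _ ≫ Map.post _ f) (pullback.snd _ _) (by
      rw [Category.assoc, ← Map.post_comp, pullback.condition])
  have hφ : IsPullback (pullback.fst _ _) φ (Map.post _ f) (pullback.fst _ _) := by
    refine IsPullback.of_bot (v₂₁ := pullback.snd _ _) (v₂₂ := Map.post _ g)
      (h₃₁ := Map.res _ Z) ?_ (pullback.lift_fst _ _ _).symm (IsPullback.of_hasPullback _ _)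
    rw [pullback.lift_snd, ← Map.post_comp]
    exact IsPullback.of_hasPullback _ _
  have e : Map.post Δ[n] f ≫ toRelMap ∂Δ[n].ι g = toRelMap ∂Δ[n].ι (f ≫ g) ≫ φ := by
    apply pullback.hom_ext
    · rw [Category.assoc, Category.assoc]
      erw [pullback.lift_fst, pullback.lift_fst, pullback.lift_fst_assoc]
      exact (Map.res_post _ _).symm
    · rw [Category.assoc, Category.assoc]
      erw [pullback.lift_snd, pullback.lift_snd, pullback.lift_snd]
      exact (Map.post_comp _ _ _).symm
  rw [e]
  exact J.presheaf.comp_mem _ _ (hfg n) (J.presheaf.of_isPullback hφ h₂)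

end Hypercover

end HigherCat

namespace HigherCat

/-! ### Simplicial sets of words -/

section Words

open SSet

/-- The word `x` of length `n + 1` is obtained from `u` by deleting the letter with index `j`. -/
def IsDel {Q : Type*} (n j : ℕ) (u x : ℕ → Q) : Prop :=
  ∀ a ≤ n, x a = if a < j then u a else u (a + 1)

/-- An identification of the `n`-simplices of `X` with the words `u 0, …, u n` such that
`R (u a) (u b)` holds for all `a ≤ b`. -/
structure Words (X : SSet.{v}) {Q : Type*} (R : Q → Q → Prop) where
  /-- the letters of a simplex -/
  letter : ∀ {n : ℕ}, X _⦋n⦌ → ℕ → Q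
  ext : ∀ {n : ℕ} (x y : X _⦋n⦌), (∀ a ≤ n, letter x a = letter y a) → x = y
  rel : ∀ {n : ℕ} (x : X _⦋n⦌) (a b : ℕ), a ≤ b → b ≤ n → R (letter x a) (letter x b)
  exists_letter : ∀ (n : ℕ) (u : ℕ → Q), (∀ a b, a ≤ b → b ≤ n → R (u a) (u b)) →
    ∃ x : X _⦋n⦌, ∀ a ≤ n, letter x a = u a
  letter_δ : ∀ {n : ℕ} (x : X _⦋n + 1⦌) (j : Fin (n + 2)),
    IsDel n j (letter x) (letter (X.δ j x))
  letter_σ : ∀ {n : ℕ} (x : X _⦋n⦌) (j : Fin (n + 1)) (a : ℕ), a ≤ n + 1 →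
    letter (X.σ j x) a = if a ≤ j then letter x a else letter x (a - 1)

variable {X : SSet.{v}} {Q : Type*} {R : Q → Q → Prop} (W : Words X R)

lemma Words.mem_nonDegenerate_iff {n : ℕ} (x : X _⦋n⦌) :
    x ∈ X.nonDegenerate n ↔ ∀ a < n, W.letter x a ≠ W.letter x (a + 1) := by
  obtain _ | n := n
  · simp
  rw [← not_iff_not, ← mem_degenerate_iff_notMem_nonDegenerate, degenerate_eq_iUnion_range_σ]
  simp only [Set.mem_iUnion, Set.mem_range, not_forall, not_not]
  constructor
  · rintro ⟨i, y, rfl⟩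
    refine ⟨i, i.2, ?_⟩
    rw [W.letter_σ _ _ _ (by lia), W.letter_σ _ _ _ (by lia)]
    simp
  · rintro ⟨a, ha, h⟩
    -- When the letters `a` and `a + 1` agree, deleting one and repeating the other restores `x`.
    refine ⟨⟨a, ha⟩, X.δ ⟨a, by lia⟩ x, W.ext _ _ fun b hb => ?_⟩
    rw [W.letter_σ _ _ _ hb]
    simp only
    split_ifs with hba
    · rw [W.letter_δ _ _ _ (by lia)]
      simp only
      split_ifs
      · rfl
      · obtain rfl : b = a := by lia
        exact h.symm
    · rw [W.letter_δ _ _ _ (by lia)]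
      simp only
      rw [if_neg (by lia)]
      congr 1
      lia

/-- A version of `ι_of_pairing` for simplicial sets of words. -/
lemma Words.ι_of_pairing {P : MorphismProperty SSet.{v}} [P.IsStableUnderCobaseChange]
    [P.IsMultiplicative] [∀ d, Finite (X _⦋d⦌)] (N : ℕ)
    (htr : ∀ (A B : X.Subcomplex) (h : A ≤ B),
      (∀ d ≤ N, B.obj (op ⦋d⦌) ⊆ A.obj _) → P (Subcomplex.homOfLE h))
    (A : X.Subcomplex) (S : ℕ → (ℕ → Q) → Prop)
    (hA : ∀ n (x : X _⦋n⦌), x ∉ A.obj _ ↔ S n (W.letter x))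
    (I : ℕ → (ℕ → Q) → ℕ → Prop) (r : ℕ → (ℕ → Q) → ℕ → ℕ)
    (hI : ∀ n u u' p, (∀ a ≤ n + 1, u a = u' a) → I n u p → I n u' p)
    (hI₁ : ∀ n u p, (∀ a b, a ≤ b → b ≤ n + 1 → R (u a) (u b)) → I n u p →
      p ≤ n + 1 ∧ ∀ a < n + 1, u a ≠ u (a + 1))
    (hI₂ : ∀ n u x p, (∀ a b, a ≤ b → b ≤ n + 1 → R (u a) (u b)) → I n u p → IsDel n p u x →
      S n x ∧ ∀ a < n, x a ≠ x (a + 1))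
    (hex : ∀ n x, (∀ a b, a ≤ b → b ≤ n → R (x a) (x b)) → S n x →
      (∀ a < n, x a ≠ x (a + 1)) → (∃ m p, n = m + 1 ∧ I m x p) ∨
        ∃ u p, (∀ a b, a ≤ b → b ≤ n + 1 → R (u a) (u b)) ∧ I n u p ∧ IsDel n p u x)
    (hdis : ∀ n u x p q, (∀ a b, a ≤ b → b ≤ n + 2 → R (u a) (u b)) →
      I (n + 1) u p → IsDel (n + 1) p u x → ¬ I n x q)
    (hinj : ∀ n u v x p q, (∀ a b, a ≤ b → b ≤ n + 1 → R (u a) (u b)) →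
      (∀ a b, a ≤ b → b ≤ n + 1 → R (v a) (v b)) → I n u p → I n v q →
      IsDel n p u x → IsDel n q v x → ∀ a ≤ n + 1, u a = v a)
    (hr : ∀ n u v x p q j, (∀ a b, a ≤ b → b ≤ n + 1 → R (u a) (u b)) →
      (∀ a b, a ≤ b → b ≤ n + 1 → R (v a) (v b)) → I n u p → I n v q → j ≤ n + 1 → j ≠ p →
      IsDel n j u x → IsDel n q v x → r n v q < r n u p)
    (hP : ∀ n u p (_ : ∀ a b, a ≤ b → b ≤ n + 1 → R (u a) (u b)) (_ : I n u p) (h : p < n + 2),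
      P Λ[n + 1, ⟨p, h⟩].ι) : P A.ι := by
  refine HigherCat.ι_of_pairing N htr A (fun n x p => I n (W.letter x) p)
    (fun n x p => r n (W.letter x) p) ?_ ?_ ?_ ?_ ?_ ?_ ?_ ?_
  · exact fun n x p h => (W.mem_nonDegenerate_iff x).2 (hI₁ _ _ _ (W.rel x) h).2
  · exact fun n x p h => (W.mem_nonDegenerate_iff _).2 (hI₂ _ _ _ _ (W.rel x) h (W.letter_δ x p)).2
  · exact fun n x p h => (hA _ _).2 (hI₂ _ _ _ _ (W.rel x) h (W.letter_δ x p)).1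
  · intro n x hx hxA
    obtain ⟨m, p, rfl, h⟩ | ⟨u, p, hu, h, h'⟩ :=
      hex n (W.letter x) (W.rel x) ((hA _ _).1 hxA) ((W.mem_nonDegenerate_iff x).1 hx)
    · exact Or.inl ⟨m, rfl, ⟨p, by have := (hI₁ _ _ _ (W.rel x) h).1; lia⟩, h⟩
    · obtain ⟨y, hy⟩ := W.exists_letter (n + 1) u hu
      have hp := (hI₁ _ _ _ hu h).1
      refine Or.inr ⟨y, ⟨p, by lia⟩, hI _ _ _ _ (fun a ha => (hy a ha).symm) h,
        W.ext _ _ fun a ha => ?_⟩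
      rw [W.letter_δ _ _ _ ha, h' a ha, hy _ (by lia), hy _ (by lia)]
  · exact fun n x p q h => hdis n _ _ p q (W.rel x) h (W.letter_δ x p)
  · exact fun n x y p q h h' e => W.ext _ _ (hinj n _ _ _ p q (W.rel x) (W.rel y) h h'
      (W.letter_δ x p) (e ▸ W.letter_δ y q))
  · exact fun n x p j y q h hj h' e => hr n _ _ _ p q j (W.rel x) (W.rel y) h h'
      (by lia) (fun hjp => hj (Fin.ext hjp)) (W.letter_δ x j) (e ▸ W.letter_δ y q)
  · exact fun n x p h _ => hP n _ p (W.rel x) h p.2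

end Words

end HigherCat

namespace HigherCat

/-! ### Pairings of words -/

lemma IsDel.exists {Q : Type*} {n p : ℕ} {u x : ℕ → Q} (h : IsDel n p u x) (hp : p ≤ n + 1)
    {a : ℕ} (ha : a ≤ n + 1) (hap : a ≠ p) : ∃ b ≤ n, x b = u a := by
  obtain hap | hap := hap.lt_or_gt
  · exact ⟨a, by lia, by rw [h _ (by lia), if_pos hap]⟩
  · exact ⟨a - 1, by lia, by rw [h _ (by lia), if_neg (by lia), Nat.sub_add_cancel (by lia)]⟩

/-- The word obtained by inserting the letter `q`. -/
def insWord {Q : Type*} (p : ℕ) (q : Q) (x : ℕ → Q) (a : ℕ) : Q :=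
  if a < p then x a else if a = p then q else x (a - 1)

lemma isDel_insWord {Q : Type*} (n p : ℕ) (q : Q) (x : ℕ → Q) : IsDel n p (insWord p q x) x := by
  intro a ha
  unfold insWord
  grind

lemma insWord_rel {Q : Type*} {R : Q → Q → Prop} {d p : ℕ} {q : Q} {x : ℕ → Q}
    (hx : ∀ a b, a ≤ b → b ≤ d → R (x a) (x b)) (hpd : p ≤ d + 1) (h₁ : ∀ a < p, R (x a) q)
    (h₂ : ∀ b, p ≤ b → b ≤ d → R q (x b)) (hq : R q q) (a b : ℕ) (hab : a ≤ b) (hb : b ≤ d + 1) :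
    R (insWord p q x a) (insWord p q x b) := by
  unfold insWord
  split_ifs
  · exact hx _ _ hab (by lia)
  · exact h₁ _ ‹_›
  · exact hx _ _ (by lia) (by lia)
  · lia
  · exact hq
  · exact h₂ _ (by lia) (by lia)
  · lia
  · lia
  · exact hx _ _ (by lia) (by lia)

lemma insWord_ne {Q : Type*} {d p : ℕ} {q : Q} {x : ℕ → Q} (hx : ∀ a < d, x a ≠ x (a + 1))
    (hp : 1 ≤ p) (hpd : p ≤ d) (h₁ : x (p - 1) ≠ q) (h₂ : q ≠ x p) (a : ℕ) (ha : a ≤ d) :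
    insWord p q x a ≠ insWord p q x (a + 1) := by
  have := hx a
  have := hx (a - 1)
  clear hx
  unfold insWord
  grind

lemma exists_insWord {Q : Type*} {d p : ℕ} {q : Q} {x : ℕ → Q} (S : Q → Prop)
    (h : ∃ a ≤ d, S (x a)) : ∃ a ≤ d + 1, S (insWord p q x a) := by
  obtain ⟨a, ha, h⟩ := h
  rw [isDel_insWord d p q x a ha] at h
  split_ifs at h
  · exact ⟨a, by lia, h⟩
  · exact ⟨a + 1, by lia, h⟩

/-- This bounds from below the dimension of the horns used in a pairing, which is needed to apply
the isomorphism condition above `k`. -/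
lemma card_le_of_surj {n d : ℕ} (u : ℕ → ℕ) (h : ∀ j ≤ n, ∃ a ≤ d, u a = j) : n ≤ d := by
  have : Finset.range (n + 1) ⊆ (Finset.range (d + 1)).image u := by
    intro j hj
    obtain ⟨a, ha, rfl⟩ := h j (Nat.lt_succ_iff.1 (Finset.mem_range.1 hj))
    exact Finset.mem_image_of_mem _ (Finset.mem_range.2 (by lia))
  have := (Finset.card_le_card this).trans Finset.card_image_le
  simpa using this

/-- The letters are pairs of a level and a vertex of `thick 1`, with increasing levels. -/
abbrev HornRel (n : ℕ) (x y : ℕ × ℕ) : Prop := x.1 ≤ y.1 ∧ y.1 ≤ n ∧ x.2 ≤ 1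

section Pairings
open SSet

variable {X : SSet.{v}} {P : MorphismProperty SSet.{v}} [P.IsStableUnderCobaseChange]
    [P.IsMultiplicative] [∀ d, Finite (X _⦋d⦌)]

/-! ### Matching for an inner horn times the ends of the thick interval -/

/-- The pivots for the pairing of the simplices of `Δ[n] ⊗ thick 1`
outside of `Λ[n, i] ⊗ thick 1 ∪ Δ[n] ⊗ ∂`. -/
structure HornPivot (n i : ℕ) (d : ℕ) (u : ℕ → ℕ × ℕ) (p : ℕ) : Prop where
  ne : ∀ a ≤ d, u a ≠ u (a + 1)
  surj : ∀ j ≤ n, ∃ a ≤ d + 1, (u a).1 = j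
  zero : ∃ a ≤ d + 1, (u a).2 = 0
  one : ∃ a ≤ d + 1, (u a).2 = 1
  pos : 1 ≤ p
  le : p ≤ d
  lev : (u (p - 1)).1 + 1 = i
  eq : u p = (i, (u (p - 1)).2)

/-- Together with `HornPivot.ge` this characterizes the pivot as the first letter of level at least
`i`, so a word has at most one. -/
lemma HornPivot.lt {n i d : ℕ} {u : ℕ → ℕ × ℕ} {p : ℕ} (h : HornPivot n i d u p)
    (hu : ∀ a b, a ≤ b → b ≤ d + 1 → (u a).1 ≤ (u b).1 ∧ (u b).1 ≤ n ∧ (u a).2 ≤ 1) (a : ℕ)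
    (ha : a < p) : (u a).1 < i := by
  have := hu a (p - 1) (by lia) (by have := h.le; lia)
  have := h.lev
  lia

lemma HornPivot.ge {n i d : ℕ} {u : ℕ → ℕ × ℕ} {p : ℕ} (h : HornPivot n i d u p)
    (hu : ∀ a b, a ≤ b → b ≤ d + 1 → (u a).1 ≤ (u b).1 ∧ (u b).1 ≤ n ∧ (u a).2 ≤ 1) (a : ℕ)
    (ha : p ≤ a) (ha' : a ≤ d + 1) : i ≤ (u a).1 := by
  have := (hu p a ha ha').1
  rwa [h.eq] at this

/-- The words outside of `Λ[n, i] ⊗ thick 1 ∪ Δ[n] ⊗ ∂`. -/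
abbrev HornWord (n i d : ℕ) (u : ℕ → ℕ × ℕ) : Prop :=
  (∀ j ≤ n, j ≠ i → ∃ a ≤ d, (u a).1 = j) ∧ (∃ a ≤ d, (u a).2 = 0) ∧ ∃ a ≤ d, (u a).2 = 1

lemma HornPivot.congr {n i d : ℕ} {u u' : ℕ → ℕ × ℕ} {p : ℕ} (h : ∀ a ≤ d + 1, u a = u' a)
    (hp : HornPivot n i d u p) : HornPivot n i d u' p := by
  have := hp.le
  refine ⟨?_, ?_, ?_, ?_, hp.pos, hp.le, ?_, ?_⟩
  · intro a ha
    rw [← h a (by lia), ← h _ (by lia)]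
    exact hp.ne a ha
  · intro j hj
    obtain ⟨a, ha, h'⟩ := hp.surj j hj
    exact ⟨a, ha, by rw [← h a ha, h']⟩
  · obtain ⟨a, ha, h'⟩ := hp.zero
    exact ⟨a, ha, by rw [← h a ha, h']⟩
  · obtain ⟨a, ha, h'⟩ := hp.one
    exact ⟨a, ha, by rw [← h a ha, h']⟩
  · rw [← h _ (by lia)]
    exact hp.lev
  · rw [← h _ (by lia), ← h _ (by lia)]
    exact hp.eq

/-- Only level `i` may be lost, and the vertex of the pivot survives in the preceding letter. The
new neighbours have levels i - 1 and at least `i`, so no repetition is created. -/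
lemma HornPivot.hornWord {n i d : ℕ} {u x : ℕ → ℕ × ℕ} {p : ℕ}
    (hu : ∀ a b, a ≤ b → b ≤ d + 1 → HornRel n (u a) (u b))
    (h : HornPivot n i d u p) (hx : IsDel d p u x) :
    HornWord n i d x ∧ ∀ a < d, x a ≠ x (a + 1) := by
  have h₁ := h.le
  have h₂ := h.pos
  have h₃ := h.lev
  have h₄ := h.eq
  have h₅ : (u p).1 = i := by rw [h₄]
  have h₆ : (u p).2 = (u (p - 1)).2 := by rw [h₄]
  refine ⟨⟨fun j hj hji => ?_, ?_, ?_⟩, fun a ha => ?_⟩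
  · obtain ⟨a, ha, h'⟩ := h.surj j hj
    obtain ⟨b, hb, e⟩ := hx.exists (by lia) ha (by grind)
    exact ⟨b, hb, by rw [e, h']⟩
  · obtain ⟨a, ha, h'⟩ := h.zero
    by_cases hap : a = p
    · obtain ⟨b, hb, e⟩ := hx.exists (by lia) (a := p - 1) (by lia) (by lia)
      exact ⟨b, hb, by rw [e, ← h₆, ← hap, h']⟩
    · obtain ⟨b, hb, e⟩ := hx.exists (by lia) ha hap
      exact ⟨b, hb, by rw [e, h']⟩
  · obtain ⟨a, ha, h'⟩ := h.one
    by_cases hap : a = p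
    · obtain ⟨b, hb, e⟩ := hx.exists (by lia) (a := p - 1) (by lia) (by lia)
      exact ⟨b, hb, by rw [e, ← h₆, ← hap, h']⟩
    · obtain ⟨b, hb, e⟩ := hx.exists (by lia) ha hap
      exact ⟨b, hb, by rw [e, h']⟩
  · rw [hx a (by lia), hx (a + 1) (by lia)]
    have := h.lt hu
    have := h.ge hu
    have := h.ne a
    have := h.ne (a + 1)
    grind

/-- Cut the word before its first letter of level at least `i`; the letter preceding the cut is (i -
1, ε). Either the next letter is (i, ε), which is the pivot, or inserting (i, ε) produces the
partner. Level 0 occurs before the cut and level `n > i` after it, so the pivot is an interior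
position and the horn is inner. -/
lemma HornPivot.exists {n i d : ℕ} {x : ℕ → ℕ × ℕ} (hi : 0 < i) (hin : i < n)
    (hx : ∀ a b, a ≤ b → b ≤ d → HornRel n (x a) (x b)) (hs : ∀ j ≤ n, j ≠ i → ∃ a ≤ d, (x a).1 = j)
    (h0 : ∃ a ≤ d, (x a).2 = 0) (h1 : ∃ a ≤ d, (x a).2 = 1)
    (hne : ∀ a < d, x a ≠ x (a + 1)) :
    (∃ m p, d = m + 1 ∧ HornPivot n i m x p) ∨
      ∃ u p, (∀ a b, a ≤ b → b ≤ d + 1 → HornRel n (u a) (u b)) ∧ HornPivot n i d u p ∧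
        IsDel d p u x := by
  obtain ⟨a, ha, han⟩ := hs n le_rfl (by lia)
  obtain ⟨b, hb, hb0⟩ := hs 0 (by lia) (by lia)
  obtain ⟨c, hc, hci⟩ := hs (i - 1) (by lia) (by lia)
  have hex : ∃ a, i ≤ (x a).1 := ⟨a, by lia⟩
  obtain ⟨p, hp, hmin⟩ : ∃ p, i ≤ (x p).1 ∧ ∀ a < p, (x a).1 < i :=
    ⟨Nat.find hex, Nat.find_spec hex, fun a ha => not_le.1 (Nat.find_min hex ha)⟩
  have hpa : p ≤ a := by
    by_contra h
    have := hmin a (by lia)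
    lia
  have hp0 : 1 ≤ p := by
    by_contra h
    have := hx 0 b (by lia) (by lia)
    obtain rfl : p = 0 := by lia
    lia
  have hlev : (x (p - 1)).1 + 1 = i := by
    have := hmin (p - 1) (by lia)
    have h₁ : c ≤ p - 1 := by
      by_contra h
      have := hx p c (by lia) (by lia)
      lia
    have := hx c (p - 1) h₁ (by lia)
    lia
  by_cases hxp : x p = (i, (x (p - 1)).2)
  · have hpa' : p < a := lt_of_le_of_ne hpa (by rintro rfl; grind)
    obtain ⟨d, rfl⟩ : ∃ m, d = m + 1 := ⟨d - 1, by lia⟩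
    refine Or.inl ⟨d, p, rfl, ⟨fun a ha => hne a (by lia), fun j hj => ?_, h0, h1, hp0, by lia,
      hlev, hxp⟩⟩
    by_cases hji : j = i
    · exact ⟨p, by lia, by rw [hxp, hji]⟩
    · exact hs j hj hji
  · have h₁ := hx (p - 1) p (by lia) (by lia)
    refine Or.inr ⟨insWord p (i, (x (p - 1)).2) x, p, insWord_rel hx (by lia) (fun a ha => ?_)
      (fun b hb hbd => ?_) ⟨le_rfl, by lia, h₁.2.2⟩,
      ⟨insWord_ne hne hp0 (by lia) (by grind) (Ne.symm hxp), fun j hj => ?_,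
      exists_insWord (fun q : ℕ × ℕ => q.2 = 0) h0, exists_insWord (fun q : ℕ × ℕ => q.2 = 1) h1,
      hp0, by lia, ?_, ?_⟩, isDel_insWord d p _ x⟩
    · have := hx a (p - 1) (by lia) (by lia)
      exact ⟨by lia, by lia, by lia⟩
    · have := hx p b hb hbd
      exact ⟨by lia, by lia, by lia⟩
    · by_cases hji : j = i
      · exact ⟨p, by lia, by simp [insWord, hji]⟩
      · exact exists_insWord (fun q : ℕ × ℕ => q.1 = j) (hs j hj hji)
    · rw [insWord, if_pos (by lia), hlev]
    · simp only [insWord, if_true, lt_irrefl, if_false]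
      rw [if_pos (by lia)]

lemma HornPivot.disjoint {n i d : ℕ} {u x : ℕ → ℕ × ℕ} {p q : ℕ}
    (hu : ∀ a b, a ≤ b → b ≤ d + 2 → HornRel n (u a) (u b))
    (h : HornPivot n i (d + 1) u p) (hx : IsDel (d + 1) p u x) : ¬ HornPivot n i d x q := by
  intro h'
  have := h.lt hu
  have := h.ge hu
  have := h'.eq
  have := h'.lev
  have := h'.pos
  have := h'.le
  have := h.ne p
  have := h.eq
  have := h.lev
  have := h.pos
  have := h.le
  have := hx q (by lia)
  have := hx (q - 1) (by lia)
  obtain rfl : p = q := by grind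
  grind

lemma HornPivot.inj {n i d : ℕ} {u v x : ℕ → ℕ × ℕ} {p q : ℕ}
    (hu : ∀ a b, a ≤ b → b ≤ d + 1 → HornRel n (u a) (u b))
    (hv : ∀ a b, a ≤ b → b ≤ d + 1 → HornRel n (v a) (v b))
    (h : HornPivot n i d u p) (h' : HornPivot n i d v q) (hx : IsDel d p u x)
    (hx' : IsDel d q v x) (a : ℕ) (ha : a ≤ d + 1) : u a = v a := by
  have := h.lt hu
  have := h.ge hu
  have := h'.lt hv
  have := h'.ge hv
  have := h.le
  have := h'.le
  obtain rfl : p = q := by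
    by_contra
    have := hx p (by lia)
    have := hx q (by lia)
    have := hx' p (by lia)
    have := hx' q (by lia)
    grind
  have := h.eq
  have := h'.eq
  have := h.pos
  have := hx (p - 1) (by lia)
  have := hx' (p - 1) (by lia)
  have := hx a
  have := hx (a - 1)
  have := hx' a
  have := hx' (a - 1)
  grind

/-- Deleting a letter after the pivot keeps the pivot, so such a face is not a matched lower cell.
Deleting an earlier letter moves the first letter of level at least `i` to the left. -/
lemma HornPivot.rank_lt {n i d : ℕ} {u v x : ℕ → ℕ × ℕ} {p q j : ℕ}
    (hu : ∀ a b, a ≤ b → b ≤ d + 1 → HornRel n (u a) (u b))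
    (hv : ∀ a b, a ≤ b → b ≤ d + 1 → HornRel n (v a) (v b))
    (h : HornPivot n i d u p) (h' : HornPivot n i d v q) (hjp : j ≠ p)
    (hx : IsDel d j u x) (hx' : IsDel d q v x) : q < p := by
  have := h.lt hu
  have := h.ge hu
  have := h'.lt hv
  have := h'.ge hv
  have := h.le
  have := h'.le
  have := h.eq
  have := h'.eq
  have := h.pos
  have := h'.pos
  have := h'.ne p
  have := hx p (by lia)
  have := hx' p (by lia)
  have := hx (p - 1) (by lia)
  have := hx' (p - 1) (by lia)
  by_contra
  obtain hjp | hjp := lt_or_gt_of_ne hjp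
  · grind
  · obtain rfl : p = q := by grind
    grind

lemma Words.ι_of_hornPivot (n i : ℕ) (hi : 0 < i) (hin : i < n)
    (W : Words X (HornRel n)) (N : ℕ)
    (htr : ∀ (A B : X.Subcomplex) (h : A ≤ B),
      (∀ d ≤ N, B.obj (op ⦋d⦌) ⊆ A.obj _) → P (Subcomplex.homOfLE h))
    (A : X.Subcomplex)
    (hA : ∀ d (x : X _⦋d⦌), x ∉ A.obj _ ↔ HornWord n i d (W.letter x))
    (hP : ∀ d, n ≤ d + 1 → ∀ p : Fin (d + 2), 0 < p → p < Fin.last (d + 1) → P Λ[d + 1, p].ι) :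
    P A.ι := by
  refine W.ι_of_pairing N htr A (HornWord n i) hA (HornPivot n i) (fun _ _ p => p)
    (fun _ _ _ _ => HornPivot.congr) ?_ (fun _ _ _ _ hu h hx => h.hornWord hu hx)
    (fun _ _ hx h hne => HornPivot.exists hi hin hx h.1 h.2.1 h.2.2 hne)
    (fun _ _ _ _ _ hu h hx => h.disjoint hu hx)
    (fun _ _ _ _ _ _ hu hv h h' hx hx' => h.inj hu hv h' hx hx')
    (fun _ _ _ _ _ _ _ hu hv h h' _ hjp hx hx' => h.rank_lt hu hv h' hjp hx hx') ?_
  · intro d u p _ h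
    exact ⟨by have := h.le; lia, fun a ha => h.ne a (by lia)⟩
  · intro d u p hu h hp
    refine hP d ?_ _ ?_ ?_
    · have := card_le_of_surj (fun a => (u a).1) (fun j hj => h.surj j hj)
      lia
    · rw [Fin.lt_def]
      exact h.pos
    · rw [Fin.lt_def]
      exact Nat.lt_succ_of_le h.le

/-! ### Matching for a boundary times a vertex of the thick interval -/

/-- The words outside of `∂Δ[n] ⊗ thick 1 ∪ Δ[n] ⊗ {0}`. -/
abbrev BoundaryWord (n d : ℕ) (u : ℕ → ℕ × ℕ) : Prop :=
  (∀ j ≤ n, ∃ a ≤ d, (u a).1 = j) ∧ ∃ a ≤ d, (u a).2 = 1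

/-- The pivots for the pairing of the simplices of `Δ[n] ⊗ thick 1`
outside of `∂Δ[n] ⊗ thick 1 ∪ Δ[n] ⊗ {0}`. -/
structure BoundaryPivot (n : ℕ) (d : ℕ) (u : ℕ → ℕ × ℕ) (p : ℕ) : Prop where
  ne : ∀ a ≤ d, u a ≠ u (a + 1)
  surj : ∀ j ≤ n, ∃ a ≤ d + 1, (u a).1 = j
  one : ∃ a ≤ d + 1, (u a).2 = 1
  pos : 1 ≤ p
  le : p ≤ d
  eq : (u (p - 1) = (0, 1) ∧ u p = (0, 0) ∧ ∀ a, p ≤ a → a ≤ d + 1 → u a ≠ (0, 1)) ∨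
    ((∀ a ≤ d + 1, u a ≠ (0, 1)) ∧ u (p + 1) = ((u p).1, 1) ∧ ∀ a ≤ p, (u a).2 = 0)

lemma BoundaryPivot.congr {n d : ℕ} {u u' : ℕ → ℕ × ℕ} {p : ℕ} (h : ∀ a ≤ d + 1, u a = u' a)
    (hp : BoundaryPivot n d u p) : BoundaryPivot n d u' p := by
  obtain ⟨h₁, h₂, h₃, h₄, h₅, h₆⟩ := hp
  refine ⟨by grind, ?_, by grind, h₄, h₅, ?_⟩
  · intro j hj
    obtain ⟨a, ha, h'⟩ := h₂ j hj
    exact ⟨a, ha, by rw [← h a ha, h']⟩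
  · refine h₆.imp (fun ⟨h₇, h₈, h₉⟩ => ⟨?_, ?_, ?_⟩) (fun ⟨h₇, h₈, h₉⟩ => ⟨?_, ?_, ?_⟩) <;> grind

/-- The pivot has the form (l, 0) and one of its neighbours is (l, 1), so neither a level nor the
vertex 1 is lost when it is deleted. -/
lemma BoundaryPivot.boundaryWord {n d : ℕ} {u x : ℕ → ℕ × ℕ} {p : ℕ}
    (h : BoundaryPivot n d u p) (hx : IsDel d p u x) :
    BoundaryWord n d x ∧ ∀ a < d, x a ≠ x (a + 1) := by
  have h₁ := h.le
  have h₂ := h.pos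
  have h₃ := h.eq
  refine ⟨⟨fun j hj => ?_, ?_⟩, fun a ha => ?_⟩
  · obtain ⟨a, ha, h'⟩ := h.surj j hj
    by_cases hap : a = p
    · obtain ⟨b, hb, hbp, e⟩ : ∃ b ≤ d + 1, b ≠ p ∧ (u b).1 = j := by
        obtain ⟨h₄, h₅, -⟩ | ⟨-, h₄, h₅⟩ := h₃
        · exact ⟨p - 1, by lia, by lia, by rw [h₄, ← h', hap, h₅]⟩
        · exact ⟨p + 1, by lia, by lia, by rw [h₄, ← h', hap]⟩
      obtain ⟨c, hc, e'⟩ := hx.exists (by lia) hb hbp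
      exact ⟨c, hc, by rw [e', e]⟩
    · obtain ⟨b, hb, e⟩ := hx.exists (by lia) ha hap
      exact ⟨b, hb, by rw [e, h']⟩
  · obtain ⟨a, ha, h'⟩ := h.one
    obtain ⟨b, hb, e⟩ := hx.exists (by lia) ha (by grind)
    exact ⟨b, hb, by rw [e, h']⟩
  · rw [hx a (by lia), hx (a + 1) (by lia)]
    have := h.ne a
    have := h.ne (a + 1)
    grind

/-- If (0, 1) occurs, the pivot is a letter (0, 0) directly after its last occurrence. Otherwise it
is a letter (l, 0) directly before the first letter (l, 1) with vertex 1. If the letter is absent it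
is inserted. -/
lemma BoundaryPivot.exists {n d : ℕ} {x : ℕ → ℕ × ℕ} (hn : 0 < n)
    (hx : ∀ a b, a ≤ b → b ≤ d → HornRel n (x a) (x b)) (hs : ∀ j ≤ n, ∃ a ≤ d, (x a).1 = j)
    (h1 : ∃ a ≤ d, (x a).2 = 1) (hne : ∀ a < d, x a ≠ x (a + 1)) :
    (∃ m p, d = m + 1 ∧ BoundaryPivot n m x p) ∨
      ∃ u p, (∀ a b, a ≤ b → b ≤ d + 1 → HornRel n (u a) (u b)) ∧ BoundaryPivot n d u p ∧
        IsDel d p u x := by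
  have key (p : ℕ) (q : ℕ × ℕ) (hp : 1 ≤ p) (hpd : p ≤ d) (hq : (x (p - 1)).1 ≤ q.1)
      (hq' : q.1 ≤ (x p).1) (hq₂ : q.2 = 0) (hne₁ : x (p - 1) ≠ q) (hne₂ : q ≠ x p)
      (hc : (x (p - 1) = (0, 1) ∧ q = (0, 0) ∧ ∀ a, p ≤ a → a ≤ d → x a ≠ (0, 1)) ∨
        ((∀ a ≤ d, x a ≠ (0, 1)) ∧ x p = (q.1, 1) ∧ ∀ a < p, (x a).2 = 0)) :
      ∃ u p, (∀ a b, a ≤ b → b ≤ d + 1 → HornRel n (u a) (u b)) ∧ BoundaryPivot n d u p ∧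
        IsDel d p u x := by
    have hd := isDel_insWord d p q x
    have e₁ : ∀ a < p, insWord p q x a = x a := fun a ha => if_pos ha
    have e₂ : insWord p q x p = q := by simp [insWord]
    have e₃ : ∀ a, p < a → insWord p q x a = x (a - 1) := fun a ha => by
      rw [insWord, if_neg (by lia), if_neg (by lia)]
    refine ⟨insWord p q x, p, insWord_rel hx (by lia) (fun a ha => ?_) (fun b hb hbd => ?_) ?_,
      ⟨insWord_ne hne hp hpd hne₁ hne₂, fun j hj =>
        exists_insWord (fun q : ℕ × ℕ => q.1 = j) (hs j hj),
      exists_insWord (fun q : ℕ × ℕ => q.2 = 1) h1, hp, hpd, ?_⟩, hd⟩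
    · have h₁ := hx a (p - 1) (by lia) (by lia)
      have h₂ := hx p p le_rfl hpd
      exact ⟨by lia, by lia, by lia⟩
    · have h₂ := hx p b hb hbd
      exact ⟨by lia, by lia, by lia⟩
    · have h₂ := hx p p le_rfl hpd
      exact ⟨by lia, by lia, by lia⟩
    · refine hc.imp (fun ⟨h₁, h₂, h₃⟩ => ⟨?_, ?_, ?_⟩) (fun ⟨h₁, h₂, h₃⟩ => ⟨?_, ?_, ?_⟩)
      · rw [e₁ _ (by lia), h₁]
      · rw [e₂, h₂]
      · intro a ha ha'
        obtain rfl | ha := ha.eq_or_lt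
        · rw [e₂, h₂]
          simp
        · rw [e₃ _ ha]
          exact h₃ _ (by lia) (by lia)
      · intro a ha
        obtain hap | rfl | hap := lt_trichotomy a p
        · rw [e₁ _ hap]
          exact h₁ _ (by lia)
        · rw [e₂]
          grind
        · rw [e₃ _ hap]
          exact h₁ _ (by lia)
      · rw [e₂, e₃ _ (by lia), Nat.add_sub_cancel, h₂]
      · intro a ha
        obtain rfl | ha := ha.eq_or_lt
        · rw [e₂, hq₂]
        · rw [e₁ _ ha]
          exact h₃ _ ha
  obtain ⟨a, ha, han⟩ := hs n le_rfl
  obtain ⟨b, hb, hb0⟩ := hs 0 (by lia)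
  have hx0 : (x 0).1 = 0 := by
    have := hx 0 b (by lia) hb
    lia
  by_cases hc : ∃ a ≤ d, x a = (0, 1)
  · obtain ⟨l, hl, hl₁, hmax⟩ : ∃ l ≤ d, x l = (0, 1) ∧ ∀ a, l < a → a ≤ d → x a ≠ (0, 1) := by
      classical
      obtain ⟨c, hc, hc'⟩ := hc
      have := Nat.findGreatest_spec (P := fun a => x a = (0, 1)) hc hc'
      exact ⟨_, Nat.findGreatest_le d, this, fun a ha ha' => Nat.findGreatest_is_greatest ha ha'⟩
    -- A letter of level `n > 0` follows the last (0, 1), so the pivot is not the final letter.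
    have hla : l < a := by
      by_contra h
      have := (hx a l (by lia) hl).1
      rw [hl₁, han] at this
      lia
    by_cases hp : x (l + 1) = (0, 0)
    · have hla : l + 1 < a := by
        refine lt_of_le_of_ne hla ?_
        rintro rfl
        rw [hp] at han
        simp at han
        lia
      obtain ⟨d, rfl⟩ : ∃ m, d = m + 1 := ⟨d - 1, by lia⟩
      exact Or.inl ⟨d, l + 1, rfl, fun a ha => hne a (by lia), hs, h1, by lia, by lia,
        Or.inl ⟨hl₁, hp, fun a ha => hmax a ha⟩⟩
    · refine Or.inr (key (l + 1) (0, 0) (by lia) (by lia) (by simp [hl₁]) (by simp) rfl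
        (by simp [hl₁]) (Ne.symm hp) (Or.inl ⟨hl₁, rfl, fun a ha => hmax a ha⟩))
  · push Not at hc
    obtain ⟨c, hc₁, hc₂⟩ := h1
    have hex : ∃ a, (x a).2 = 1 := ⟨c, hc₂⟩
    obtain ⟨q, hq, hqc, hmin⟩ : ∃ p, (x p).2 = 1 ∧ p ≤ c ∧ ∀ a < p, (x a).2 = 0 :=
      ⟨Nat.find hex, Nat.find_spec hex, Nat.find_min' hex hc₂, fun a ha => by
        have := Nat.find_min hex ha
        have h' := Nat.find_min' hex hc₂
        have := (hx a a le_rfl (by lia)).2.2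
        lia⟩
    -- Since (0, 1) does not occur, the first letter with vertex 1 has positive level. The word
    -- starts at level 0, so this letter is not the initial one, and neither is a letter of the same
    -- level before it.
    have hq₁ : 1 ≤ (x q).1 := by
      have := hc q (by lia)
      grind
    have hq₀ : q ≠ 0 := by
      rintro rfl
      lia
    by_cases hp : (x (q - 1)).1 = (x q).1
    · have : q - 1 ≠ 0 := by
        intro h
        rw [h] at hp
        lia
      obtain ⟨d, rfl⟩ : ∃ m, d = m + 1 := ⟨d - 1, by lia⟩
      refine Or.inl ⟨d, q - 1, rfl, fun a ha => hne a (by lia), hs, ⟨c, hc₁, hc₂⟩, by lia, by lia,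
        Or.inr ⟨hc, ?_, fun a ha => hmin a (by lia)⟩⟩
      rw [Nat.sub_add_cancel (by lia)]
      grind
    · refine Or.inr (key q ((x q).1, 0) (by lia) (by lia) (hx _ _ (by lia) (by lia)).1 le_rfl rfl
        (by grind) (by grind) (Or.inr ⟨hc, ?_, hmin⟩))
      grind

lemma BoundaryPivot.disjoint {n d : ℕ} {u x : ℕ → ℕ × ℕ} {p q : ℕ}
    (h : BoundaryPivot n (d + 1) u p) (hx : IsDel (d + 1) p u x) : ¬ BoundaryPivot n d x q := by
  intro h'
  have h₁ := h.ne p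
  have h₂ := h.ne (p - 1)
  have h₃ := h.pos
  have h₄ := h.le
  have h₅ := h'.pos
  have h₆ := h'.le
  have x₁ := hx (p - 1) (by lia)
  have x₂ := hx p (by lia)
  have x₃ := hx (q - 1) (by lia)
  have x₄ := hx q (by lia)
  have x₅ := hx (q + 1) (by lia)
  rw [if_pos (by lia)] at x₁
  rw [if_neg (by lia)] at x₂
  obtain ⟨a₁, a₂, a₃⟩ | ⟨a₁, a₂, a₃⟩ := h.eq <;> obtain ⟨b₁, b₂, b₃⟩ | ⟨b₁, b₂, b₃⟩ := h'.eq
  · obtain rfl : p = q := by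
      have := b₃ (p - 1)
      have := a₃ (q - 1)
      have := a₃ q
      grind
    have := b₃ p
    grind
  · grind
  · have := a₁ (q - 1)
    have := a₁ q
    grind
  · obtain rfl : p = q + 1 := by
      have := b₃ p
      have := a₃ (q + 1)
      grind
    grind

lemma BoundaryPivot.inj {n d : ℕ} {u v x : ℕ → ℕ × ℕ} {p q : ℕ}
    (h : BoundaryPivot n d u p) (h' : BoundaryPivot n d v q) (hx : IsDel d p u x)
    (hx' : IsDel d q v x) (a : ℕ) (ha : a ≤ d + 1) : u a = v a := by
  have h₃ := h.pos
  have h₄ := h.le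
  have h₅ := h'.pos
  have h₆ := h'.le
  have x₁ := hx (p - 1) (by lia)
  have x₂ := hx p (by lia)
  have y₁ := hx (q - 1) (by lia)
  have y₂ := hx q (by lia)
  have x₃ := hx' (q - 1) (by lia)
  have x₄ := hx' q (by lia)
  have y₃ := hx' (p - 1) (by lia)
  have y₄ := hx' p (by lia)
  obtain ⟨rfl, e⟩ : p = q ∧ u p = v q := by
    obtain ⟨a₁, a₂, a₃⟩ | ⟨a₁, a₂, a₃⟩ := h.eq <;> obtain ⟨b₁, b₂, b₃⟩ | ⟨b₁, b₂, b₃⟩ := h'.eq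
    · have := a₃ q
      have := b₃ p
      have := a₃ (q - 1)
      have := b₃ (p - 1)
      grind
    · have := b₁ (p - 1)
      have := b₁ p
      grind
    · have := a₁ (q - 1)
      have := a₁ q
      grind
    · have c₁ := a₃ p
      have c₂ := a₃ q
      have c₃ := b₃ p
      have c₄ := b₃ q
      obtain rfl : p = q := by grind
      grind
  have z₁ := hx a
  have z₂ := hx (a - 1)
  have z₃ := hx' a
  have z₄ := hx' (a - 1)
  grind

open Classical in
/-- The rank function of the pairing. -/
noncomputable def boundaryRank (d : ℕ) (u : ℕ → ℕ × ℕ) (p : ℕ) : ℕ :=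
  if ∃ a ≤ d + 1, u a = (0, 1) then d + 2 + p else d + 1 - p

/-- Deleting a letter can destroy (0, 1) but not create it, so words avoiding (0, 1) are filled
first. They are filled by decreasing position of the pivot, the others by increasing position. -/
lemma BoundaryPivot.rank_lt {n d : ℕ} {u v x : ℕ → ℕ × ℕ} {p q j : ℕ}
    (h : BoundaryPivot n d u p) (h' : BoundaryPivot n d v q) (hjp : j ≠ p)
    (hx : IsDel d j u x) (hx' : IsDel d q v x) : boundaryRank d v q < boundaryRank d u p := by
  have h₃ := h.pos
  have h₄ := h.le
  have h₅ := h'.pos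
  have h₆ := h'.le
  have k₁ := h'.ne (p - 1)
  have k₂ := h'.ne p
  have x₁ := hx (p - 1) (by lia)
  have x₂ := hx p (by lia)
  have y₁ := hx (q - 1) (by lia)
  have y₂ := hx q (by lia)
  have x₃ := hx' (q - 1) (by lia)
  have x₄ := hx' q (by lia)
  have y₃ := hx' (p - 1) (by lia)
  have y₄ := hx' p (by lia)
  unfold boundaryRank
  obtain ⟨a₁, a₂, a₃⟩ | ⟨a₁, a₂, a₃⟩ := h.eq <;> obtain ⟨b₁, b₂, b₃⟩ | ⟨b₁, b₂, b₃⟩ := h'.eq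
  · rw [if_pos ⟨q - 1, by lia, b₁⟩, if_pos ⟨p - 1, by lia, a₁⟩]
    have := a₃ (q - 1)
    have := a₃ q
    have := b₃ p
    have := b₃ (p - 1)
    grind
  · rw [if_neg (by push Not; exact b₁), if_pos ⟨p - 1, by lia, a₁⟩]
    lia
  · have := a₁ (q - 1)
    have := a₁ q
    grind
  · rw [if_neg (by push Not; exact b₁), if_neg (by push Not; exact a₁)]
    have c₁ := a₃ p
    have c₂ := a₃ q
    have c₃ := b₃ p
    have c₄ := b₃ q
    grind

lemma Words.ι_of_boundaryPivot (n : ℕ) (hn : 0 < n) (W : Words X (HornRel n)) (N : ℕ)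
    (htr : ∀ (A B : X.Subcomplex) (h : A ≤ B),
      (∀ d ≤ N, B.obj (op ⦋d⦌) ⊆ A.obj _) → P (Subcomplex.homOfLE h))
    (A : X.Subcomplex) (hA : ∀ d (x : X _⦋d⦌), x ∉ A.obj _ ↔ BoundaryWord n d (W.letter x))
    (hP : ∀ d, ∀ p : Fin (d + 2), 0 < p → p < Fin.last (d + 1) → P Λ[d + 1, p].ι) :
    P A.ι := by
  refine W.ι_of_pairing N htr A (BoundaryWord n) hA (BoundaryPivot n) boundaryRank
    (fun _ _ _ _ => BoundaryPivot.congr) ?_ (fun _ _ _ _ _ h hx => h.boundaryWord hx)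
    (fun _ _ hx h hne => BoundaryPivot.exists hn hx h.1 h.2 hne)
    (fun _ _ _ _ _ _ h hx => h.disjoint hx)
    (fun _ _ _ _ _ _ _ _ h h' hx hx' => h.inj h' hx hx')
    (fun _ _ _ _ _ _ _ _ _ h h' _ hjp hx hx' => h.rank_lt h' hjp hx hx') ?_
  · intro d u p _ h
    exact ⟨by have := h.le; lia, fun a ha => h.ne a (by lia)⟩
  · intro d u p _ h _
    refine hP d _ ?_ ?_
    · rw [Fin.lt_def]
      exact h.pos
    · rw [Fin.lt_def]
      exact Nat.lt_succ_of_le h.le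

/-! ### Matching for thick horns -/

/-- The words in `thick n` containing all letters except possibly `i`. -/
abbrev ThickWord (n i d : ℕ) (u : ℕ → ℕ) : Prop := ∀ j ≤ n, j ≠ i → ∃ a ≤ d, u a = j

/-- The pivots for the pairing of the simplices of `thick n` outside of the `i`-th thick horn. -/
structure ThickPivot (n i : ℕ) (d : ℕ) (u : ℕ → ℕ) (p : ℕ) : Prop where
  ne : ∀ a ≤ d, u a ≠ u (a + 1)
  surj : ∀ j ≤ n, ∃ a ≤ d + 1, u a = j
  pos : 1 ≤ p
  le : p ≤ d
  eq : u p = i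
  ne_eq : u (p - 1) ≠ i
  ne_succ : u (p + 1) ≠ u (p - 1)
  prefix_eq : ∀ a < p, u a = i ∨ u a = u (p - 1)

lemma ThickPivot.congr {n i d : ℕ} {u u' : ℕ → ℕ} {p : ℕ} (h : ∀ a ≤ d + 1, u a = u' a)
    (hp : ThickPivot n i d u p) : ThickPivot n i d u' p := by
  obtain ⟨h₁, h₂, h₃, h₄, h₅, h₆, h₇, h₈⟩ := hp
  refine ⟨by grind, ?_, h₃, h₄, ?_, ?_, ?_, ?_⟩
  · intro j hj
    obtain ⟨a, ha, h'⟩ := h₂ j hj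
    exact ⟨a, ha, by rw [← h a ha, h']⟩
  all_goals grind

/-- The pivot is a letter `i`, which need not occur, between two different letters, so its deletion
creates no repetition. -/
lemma ThickPivot.thickWord {n i d : ℕ} {u x : ℕ → ℕ} {p : ℕ} (h : ThickPivot n i d u p)
    (hx : IsDel d p u x) : ThickWord n i d x ∧ ∀ a < d, x a ≠ x (a + 1) := by
  have h₁ := h.le
  have h₂ := h.pos
  have h₃ := h.eq
  refine ⟨fun j hj hji => ?_, fun a ha => ?_⟩
  · obtain ⟨a, ha, h'⟩ := h.surj j hj
    obtain ⟨b, hb, e⟩ := hx.exists (by lia) ha (by grind)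
    exact ⟨b, hb, by rw [e, h']⟩
  · rw [hx a (by lia), hx (a + 1) (by lia)]
    have := h.ne a
    have := h.ne (a + 1)
    have := h.ne_succ
    grind

/-- Let c be the first letter different from `i`, and cut the word before the first letter outside
{i, c}. If the letter before the cut is `i`, it is the pivot; otherwise that letter is c, and `i` is
inserted at the cut. At least one c precedes the pivot and the letter after the cut follows it, so
the pivot is interior. -/
lemma ThickPivot.exists {n i d : ℕ} {x : ℕ → ℕ} (hn : 2 ≤ n) (hi : i ≤ n)
    (hx : ∀ a b, a ≤ b → b ≤ d → x a ≤ n ∧ x b ≤ n) (hs : ThickWord n i d x)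
    (hne : ∀ a < d, x a ≠ x (a + 1)) :
    (∃ m p, d = m + 1 ∧ ThickPivot n i m x p) ∨
      ∃ u p, (∀ a b, a ≤ b → b ≤ d + 1 → u a ≤ n ∧ u b ≤ n) ∧ ThickPivot n i d u p ∧
        IsDel d p u x := by
  -- Here `2 ≤ n` is used: with two required letters besides `i`, the word cannot be made of `i` and
  -- c alone.
  obtain ⟨j₁, j₂, hj₁, hj₂, hj₁i, hj₂i, hj⟩ :
      ∃ j₁ j₂, j₁ ≤ n ∧ j₂ ≤ n ∧ j₁ ≠ i ∧ j₂ ≠ i ∧ j₁ ≠ j₂ := by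
    by_cases h0 : i = 0
    · exact ⟨1, 2, by lia⟩
    by_cases h1 : i = 1
    · exact ⟨0, 2, by lia⟩
    · exact ⟨0, 1, by lia⟩
  obtain ⟨a₁, ha₁, e₁⟩ := hs j₁ hj₁ hj₁i
  obtain ⟨a₂, ha₂, e₂⟩ := hs j₂ hj₂ hj₂i
  obtain ⟨s, hs₁, hsi, hmin⟩ : ∃ s, s ≤ a₁ ∧ x s ≠ i ∧ ∀ a < s, x a = i := by
    have hex : ∃ a, x a ≠ i := ⟨a₁, by lia⟩
    exact ⟨Nat.find hex, Nat.find_min' hex (by lia), Nat.find_spec hex,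
      fun a ha => not_not.1 (Nat.find_min hex ha)⟩
  obtain ⟨t, htd, hti, hts, hmin'⟩ : ∃ t ≤ d, x t ≠ i ∧ x t ≠ x s ∧
      ∀ a < t, x a = i ∨ x a = x s := by
    have hex : ∃ a, x a ≠ i ∧ x a ≠ x s := by
      by_cases h : x a₁ = x s
      · exact ⟨a₂, by lia, by lia⟩
      · exact ⟨a₁, by lia, h⟩
    refine ⟨Nat.find hex, ?_, (Nat.find_spec hex).1, (Nat.find_spec hex).2, fun a ha => ?_⟩
    · by_cases h : x a₁ = x s
      · exact (Nat.find_min' hex (m := a₂) ⟨by lia, by lia⟩).trans ha₂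
      · exact (Nat.find_min' hex (m := a₁) ⟨by lia, h⟩).trans ha₁
    · have := Nat.find_min hex ha
      tauto
  have hst : s < t := by
    by_contra h
    obtain h | h := (not_lt.1 h).eq_or_lt
    · exact hts (by rw [h])
    · exact hti (hmin t h)
  by_cases hp : x (t - 1) = i
  · have h₁ : s ≠ t - 1 := by
      rintro rfl
      exact hsi hp
    have h₂ : x (t - 1 - 1) = x s := by
      have := hmin' (t - 1 - 1) (by lia)
      have h := hne (t - 1 - 1) (by lia)
      rw [Nat.sub_add_cancel (by lia)] at h
      lia
    obtain ⟨d, rfl⟩ : ∃ m, d = m + 1 := ⟨d - 1, by lia⟩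
    refine Or.inl ⟨d, t - 1, rfl, fun a ha => hne a (by lia), fun j hj => ?_, by lia, by lia, hp,
      by rw [h₂]; exact hsi, ?_, fun a ha => ?_⟩
    · by_cases hji : j = i
      · exact ⟨t - 1, by lia, by rw [hp, hji]⟩
      · exact hs j hj hji
    · rw [h₂, Nat.sub_add_cancel (by lia)]
      exact hts
    · rw [h₂]
      exact hmin' a (by lia)
  · have hps : x (t - 1) = x s := (hmin' _ (by lia)).resolve_left hp
    have f₁ : ∀ a < t, insWord t i x a = x a := fun a ha => if_pos ha
    have f₂ : insWord t i x t = i := by simp [insWord]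
    have f₃ : insWord t i x (t + 1) = x t := by simp [insWord]
    refine Or.inr ⟨insWord t i x, t, insWord_rel (R := fun a b => a ≤ n ∧ b ≤ n) hx (by lia)
      (fun a ha => ⟨(hx a a le_rfl (by lia)).1, hi⟩) (fun b _ hbd => ⟨hi, (hx b b le_rfl hbd).1⟩)
      ⟨hi, hi⟩, ⟨insWord_ne hne (by lia) htd hp hti.symm, fun j hj => ?_, by lia, htd, f₂, ?_, ?_,
      fun a ha => ?_⟩, isDel_insWord d t i x⟩
    · by_cases hji : j = i
      · exact ⟨t, by lia, by rw [f₂, hji]⟩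
      · exact exists_insWord (fun q => q = j) (hs j hj hji)
    · rwa [f₁ _ (by lia)]
    · rw [f₃, f₁ _ (by lia), hps]
      exact hts
    · rw [f₁ _ ha, f₁ _ (by lia), hps]
      exact hmin' a ha

lemma ThickPivot.disjoint {n i d : ℕ} {u x : ℕ → ℕ} {p q : ℕ}
    (h : ThickPivot n i (d + 1) u p) (hx : IsDel (d + 1) p u x) : ¬ ThickPivot n i d x q := by
  intro h'
  have h₁ := h.ne p
  have h₂ := h.ne_eq
  have h₃ := h.pos
  have h₄ := h.le
  have h₅ := h'.pos
  have h₆ := h'.le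
  have h₇ := h.eq
  have h₈ := h.ne_succ
  have h₉ := h'.eq
  have h₁₀ := h'.ne_eq
  have h₁₁ := h'.ne_succ
  have h₁₂ := h.prefix_eq (q - 1)
  have h₁₃ := h'.prefix_eq p
  have h₁₄ := h'.prefix_eq (p - 1)
  have h₁₅ := h.prefix_eq (q + 1)
  have x₁ := hx (p - 1) (by lia)
  have x₂ := hx p (by lia)
  have x₃ := hx (q - 1) (by lia)
  have x₄ := hx q (by lia)
  have x₅ := hx (q + 1) (by lia)
  have h₁₆ := h'.ne (q - 1)
  have h₁₇ := h'.ne q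
  clear h h' hx
  grind

lemma ThickPivot.inj {n i d : ℕ} {u v x : ℕ → ℕ} {p q : ℕ}
    (h : ThickPivot n i d u p) (h' : ThickPivot n i d v q) (hx : IsDel d p u x)
    (hx' : IsDel d q v x) (a : ℕ) (ha : a ≤ d + 1) : u a = v a := by
  wlog hpq : p ≤ q generalizing u v p q
  · exact (this h' h hx' hx (by lia)).symm
  have h₁ := h.ne p
  have h₂ := h.ne_eq
  have h₃ := h.pos
  have h₄ := h.le
  have h₅ := h'.pos
  have h₆ := h'.le
  have h₇ := h.eq
  have h₈ := h.ne_succ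
  have h₉ := h'.eq
  have h₁₀ := h'.prefix_eq p
  have h₁₁ := h'.prefix_eq (p - 1)
  have x₁ := hx (p - 1) (by lia)
  have x₂ := hx p (by lia)
  have x₃ := hx' (p - 1) (by lia)
  have x₄ := hx' p (by lia)
  obtain rfl : p = q := by
    clear h h' hx hx'
    grind
  have z₁ := hx a
  have z₂ := hx (a - 1)
  have z₃ := hx' a
  have z₄ := hx' (a - 1)
  clear h h' hx hx'
  grind

/-- A matched face has its pivot strictly further to the right, so pairs are filled by decreasing
position. -/
lemma ThickPivot.rank_lt {n i d : ℕ} {u v x : ℕ → ℕ} {p q j : ℕ}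
    (h : ThickPivot n i d u p) (h' : ThickPivot n i d v q) (hjp : j ≠ p)
    (hx : IsDel d j u x) (hx' : IsDel d q v x) : d + 1 - q < d + 1 - p := by
  have h₃ := h.pos
  have h₄ := h.le
  have h₅ := h'.pos
  have h₆ := h'.le
  suffices p < q by lia
  by_contra hpq
  have h₇ := h.eq
  have h₉ := h'.eq
  have h₁₀ := h'.ne_eq
  have h₁₁ := h'.ne_succ
  have h₁₂ := h.prefix_eq q
  have h₁₃ := h.prefix_eq (q - 1)
  have h₁₄ := h.prefix_eq (q + 1)
  have x₁ := hx q (by lia)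
  have x₂ := hx (q - 1) (by lia)
  have x₃ := hx' q (by lia)
  have x₄ := hx' (q - 1) (by lia)
  have h₁₅ := h'.ne q
  clear h h' hx hx'
  grind

lemma Words.ι_of_thickPivot (n i : ℕ) (hn : 2 ≤ n) (hi : i ≤ n)
    (W : Words X (fun x y => x ≤ n ∧ y ≤ n)) (N : ℕ)
    (htr : ∀ (A B : X.Subcomplex) (h : A ≤ B),
      (∀ d ≤ N, B.obj (op ⦋d⦌) ⊆ A.obj _) → P (Subcomplex.homOfLE h))
    (A : X.Subcomplex) (hA : ∀ d (x : X _⦋d⦌), x ∉ A.obj _ ↔ ThickWord n i d (W.letter x))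
    (hP : ∀ d, n ≤ d + 1 → ∀ p : Fin (d + 2), 0 < p → p < Fin.last (d + 1) → P Λ[d + 1, p].ι) :
    P A.ι := by
  refine W.ι_of_pairing N htr A (ThickWord n i) hA (ThickPivot n i) (fun d _ p => d + 1 - p)
    (fun _ _ _ _ => ThickPivot.congr) ?_ (fun _ _ _ _ _ h hx => h.thickWord hx)
    (fun _ _ hx h hne => ThickPivot.exists hn hi hx h hne)
    (fun _ _ _ _ _ _ h hx => h.disjoint hx)
    (fun _ _ _ _ _ _ _ _ h h' hx hx' => h.inj h' hx hx')
    (fun _ _ _ _ _ _ _ _ _ h h' _ hjp hx hx' => h.rank_lt h' hjp hx hx') ?_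
  · intro d u p _ h
    exact ⟨by have := h.le; lia, fun a ha => h.ne a (by lia)⟩
  · intro d u p _ h _
    refine hP d (card_le_of_surj u h.surj) _ ?_ ?_
    · rw [Fin.lt_def]
      exact h.pos
    · rw [Fin.lt_def]
      exact Nat.lt_succ_of_le h.le

end Pairings

end HigherCat

namespace HigherCat

open SSet MonoidalCategory

/-! ### Simplices of thick simplices and of prisms as words -/

lemma δ_toOrderHom_val {n : ℕ} (j : Fin (n + 2)) (a : ℕ) (ha : a ≤ n) :
    ((SimplexCategory.δ j).toOrderHom ⟨a, Nat.lt_succ_of_le ha⟩ : Fin (n + 2)).val =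
      if a < j then a else a + 1 := by
  change ((j.succAbove ⟨a, _⟩ : Fin (n + 2)) : ℕ) = _
  rw [Fin.succAbove]
  split_ifs with h h' h'
  · rfl
  · exact absurd (show a < (j : ℕ) from h) h'
  · exact absurd (show a < (j : ℕ) from h') h
  · rfl

lemma σ_toOrderHom_val {n : ℕ} (j : Fin (n + 1)) (a : ℕ) (ha : a ≤ n + 1) :
    ((SimplexCategory.σ j).toOrderHom ⟨a, Nat.lt_succ_of_le ha⟩ : Fin (n + 1)).val =
      if a ≤ j then a else a - 1 := by
  change ((j.predAbove ⟨a, _⟩ : Fin (n + 1)) : ℕ) = _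
  rw [Fin.predAbove]
  split_ifs with h h' h'
  · exact absurd (show (j : ℕ) < a from h) (by lia)
  · rfl
  · rfl
  · exact absurd (show (j : ℕ) < a from not_le.1 h') h

/-- The value at `a` of a function on `{0, …, n}`, extended by a constant. -/
def letterOf {Q : Type*} {n : ℕ} (x : Fin (n + 1) → Q) (a : ℕ) : Q := x ⟨min a n, by lia⟩

lemma letterOf_of_le {Q : Type*} {n : ℕ} (x : Fin (n + 1) → Q) (a : ℕ) (ha : a ≤ n) :
    letterOf x a = x ⟨a, Nat.lt_succ_of_le ha⟩ := by
  simp [letterOf, ha]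

lemma isDel_letterOf {Q : Type*} {n : ℕ} (x : Fin (n + 2) → Q) (j : Fin (n + 2)) :
    IsDel n j (letterOf x) (letterOf fun a => x ((SimplexCategory.δ j).toOrderHom a)) := by
  intro a ha
  rw [letterOf_of_le _ _ ha]
  have h := δ_toOrderHom_val j a ha
  split_ifs with h'
  · rw [letterOf_of_le _ _ (by lia)]
    rw [if_pos h'] at h
    exact congrArg x (Fin.ext h)
  · rw [letterOf_of_le _ _ (by lia)]
    rw [if_neg h'] at h
    exact congrArg x (Fin.ext h)

lemma letterOf_σ {Q : Type*} {n : ℕ} (x : Fin (n + 1) → Q) (j : Fin (n + 1)) (a : ℕ)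
    (ha : a ≤ n + 1) :
    letterOf (n := n + 1) (fun a => x ((SimplexCategory.σ j).toOrderHom a)) a =
      if a ≤ j then letterOf x a else letterOf x (a - 1) := by
  rw [letterOf_of_le _ _ ha]
  have h := σ_toOrderHom_val j a ha
  have := j.2
  split_ifs with h'
  · rw [letterOf_of_le _ _ (by lia)]
    rw [if_pos h'] at h
    exact congrArg x (Fin.ext h)
  · rw [letterOf_of_le _ _ (by lia)]
    rw [if_neg h'] at h
    exact congrArg x (Fin.ext h)

/-- The simplices of the thick simplex `thick ⦋n⦌` are words in the letters `0, …, n`. -/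
def thickWords (n : ℕ) : Words (thick.{v}.obj ⦋n⦌) (fun x y => x ≤ n ∧ y ≤ n) where
  letter x := letterOf fun j => (x j).down.val
  ext x y h := by
    funext a
    have := h a (by have := a.2; lia)
    rw [letterOf_of_le _ _ (by have := a.2; lia), letterOf_of_le _ _ (by have := a.2; lia)] at this
    exact ULift.ext _ _ (Fin.ext this)
  rel x a b _ _ := ⟨Nat.le_of_lt_succ (Fin.is_lt _), Nat.le_of_lt_succ (Fin.is_lt _)⟩
  exists_letter d u h := ⟨fun a => ⟨⟨u a, Nat.lt_succ_of_le
      (h a a le_rfl (Nat.le_of_lt_succ a.2)).1⟩⟩, fun a ha => letterOf_of_le _ _ ha⟩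
  letter_δ x j := isDel_letterOf _ j
  letter_σ x j a ha := letterOf_σ (fun j => (x j).down.val) j a ha

/-- The simplices of `Δ[m] ⊗ thick ⦋1⦌` are words in the letters `(i, ε)`, where `ε` says
whether a vertex of `thick ⦋1⦌` is different from the given vertex `e`. -/
def prodWords (m : ℕ) (e : Fin 2) :
    Words (Δ[m] ⊗ thick.{v}.obj ⦋1⦌) (HornRel m) where
  letter x := letterOf fun j => ((x.1 j).val, (((x.2 j).down + e : Fin 2)).val)
  ext {d} x y h := by
    have h' (a : Fin (d + 1)) : x.1 a = y.1 a ∧ x.2 a = y.2 a := by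
      have := h a (by have := a.2; lia)
      rw [letterOf_of_le _ _ (by have := a.2; lia), letterOf_of_le _ _ (by have := a.2; lia),
        Prod.mk.injEq] at this
      exact ⟨Fin.ext this.1, ULift.ext _ _ (add_right_cancel (Fin.ext this.2))⟩
    exact Prod.ext (DFunLike.ext _ _ (fun a => (h' a).1)) (funext fun a => (h' a).2)
  rel {d} x a b hab hb := by
    refine ⟨?_, Nat.le_of_lt_succ (Fin.is_lt _), Nat.le_of_lt_succ (Fin.is_lt _)⟩
    rw [letterOf_of_le _ _ hb, letterOf_of_le _ _ (hab.trans hb)]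
    exact stdSimplex.monotone_apply x.1 (Fin.mk_le_mk.2 hab)
  exists_letter d u h := by
    have h₁ (a : Fin (d + 1)) : (u a).1 < m + 1 :=
      Nat.lt_succ_of_le (h a a le_rfl (Nat.le_of_lt_succ a.2)).2.1
    have h₂ (a : Fin (d + 1)) : (u a).2 < 2 :=
      Nat.lt_succ_of_le (h a a le_rfl (Nat.le_of_lt_succ a.2)).2.2
    refine ⟨⟨stdSimplex.objMk ⟨fun a => ⟨(u a).1, h₁ a⟩, fun a b hab =>
      (h a b hab (Nat.le_of_lt_succ b.2)).1⟩, fun a => ⟨⟨(u a).2, h₂ a⟩ - e⟩⟩, fun a ha => ?_⟩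
    rw [letterOf_of_le _ _ ha]
    exact Prod.ext rfl (by simp)
  letter_δ x j := isDel_letterOf (fun j => ((x.1 j).val, (((x.2 j).down + e : Fin 2)).val)) j
  letter_σ x j a ha := letterOf_σ (fun j => ((x.1 j).val, (((x.2 j).down + e : Fin 2)).val)) j a ha

lemma exists_letterOf_iff {Q : Type*} {n : ℕ} (x : Fin (n + 1) → Q) (p : Q → Prop) :
    (∃ a ≤ n, p (letterOf x a)) ↔ ∃ a, p (x a) :=
  ⟨fun ⟨a, ha, h⟩ => ⟨_, letterOf_of_le x a ha ▸ h⟩,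
    fun ⟨a, h⟩ => ⟨a, Nat.le_of_lt_succ a.2, by
      rwa [letterOf_of_le x a (Nat.le_of_lt_succ a.2)]⟩⟩

/-- The vertex `e` of the thick `1`-simplex, as a subcomplex. -/
abbrev thickPt (e : Fin 2) : (thick.{v}.obj ⦋1⦌).Subcomplex := Subcomplex.range (thickVertex e)

/-- The two vertices of the thick `1`-simplex. -/
def thickEnds : (thick.{v}.obj ⦋1⦌).Subcomplex := thickPt 0 ⊔ thickPt 1

lemma mem_thickPt_iff {e : Fin 2} {d : ℕ} (x : (thick.{v}.obj ⦋1⦌) _⦋d⦌) :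
    x ∈ (thickPt e).obj _ ↔ ∀ j : Fin (d + 1), (x j).down = e :=
  ⟨by rintro ⟨y, rfl⟩ j; rfl,
    fun h => ⟨stdSimplex.objEquiv.symm (SimplexCategory.const ⦋d⦌ ⦋0⦌ 0),
      funext fun j => ULift.ext _ _ (h j).symm⟩⟩

lemma mem_thickEnds_iff {d : ℕ} (x : (thick.{v}.obj ⦋1⦌) _⦋d⦌) :
    x ∈ thickEnds.obj _ ↔
      (∀ j : Fin (d + 1), (x j).down = 0) ∨ ∀ j : Fin (d + 1), (x j).down = 1 :=
  (or_congr (mem_thickPt_iff x) (mem_thickPt_iff x) :)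

lemma notMem_thickPt_iff {e : Fin 2} {d : ℕ} (x : (thick.{v}.obj ⦋1⦌) _⦋d⦌) :
    x ∉ (thickPt e).obj _ ↔ ∃ j : Fin (d + 1), ((x j).down + e : Fin 2).val = 1 := by
  rw [mem_thickPt_iff, not_forall]
  refine exists_congr fun j => ?_
  generalize (x j).down = y
  revert y e
  decide

lemma notMem_thickEnds_iff {d : ℕ} (x : (thick.{v}.obj ⦋1⦌) _⦋d⦌) :
    x ∉ thickEnds.obj _ ↔ (∃ j : Fin (d + 1), ((x j).down + 0 : Fin 2).val = 0) ∧
      ∃ j : Fin (d + 1), ((x j).down + 0 : Fin 2).val = 1 := by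
  have h (y : Fin 2) : y ≠ 0 ↔ y = 1 := by revert y; decide
  have h' (y : Fin 2) : y ≠ 1 ↔ y = 0 := by revert y; decide
  have h₁ (y : Fin 2) : (y + 0 : Fin 2).val = 0 ↔ y = 0 := by revert y; decide
  have h₂ (y : Fin 2) : (y + 0 : Fin 2).val = 1 ↔ y = 1 := by revert y; decide
  simp only [mem_thickEnds_iff, not_or, not_forall, h, h', h₁, h₂]
  exact and_comm

lemma notMem_boundary_iff {m d : ℕ} (x : (Δ[m] : SSet.{v}) _⦋d⦌) :
    x ∉ ∂Δ[m].obj _ ↔ ∀ j ≤ m, ∃ a : Fin (d + 1), (x a).val = j := by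
  rw [mem_boundary_iff_notMem_range, not_exists]
  simp only [not_not, Set.mem_range]
  exact ⟨fun h j hj => (h ⟨j, Nat.lt_succ_of_le hj⟩).imp fun a ha => by rw [ha],
    fun h j => (h j (Nat.le_of_lt_succ j.2)).imp fun a ha => Fin.ext ha⟩

lemma notMem_horn_iff {m d : ℕ} {i : Fin (m + 1)} (x : (Δ[m] : SSet.{v}) _⦋d⦌) :
    x ∉ Λ[m, i].obj _ ↔ ∀ j ≤ m, j ≠ i → ∃ a : Fin (d + 1), (x a).val = j := by
  rw [mem_horn_iff_notMem_range, not_exists]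
  simp only [not_exists, Set.mem_range, not_forall, not_not]
  exact ⟨fun h j hj hji => (h ⟨j, Nat.lt_succ_of_le hj⟩ (fun e => hji (by rw [← e]))).imp
    fun a ha => by rw [ha],
    fun h j hji => (h j (Nat.le_of_lt_succ j.2) (fun e => hji (Fin.ext e))).imp
      fun a ha => Fin.ext ha⟩

lemma boundaryWord_prodWords_iff {m : ℕ} {e : Fin 2} {d : ℕ}
    (x : (Δ[m] ⊗ thick.{v}.obj ⦋1⦌ : SSet) _⦋d⦌) :
    x ∉ (∂Δ[m].unionProd (thickPt e)).obj _ ↔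
      BoundaryWord m d ((prodWords m e).letter x) := by
  refine ((not_congr (Subcomplex.mem_unionProd_iff _ _ x)).trans not_or).trans ?_
  rw [notMem_thickPt_iff, notMem_boundary_iff, and_comm]
  refine and_congr (forall₂_congr fun j _ => ?_) ?_
  · exact (exists_letterOf_iff (fun j => ((x.1 j).val, (((x.2 j).down + e : Fin 2)).val))
      (fun y => y.1 = j)).symm
  · exact (exists_letterOf_iff (fun j => ((x.1 j).val, (((x.2 j).down + e : Fin 2)).val))
      (fun y => y.2 = 1)).symm

lemma hornWord_prodWords_iff {m : ℕ} {i : Fin (m + 1)} {d : ℕ}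
    (x : (Δ[m] ⊗ thick.{v}.obj ⦋1⦌ : SSet) _⦋d⦌) :
    x ∉ (Λ[m, i].unionProd thickEnds).obj _ ↔
      HornWord m i d ((prodWords m 0).letter x) := by
  refine ((not_congr (Subcomplex.mem_unionProd_iff _ _ x)).trans not_or).trans ?_
  rw [notMem_thickEnds_iff, notMem_horn_iff, and_comm]
  refine and_congr (forall₃_congr fun j _ _ => ?_) (and_congr ?_ ?_)
  · exact (exists_letterOf_iff (fun j => ((x.1 j).val, (((x.2 j).down + 0 : Fin 2)).val))
      (fun y => y.1 = j)).symm
  · exact (exists_letterOf_iff (fun j => ((x.1 j).val, (((x.2 j).down + 0 : Fin 2)).val))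
      (fun y => y.2 = 0)).symm
  · exact (exists_letterOf_iff (fun j => ((x.1 j).val, (((x.2 j).down + 0 : Fin 2)).val))
      (fun y => y.2 = 1)).symm

/-! ### Lifting properties of quasi-fibrations -/

section

variable {V : Type u} [Category.{v} V] [HasFiniteLimits V] {J : MorphismProperty V}
  [IsDescentCategory J] {N : ℕ} {X Y : SimplicialObject V} {f : X ⟶ Y}
  {C : MorphismProperty (Vᵒᵖ ⥤ Type v)} [C.IsMultiplicative] [C.IsStableUnderBaseChange]

lemma liftIn_homOfLE_of_cosk (hX : Cosk N X) (hY : Cosk N Y) {T : SSet.{v}} (A B : T.Subcomplex)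
    (h : A ≤ B) (h' : ∀ d ≤ N, B.obj (op ⦋d⦌) ⊆ A.obj _) :
    liftProp C f (Subcomplex.homOfLE h) := by
  have := hX.isIso_res_homOfLE A B h h'
  have := hY.isIso_res_homOfLE A B h h'
  exact LiftIn.of_isIso_res

/-- The hypothesis is restricted to horns of dimension at least `n` so that it can be used for
isomorphisms above `k` as well as for covers. -/
lemma liftIn_horn_unionProd_thickEnds (hX : Cosk N X) (hY : Cosk N Y) {n : ℕ} {i : Fin (n + 1)}
    (h₀ : 0 < i) (h₁ : i < Fin.last n)
    (hf : ∀ d, n ≤ d + 1 → ∀ p : Fin (d + 2), 0 < p → p < Fin.last (d + 1) →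
      LiftIn C Λ[d + 1, p].ι f) :
    LiftIn C (Λ[n, i].unionProd thickEnds).ι f :=
  Words.ι_of_hornPivot (P := liftProp C f) n i h₀ h₁ (prodWords n 0) N
    (liftIn_homOfLE_of_cosk hX hY) _ (fun _ => hornWord_prodWords_iff) hf

lemma range_lift_thickVertex (e : Fin 2) :
    Subcomplex.range (CartesianMonoidalCategory.lift (𝟙 Δ[0]) (thickVertex.{v} e)) =
      ∂Δ[0].unionProd (thickPt e) := by
  ext ⟨d⟩ x
  refine ⟨?_, fun hx => ?_⟩
  · rintro ⟨y, rfl⟩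
    exact Or.inl ⟨trivial, ⟨y, rfl⟩⟩
  · obtain ⟨y, hy⟩ | hx := (Subcomplex.mem_unionProd_iff _ _ _).1 hx
    · refine ⟨x.1, Prod.ext rfl (hy ▸ rfl)⟩
    · exact absurd hx (by simp)

/-- For `n = 0` the boundary is empty and the inclusion is that of a vertex in the thick interval,
which no inner horn reaches; the second clause of `quasiFibration` is there for this case. -/
lemma liftIn_boundary_unionProd_thickPt (hX : Cosk N X) (hY : Cosk N Y)
    (hf : quasiFibration J f) (n : ℕ) (e : Fin 2) :
    LiftIn J.presheaf (∂Δ[n].unionProd (thickPt e)).ι f := by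
  obtain rfl | hn := Nat.eq_zero_or_pos n
  · rw [← range_lift_thickVertex e]
    refine (liftIn_congr f (Arrow.isoMk' _ _ (asIso (Subcomplex.toRange
      (CartesianMonoidalCategory.lift (𝟙 Δ[0]) (thickVertex.{v} e)))).symm
      { hom := CartesianMonoidalCategory.snd _ _
        inv := CartesianMonoidalCategory.lift (stdSimplex.isTerminalObj₀.from _) (𝟙 _)
        hom_inv_id := CartesianMonoidalCategory.hom_ext _ _ (stdSimplex.isTerminalObj₀.hom_ext _ _)
          rfl
        inv_hom_id := rfl } ?_)).2 (liftIn_iff.2 (hf.2 e))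
    rw [Iso.symm_hom, asIso_inv, IsIso.inv_comp_eq]
    rfl
  · exact Words.ι_of_boundaryPivot (P := liftProp J.presheaf f) n hn (prodWords n e) N
      (liftIn_homOfLE_of_cosk hX hY) _ (fun _ => boundaryWord_prodWords_iff)
      (fun d p h₀ h₁ => liftIn_iff.2 (hf.1 _ p h₀ h₁))

end

end HigherCat

namespace HigherCat

open SSet MonoidalCategory

/-! ### Spaces of maps out of cosimplicial simplicial sets -/

/-- The simplicial set `n ↦ Hom(D n, K)`, for a cosimplicial simplicial set `D`. -/
abbrev cosimpHom (D : CosimplicialObject SSet.{v}) : SSet.{v} ⥤ SSet.{v} :=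
  (D.op ⋙ coyoneda).flip

/-- The functoriality of `cosimpHom`. -/
abbrev cosimpHomMap {D D' : CosimplicialObject SSet.{v}} (τ : D' ⟶ D) :
    cosimpHom D ⟶ cosimpHom D' :=
  (flipFunctor _ _ _).map (Functor.whiskerRight (NatTrans.op τ) coyoneda)

/-- `LT` represents the functor `K ↦ Hom(T, Hom(D -, K))`. -/
structure Realization (D : CosimplicialObject SSet.{v}) (T LT : SSet.{v}) where
  /-- the universal element -/
  u : T ⟶ (cosimpHom D).obj LT
  bijective : ∀ K : SSet.{v}, Function.Bijective fun ψ : LT ⟶ K => u ≫ (cosimpHom D).map ψ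

section

variable {V : Type u} [Category.{v} V]

/-- The simplicial presheaf `n ↦ Map(D n, X)`. -/
abbrev cotMap (D : CosimplicialObject SSet.{v}) :
    SimplicialObject V ⥤ SimplicialObject (Vᵒᵖ ⥤ Type v) :=
  (D.op ⋙ mapFunctor).flip

/-- The functoriality of `cotMap`. -/
abbrev cotMapMap {D D' : CosimplicialObject SSet.{v}} (τ : D' ⟶ D) :
    cotMap (V := V) D ⟶ cotMap D' :=
  (flipFunctor _ _ _).map (Functor.whiskerRight (NatTrans.op τ) mapFunctor)

instance : (simplicialYoneda (V := V)).Full :=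
  inferInstanceAs ((Functor.whiskeringRight _ _ _).obj yoneda).Full

instance : (simplicialYoneda (V := V)).Faithful :=
  inferInstanceAs ((Functor.whiskeringRight _ _ _).obj yoneda).Faithful

lemma essImage_yoneda {F : Vᵒᵖ ⥤ Type v} (h : F.IsRepresentable) : yoneda.essImage F :=
  ⟨F.reprX, ⟨F.reprW⟩⟩

lemma essImage_simplicialYoneda {F : SimplicialObject (Vᵒᵖ ⥤ Type v)}
    (h : ∀ n, (F.obj n).IsRepresentable) : simplicialYoneda.essImage F :=
  ⟨Functor.essImage.liftFunctor F yoneda fun n => essImage_yoneda (h n),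
    ⟨Functor.essImage.liftFunctorCompIso F yoneda fun n => essImage_yoneda (h n)⟩⟩

variable [HasFiniteLimits V] {J : MorphismProperty V} [IsDescentCategory J] {k : ℕ} [NeZero k]

lemma KCat.cosk (X : KCat J k) : Cosk (k + 1) X.obj := X.2.cosk (NeZero.pos k)

variable (J k) in
/-- The functor sending a `k`-category `X` to the simplicial space `n ↦ Map(D n, X)`. -/
noncomputable def cot (D : CosimplicialObject SSet.{v}) [h : ∀ n d, Finite ((D.obj n) _⦋d⦌)] :
    KCat J k ⥤ SimplicialObject V :=
  Functor.essImage.liftFunctor (KCat.incl J k ⋙ cotMap D) simplicialYoneda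
    fun X => essImage_simplicialYoneda fun n => X.cosk.isRepresentable_map (D.obj n.unop)

variable (J k) in
/-- The defining property of `cot`. -/
noncomputable def cotIso (D : CosimplicialObject SSet.{v}) [∀ n d, Finite ((D.obj n) _⦋d⦌)] :
    cot J k D ⋙ simplicialYoneda ≅ KCat.incl J k ⋙ cotMap D :=
  Functor.essImage.liftFunctorCompIso _ _ _

variable {D D' : CosimplicialObject SSet.{v}} [∀ n d, Finite ((D.obj n) _⦋d⦌)]
  [∀ n d, Finite ((D'.obj n) _⦋d⦌)]

variable (J k) in
/-- The functoriality of `cot`. -/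
noncomputable def cotNat (τ : D' ⟶ D) : cot J k D ⟶ cot J k D' :=
  ((Functor.FullyFaithful.ofFullyFaithful simplicialYoneda).whiskeringRight _).preimage
    ((cotIso J k D).hom ≫ Functor.whiskerLeft _ (cotMapMap τ) ≫ (cotIso J k D').inv)

lemma cotNat_spec (τ : D' ⟶ D) (X : KCat J k) :
    simplicialYoneda.map ((cotNat J k τ).app X) ≫ (cotIso J k D').hom.app X =
      (cotIso J k D).hom.app X ≫ (cotMapMap τ).app X.obj := by
  have := ((Functor.FullyFaithful.ofFullyFaithful simplicialYoneda).whiskeringRight _).map_preimage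
    ((cotIso J k D).hom ≫ Functor.whiskerLeft _ (cotMapMap τ) ≫ (cotIso J k D').inv)
  have := congr_app this X
  dsimp at this
  erw [this]
  simp

/-- The isomorphism between the simplices of `cot D X` and maps out of `D`. -/
noncomputable def cotHomIso (D : CosimplicialObject SSet.{v}) [∀ n d, Finite ((D.obj n) _⦋d⦌)]
    (X : KCat J k) (U : Vᵒᵖ) :
    (cot J k D).obj X ⋙ coyoneda.obj U ≅ (cosimpHom D).obj (X.obj ⋙ coyoneda.obj U) :=
  Functor.isoWhiskerRight ((cotIso J k D).app X) ((evaluation _ _).obj U)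

/-- The universal property of `cot D X`. -/
noncomputable def Realization.homEquiv {T LT : SSet.{v}} (r : Realization D T LT) (X : KCat J k)
    (U : Vᵒᵖ) :
    (LT ⟶ X.obj ⋙ coyoneda.obj U) ≃ (T ⟶ (cot J k D).obj X ⋙ coyoneda.obj U) :=
  (Equiv.ofBijective _ (r.bijective _)).trans ((cotHomIso D X U).homToEquiv).symm

lemma Realization.homEquiv_comp {T LT : SSet.{v}} (r : Realization D T LT) (X : KCat J k)
    (U : Vᵒᵖ) (ψ : LT ⟶ X.obj ⋙ coyoneda.obj U) :
    r.homEquiv X U ψ ≫ (cotHomIso D X U).hom = r.u ≫ (cosimpHom D).map ψ := by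
  simp [Realization.homEquiv]

lemma cotHomIso_naturality_left (X : KCat J k) {U U' : Vᵒᵖ} (a : U ⟶ U') :
    Functor.whiskerLeft ((cot J k D).obj X) (coyoneda.map a) ≫ (cotHomIso D X U').hom =
      (cotHomIso D X U).hom ≫ (cosimpHom D).map (Functor.whiskerLeft X.obj (coyoneda.map a)) := by
  ext n x
  exact ConcreteCategory.congr_hom (((cotIso J k D).hom.app X |>.app n).naturality a) x

lemma cotHomIso_naturality_right {X Y : KCat J k} (f : X ⟶ Y) (U : Vᵒᵖ) :
    Functor.whiskerRight ((cot J k D).map f) (coyoneda.obj U) ≫ (cotHomIso D Y U).hom =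
      (cotHomIso D X U).hom ≫
        (cosimpHom D).map (Functor.whiskerRight f.hom (coyoneda.obj U)) := by
  ext n x
  exact ConcreteCategory.congr_hom
    (congr_app (congr_app ((cotIso J k D).hom.naturality f) n) U) x

lemma cotHomIso_naturality_cosimplicial (τ : D' ⟶ D) (X : KCat J k) (U : Vᵒᵖ) :
    Functor.whiskerRight ((cotNat J k τ).app X) (coyoneda.obj U) ≫ (cotHomIso D' X U).hom =
      (cotHomIso D X U).hom ≫ (cosimpHomMap τ).app (X.obj ⋙ coyoneda.obj U) := by
  ext n x
  exact ConcreteCategory.congr_hom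
    (congr_app (congr_app (cotNat_spec τ X) n) U) x

variable {T LT T' LT' : SSet.{v}}

lemma Realization.homEquiv_whiskerLeft (r : Realization D T LT) (X : KCat J k) {U U' : Vᵒᵖ}
    (a : U ⟶ U') (ψ : LT ⟶ X.obj ⋙ coyoneda.obj U) :
    r.homEquiv X U' (ψ ≫ Functor.whiskerLeft X.obj (coyoneda.map a)) =
      r.homEquiv X U ψ ≫ Functor.whiskerLeft _ (coyoneda.map a) := by
  refine (cancel_mono (cotHomIso D X U').hom).1 ?_
  rw [r.homEquiv_comp, Category.assoc, cotHomIso_naturality_left, ← Category.assoc,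
    r.homEquiv_comp, Category.assoc, ← Functor.map_comp]

lemma Realization.homEquiv_whiskerRight (r : Realization D T LT) {X Y : KCat J k} (f : X ⟶ Y)
    (U : Vᵒᵖ) (ψ : LT ⟶ X.obj ⋙ coyoneda.obj U) :
    r.homEquiv Y U (ψ ≫ Functor.whiskerRight f.hom (coyoneda.obj U)) =
      r.homEquiv X U ψ ≫ Functor.whiskerRight ((cot J k D).map f) (coyoneda.obj U) := by
  refine (cancel_mono (cotHomIso D Y U).hom).1 ?_
  rw [r.homEquiv_comp, Category.assoc, cotHomIso_naturality_right, ← Category.assoc,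
    r.homEquiv_comp, Category.assoc, ← Functor.map_comp]

lemma Realization.homEquiv_res (r : Realization D T LT) (r' : Realization D T' LT') {j : T ⟶ T'}
    {l : LT ⟶ LT'} (w : r.u ≫ (cosimpHom D).map l = j ≫ r'.u) (X : KCat J k) (U : Vᵒᵖ)
    (ψ : LT' ⟶ X.obj ⋙ coyoneda.obj U) :
    r.homEquiv X U (l ≫ ψ) = j ≫ r'.homEquiv X U ψ := by
  refine (cancel_mono (cotHomIso D X U).hom).1 ?_
  rw [r.homEquiv_comp, Category.assoc, r'.homEquiv_comp, Functor.map_comp, reassoc_of% w]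

lemma Realization.homEquiv_cotNat (τ : D' ⟶ D) (r : Realization D T LT)
    (r' : Realization D' T LT') {l : LT' ⟶ LT}
    (w : r.u ≫ (cosimpHomMap τ).app LT = r'.u ≫ (cosimpHom D').map l) (X : KCat J k) (U : Vᵒᵖ)
    (ψ : LT ⟶ X.obj ⋙ coyoneda.obj U) :
    r'.homEquiv X U (l ≫ ψ) =
      r.homEquiv X U ψ ≫ Functor.whiskerRight ((cotNat J k τ).app X) (coyoneda.obj U) := by
  refine (cancel_mono (cotHomIso D' X U).hom).1 ?_
  rw [r'.homEquiv_comp, Category.assoc, cotHomIso_naturality_cosimplicial, ← Category.assoc,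
    r.homEquiv_comp, Functor.map_comp, ← Category.assoc, ← w, Category.assoc, Category.assoc]
  congr 1

/-- The isomorphism `Map(LT, X) ≅ Map(T, cot D X)`. -/
noncomputable def Realization.iso (r : Realization D T LT) (X : KCat J k) :
    Map LT X.obj ≅ Map T ((cot J k D).obj X) :=
  NatIso.ofComponents (fun U => (r.homEquiv X U).toIso) fun a => by
    ext ψ
    exact r.homEquiv_whiskerLeft X a ψ

lemma Realization.iso_post (r : Realization D T LT) {X Y : KCat J k} (f : X ⟶ Y) :
    Map.post LT f.hom ≫ (r.iso Y).hom = (r.iso X).hom ≫ Map.post T ((cot J k D).map f) := by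
  ext U ψ
  exact r.homEquiv_whiskerRight f U ψ

lemma Realization.iso_res (r : Realization D T LT) (r' : Realization D T' LT') {j : T ⟶ T'}
    {l : LT ⟶ LT'} (w : r.u ≫ (cosimpHom D).map l = j ≫ r'.u) (X : KCat J k) :
    Map.res l X.obj ≫ (r.iso X).hom = (r'.iso X).hom ≫ Map.res j ((cot J k D).obj X) := by
  ext U ψ
  exact r.homEquiv_res r' w X U ψ

lemma Realization.iso_cotNat (τ : D' ⟶ D) (r : Realization D T LT) (r' : Realization D' T LT')
    {l : LT' ⟶ LT} (w : r.u ≫ (cosimpHomMap τ).app LT = r'.u ≫ (cosimpHom D').map l)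
    (X : KCat J k) :
    Map.res l X.obj ≫ (r'.iso X).hom =
      (r.iso X).hom ≫ Map.post T ((cotNat J k τ).app X) := by
  ext U ψ
  exact r.homEquiv_cotNat τ r' w X U ψ

lemma GapIn.of_iso {E : Type*} [Category* E] [HasPullbacks E] {C : MorphismProperty E}
    [C.IsStableUnderBaseChange]
    {A B A' B' A₀ B₀ A₀' B₀' : E} {t : A ⟶ B} {l : A ⟶ A'} {r : B ⟶ B'} {b : A' ⟶ B'}
    {t₀ : A₀ ⟶ B₀} {l₀ : A₀ ⟶ A₀'} {r₀ : B₀ ⟶ B₀'} {b₀ : A₀' ⟶ B₀'}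
    {α : A₀ ⟶ A} {β : B₀ ⟶ B} {α' : A₀' ⟶ A'} {β' : B₀' ⟶ B'} [IsIso α] [IsIso β] [IsIso α']
    [IsIso β'] (h : GapIn C t l r b) (ht : t₀ ≫ β = α ≫ t)
    (hl : l₀ ≫ α' = α ≫ l) (hr : r₀ ≫ β' = β ≫ r) (hb : b₀ ≫ β' = α' ≫ b) :
    GapIn C t₀ l₀ r₀ b₀ := by
  refine h.base_change ?_ hl hr (.of_vert_isIso ⟨ht⟩) (.of_vert_isIso ⟨hb⟩)
  obtain ⟨w, -⟩ := h
  rw [← cancel_mono β', Category.assoc, hr, reassoc_of% ht, w, Category.assoc, hb, reassoc_of% hl]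

variable {C : MorphismProperty (Vᵒᵖ ⥤ Type v)} [C.IsStableUnderBaseChange]

/-- Through Map(LT, X) ≅ Map(T, `cot D X`), conditions on `cot D` become conditions on the original
`k`-category. This serves both for powers and for the groupoid functor. -/
lemma Realization.liftIn_iff (r : Realization D T LT) (r' : Realization D T' LT') {j : T ⟶ T'}
    {l : LT ⟶ LT'} (w : r.u ≫ (cosimpHom D).map l = j ≫ r'.u) {X Y : KCat J k} (f : X ⟶ Y) :
    LiftIn C j ((cot J k D).map f) ↔ LiftIn C l f.hom :=
  ⟨fun h => GapIn.of_iso h (r.iso_res r' w X) (r'.iso_post f) (r.iso_post f) (r.iso_res r' w Y),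
    fun h => GapIn.of_iso (α := (r'.iso X).inv) (β := (r.iso X).inv) (α' := (r'.iso Y).inv)
      (β' := (r.iso Y).inv) h
      (by rw [Iso.comp_inv_eq, Category.assoc, r.iso_res r' w, Iso.inv_hom_id_assoc])
      (by rw [Iso.comp_inv_eq, Category.assoc, r'.iso_post, Iso.inv_hom_id_assoc])
      (by rw [Iso.comp_inv_eq, Category.assoc, r.iso_post, Iso.inv_hom_id_assoc])
      (by rw [Iso.comp_inv_eq, Category.assoc, r.iso_res r' w, Iso.inv_hom_id_assoc])⟩

lemma Realization.res_iff (r : Realization D T LT) (r' : Realization D T' LT') {j : T ⟶ T'}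
    {l : LT ⟶ LT'} (w : r.u ≫ (cosimpHom D).map l = j ≫ r'.u) (X : KCat J k) :
    C (Map.res j ((cot J k D).obj X)) ↔ C (Map.res l X.obj) :=
  (C.arrow_mk_iso_iff (Arrow.isoMk (f := Arrow.mk (Map.res l X.obj))
    (g := Arrow.mk (Map.res j ((cot J k D).obj X))) (r'.iso X) (r.iso X)
    (r.iso_res r' w X).symm)).symm

end

/-- The simplex `Δ[n]` is realized by `D n`. -/
def Realization.stdSimplex (D : CosimplicialObject SSet.{v}) (n : ℕ) :
    Realization D Δ[n] (D.obj ⦋n⦌) where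
  u := yonedaEquiv.symm (𝟙 (D.obj ⦋n⦌))
  bijective K := by
    refine ((Equiv.bijective (SSet.yonedaEquiv (X := (cosimpHom D).obj K))).of_comp_iff' _).1 ?_
    have h : SSet.yonedaEquiv ∘ (fun ψ : D.obj ⦋n⦌ ⟶ K =>
        SSet.yonedaEquiv.symm (𝟙 (D.obj ⦋n⦌)) ≫ (cosimpHom D).map ψ) = id := by
      funext ψ
      exact (SSet.yonedaEquiv_comp _ _).trans
        ((congrArg (· ≫ ψ) (Equiv.apply_symm_apply _ _)).trans (Category.id_comp ψ))
    rw [h]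
    exact Function.bijective_id

/-- The product with `K` of the simplices. -/
def prodCosimp (K : SSet.{v}) : CosimplicialObject SSet.{v} :=
  SSet.stdSimplex ⋙ tensorRight K

/-- The functoriality of `prodCosimp`. -/
def prodCosimpMap {K L : SSet.{v}} (l : L ⟶ K) : prodCosimp L ⟶ prodCosimp K :=
  Functor.whiskerLeft _ ((curriedTensor SSet).flip.map l)

instance (K : SSet.{v}) [∀ d, Finite (K _⦋d⦌)] (n : SimplexCategory) (d : ℕ) :
    Finite (((prodCosimp K).obj n) _⦋d⦌) :=
  have := finite_stdSimplex.{v} n.len d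
  inferInstanceAs (Finite ((Δ[n.len] ⊗ K : SSet.{v}) _⦋d⦌))

lemma yonedaEquiv_symm_map {T : SSet.{v}} {m m' : ℕ} (a : ⦋m'⦌ ⟶ ⦋m⦌) (x : T _⦋m⦌) :
    SSet.yonedaEquiv.symm (T.map a.op x) = SSet.stdSimplex.map a ≫ SSet.yonedaEquiv.symm x :=
  SSet.yonedaEquiv.injective (by
    rw [Equiv.apply_symm_apply, SSet.yonedaEquiv_comp, yonedaEquiv_map]
    exact (HigherCat.yonedaEquiv_symm_app_objEquiv_symm x a).symm)

lemma yonedaEquiv_symm_id {T : SSet.{v}} {d : ℕ} (x : T _⦋d⦌) :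
    (SSet.yonedaEquiv.symm x).app (op ⦋d⦌) (stdSimplex.objEquiv.symm (𝟙 _)) = x :=
  (yonedaEquiv_symm_app_objEquiv_symm x (𝟙 _)).trans (by simp)

/-- `T` is realized by `T ⊗ K`. -/
def Realization.prod (K T : SSet.{v}) : Realization (prodCosimp K) T (T ⊗ K) where
  u :=
    { app := fun m => TypeCat.ofHom fun x => SSet.yonedaEquiv.symm x ▷ K
      naturality := fun m m' a => by
        ext x
        exact (congrArg (· ▷ K) (yonedaEquiv_symm_map a.unop x)).trans
          (comp_whiskerRight _ _ _) }
  bijective L := by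
    constructor
    · intro ψ ψ' h
      ext ⟨d⟩ ⟨x, e⟩
      have := ConcreteCategory.congr_hom (congr_app (ConcreteCategory.congr_hom
        (congr_app h (op d)) x) (op d)) ⟨stdSimplex.objEquiv.symm (𝟙 _), e⟩
      have h' (ψ : T ⊗ K ⟶ L) : (SSet.yonedaEquiv.symm x ▷ K ≫ ψ).app (op d)
          ⟨stdSimplex.objEquiv.symm (𝟙 _), e⟩ = ψ.app (op d) ⟨x, e⟩ :=
        congrArg (fun y => ψ.app (op d) ⟨y, e⟩) (yonedaEquiv_symm_id (d := d.len) x)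
      exact (h' ψ).symm.trans (this.trans (h' ψ'))
    · intro φ
      -- By naturality `φ` is determined by its values on identity simplices, and these values
      -- define `ψ`.
      have key {m d : ℕ} (x : T _⦋m⦌) (g : ⦋d⦌ ⟶ ⦋m⦌) (e : K _⦋d⦌) :
          (φ.app (op ⦋d⦌) (T.map g.op x) : Δ[d] ⊗ K ⟶ L).app (op ⦋d⦌)
            ⟨stdSimplex.objEquiv.symm (𝟙 _), e⟩ =
          (φ.app (op ⦋m⦌) x : Δ[m] ⊗ K ⟶ L).app (op ⦋d⦌) ⟨stdSimplex.objEquiv.symm g, e⟩ := by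
        have h : (φ.app (op ⦋d⦌) (T.map g.op x) : Δ[d] ⊗ K ⟶ L) =
            SSet.stdSimplex.map g ▷ K ≫ (φ.app (op ⦋m⦌) x : Δ[m] ⊗ K ⟶ L) :=
          ConcreteCategory.congr_hom (φ.naturality g.op) x
        rw [h]
        exact congrArg (fun y => (φ.app (op ⦋m⦌) x : Δ[m] ⊗ K ⟶ L).app (op ⦋d⦌) ⟨y, e⟩)
          (stdSimplex.objEquiv.injective (Category.id_comp g))
      let ψ : T ⊗ K ⟶ L :=
        { app := fun d => TypeCat.ofHom fun y =>
            (φ.app d y.1 : Δ[d.unop.len] ⊗ K ⟶ L).app d ⟨stdSimplex.objEquiv.symm (𝟙 _), y.2⟩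
          naturality := fun d d' a => by
            ext ⟨x, e⟩
            refine (key x a.unop (K.map a e)).trans ?_
            refine Eq.trans ?_ (ConcreteCategory.congr_hom ((φ.app d x :
              Δ[d.unop.len] ⊗ K ⟶ L).naturality a) ⟨stdSimplex.objEquiv.symm (𝟙 _), e⟩)
            exact congrArg (fun y => (φ.app d x : Δ[d.unop.len] ⊗ K ⟶ L).app d' ⟨y, K.map a e⟩)
              (stdSimplex.objEquiv.injective (Category.comp_id a.unop).symm) }
      refine ⟨ψ, ?_⟩
      ext ⟨m⟩ x
      refine NatTrans.ext (funext fun d => ?_)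
      ext ⟨g, e⟩
      exact (key x (stdSimplex.objEquiv g) e).trans (congrArg (fun y =>
        (φ.app (op m) x : Δ[m.len] ⊗ K ⟶ L).app d ⟨y, e⟩)
          (stdSimplex.objEquiv.symm_apply_apply g))

lemma Realization.prod_naturality (K : SSet.{v}) {S T : SSet.{v}} (j : S ⟶ T) :
    (Realization.prod K S).u ≫ (cosimpHom _).map (j ▷ K) = j ≫ (Realization.prod K T).u := by
  ext m x
  refine (comp_whiskerRight _ _ _).symm.trans (congrArg (· ▷ K) ?_)
  refine SSet.yonedaEquiv.injective ?_
  rw [SSet.yonedaEquiv_comp]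
  rw [Equiv.apply_symm_apply]
  exact (Equiv.apply_symm_apply _ _).symm

lemma Realization.prod_prodCosimpMap {K L : SSet.{v}} (l : L ⟶ K) (T : SSet.{v}) :
    (Realization.prod K T).u ≫ (cosimpHomMap (prodCosimpMap l)).app _ =
      (Realization.prod L T).u ≫ (cosimpHom _).map (T ◁ l) := by
  ext m x
  exact whisker_exchange _ _

end HigherCat

namespace HigherCat

open SSet MonoidalCategory

/-! ### The simplicial subsets of thick simplices -/

/-- Send `j` to the largest element of `S` that is at most `j`, or to the least element of `S` if
there is none. -/
lemma exists_monotone_retraction {α : Type*} [LinearOrder α] (S : Finset α) (hS : S.Nonempty) :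
    ∃ r : α →o α, (∀ j, r j ∈ S) ∧ ∀ j ∈ S, r j = j := by
  classical
  have hm (j : α) (h : (S.filter (· ≤ j)).Nonempty) : (S.filter (· ≤ j)).max' h ∈ S :=
    (Finset.mem_filter.1 (Finset.max'_mem _ h)).1
  let f (j : α) : α := if h : (S.filter (· ≤ j)).Nonempty then (S.filter (· ≤ j)).max' h
    else S.min' hS
  have hf : Monotone f := fun a b hab => by
    have hsub : S.filter (· ≤ a) ⊆ S.filter (· ≤ b) := fun x hx => by
      rw [Finset.mem_filter] at hx ⊢
      exact ⟨hx.1, hx.2.trans hab⟩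
    dsimp only [f]
    split_ifs with h h' h'
    · exact Finset.max'_subset h hsub
    · exact absurd (h.mono hsub) h'
    · exact Finset.min'_le _ _ (hm _ h')
    · exact le_rfl
  refine ⟨⟨f, hf⟩, fun j => ?_, fun j hj => ?_⟩
  · change f j ∈ S
    dsimp only [f]
    split_ifs with h
    · exact hm _ h
    · exact Finset.min'_mem _ _
  · have hj' : j ∈ S.filter (· ≤ j) := Finset.mem_filter.2 ⟨hj, le_rfl⟩
    change f j = j
    dsimp only [f]
    rw [dif_pos ⟨j, hj'⟩]
    exact le_antisymm (Finset.mem_filter.1 (Finset.max'_mem _ ⟨j, hj'⟩)).2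
      (Finset.le_max' _ _ hj')

lemma exists_retraction {n d : ℕ} (w : (thick.{v}.obj ⦋n⦌) _⦋d⦌) :
    ∃ r : ⦋n⦌ ⟶ ⦋n⦌, (∀ j, ∃ a : Fin (d + 1), r.toOrderHom j = (w a).down) ∧
      ∀ a : Fin (d + 1), r.toOrderHom (w a).down = (w a).down := by
  obtain ⟨r, h₁, h₂⟩ := exists_monotone_retraction
    (Finset.univ.image fun a : Fin (d + 1) => (w a).down) ⟨_, Finset.mem_image_of_mem _
      (Finset.mem_univ 0)⟩
  refine ⟨SimplexCategory.Hom.mk r, fun j => ?_, fun a => ?_⟩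
  · obtain ⟨a, -, h⟩ := Finset.mem_image.1 (h₁ j)
    exact ⟨a, h.symm⟩
  · exact h₂ _ (Finset.mem_image_of_mem _ (Finset.mem_univ a))

/-- A monotone retraction of `{0, …, n}` on the set of vertices of `w`. -/
noncomputable def retraction {n d : ℕ} (w : (thick.{v}.obj ⦋n⦌) _⦋d⦌) : ⦋n⦌ ⟶ ⦋n⦌ :=
  (exists_retraction w).choose

lemma retraction_mem {n d : ℕ} (w : (thick.{v}.obj ⦋n⦌) _⦋d⦌) (j : Fin (n + 1)) :
    ∃ a : Fin (d + 1), (retraction w).toOrderHom j = (w a).down :=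
  (exists_retraction w).choose_spec.1 j

lemma retraction_apply {n d : ℕ} (w : (thick.{v}.obj ⦋n⦌) _⦋d⦌) (a : Fin (d + 1)) :
    (retraction w).toOrderHom (w a).down = (w a).down :=
  (exists_retraction w).choose_spec.2 a

/-- Choose preimages under `x` arbitrarily, the same one for equal values. Monotonicity is
automatic, because a monotone map of linear orders reflects strict inequalities. -/
lemma exists_comp_eq {l m n : ℕ} (x : ⦋m⦌ ⟶ ⦋n⦌) (y : ⦋l⦌ ⟶ ⦋n⦌)
    (h : ∀ j, ∃ a, y.toOrderHom j = x.toOrderHom a) : ∃ s : ⦋l⦌ ⟶ ⦋m⦌, s ≫ x = y := by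
  let g (b : Fin (n + 1)) : Fin (m + 1) :=
    open Classical in if h : ∃ a, b = x.toOrderHom a then h.choose else 0
  have hg (j) : x.toOrderHom (g (y.toOrderHom j)) = y.toOrderHom j := by
    dsimp only [g]
    rw [dif_pos (h j)]
    exact (h j).choose_spec.symm
  refine ⟨SimplexCategory.Hom.mk ⟨fun j => g (y.toOrderHom j), fun j j' hjj' => ?_⟩, ?_⟩
  · obtain h' | h' := (y.toOrderHom.monotone hjj').lt_or_eq
    · rw [← hg j, ← hg j'] at h'
      exact (x.toOrderHom.monotone.reflect_lt h').le
    · exact (congrArg g h').le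
  · ext j
    exact congrArg _ (hg j)

/-- Membership in a simplicial subset of Δ[n] depends only on the set of vertices, so it can be
tested on a retraction onto that set. This makes `thickSub` well behaved. -/
lemma mem_of_forall_exists {l m n : ℕ} (A : (Δ[n] : SSet.{v}).Subcomplex) (x : ⦋m⦌ ⟶ ⦋n⦌)
    (y : ⦋l⦌ ⟶ ⦋n⦌) (h : ∀ j, ∃ a, y.toOrderHom j = x.toOrderHom a)
    (hx : stdSimplex.objEquiv.symm x ∈ A.obj (op ⦋m⦌)) :
    stdSimplex.objEquiv.symm y ∈ A.obj (op ⦋l⦌) := by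
  obtain ⟨s, rfl⟩ := exists_comp_eq x y h
  exact A.map s.op hx

/-- The simplices of `thick ⦋n⦌` whose vertices are the vertices of a simplex in `A`. -/
def thickSub {n : ℕ} (A : (Δ[n] : SSet.{v}).Subcomplex) : (thick.{v}.obj ⦋n⦌).Subcomplex where
  obj d := {w | stdSimplex.objEquiv.symm (retraction (d := d.unop.len) w) ∈ A.obj (op ⦋n⦌)}
  map {d d'} α w hw := by
    refine mem_of_forall_exists A _ _ (fun j => ?_) hw
    obtain ⟨a, ha⟩ := retraction_mem (d := d'.unop.len) ((thick.obj ⦋n⦌).map α w) j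
    exact ⟨_, ha.trans (retraction_apply (d := d.unop.len) w (α.unop.toOrderHom a)).symm⟩

lemma mem_thickSub_iff {n d : ℕ} (A : (Δ[n] : SSet.{v}).Subcomplex)
    (w : (thick.{v}.obj ⦋n⦌) _⦋d⦌) : w ∈ (thickSub A).obj _ ↔
      stdSimplex.objEquiv.symm (retraction w) ∈ A.obj (op ⦋n⦌) := Iff.rfl

lemma range_thick_map_le {m n : ℕ} (A : (Δ[n] : SSet.{v}).Subcomplex) (x : ⦋m⦌ ⟶ ⦋n⦌)
    (hx : stdSimplex.objEquiv.symm x ∈ A.obj (op ⦋m⦌)) :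
    Subcomplex.range (thick.map x) ≤ thickSub A := by
  rintro ⟨d⟩ _ ⟨w, rfl⟩
  refine mem_of_forall_exists A x _ (fun j => ?_) hx
  obtain ⟨a, ha⟩ := retraction_mem (d := d.len) ((thick.map x).app (op d) w) j
  exact ⟨_, ha⟩

lemma thick_map_retraction {n d : ℕ} (w : (thick.{v}.obj ⦋n⦌) _⦋d⦌) :
    (thick.map (retraction w)).app (op ⦋d⦌) w = w :=
  funext fun a => ULift.ext _ _ (retraction_apply w a)

/-- The simplicial subset `A` of `Δ[n]` is realized by `thickSub A`. -/
def Realization.thickSub {n : ℕ} (A : (Δ[n] : SSet.{v}).Subcomplex) :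
    Realization thick A (thickSub A) where
  u :=
    { app := fun m => TypeCat.ofHom fun x => Subcomplex.lift (thick.map (stdSimplex.objEquiv x.1))
        (range_thick_map_le A (m := m.unop.len) _ x.2)
      naturality := fun m m' a => by
        ext x
        exact (cancel_mono (HigherCat.thickSub A).ι).1
          (thick.map_comp a.unop (SSet.stdSimplex.objEquiv x.1)) }
  bijective L := by
    constructor
    · intro ψ ψ' h
      ext ⟨d⟩ ⟨w, hw⟩
      have := ConcreteCategory.congr_hom (congr_app (ConcreteCategory.congr_hom
        (congr_app h (op ⦋n⦌)) ⟨_, hw⟩) (op d)) w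
      have h' (ψ : (HigherCat.thickSub A : SSet.{v}) ⟶ L) :
          (Subcomplex.lift (thick.map (retraction (d := d.len) w)) (range_thick_map_le A _ hw) ≫
            ψ).app (op d) w = ψ.app (op d) ⟨w, hw⟩ :=
        congrArg (ψ.app (op d)) (Subtype.ext (thick_map_retraction (d := d.len) w))
      exact (h' ψ).symm.trans (this.trans (h' ψ'))
    · intro φ
      have key₀ {m m' d : ℕ} (x : ⦋m⦌ ⟶ ⦋n⦌) (hx : stdSimplex.objEquiv.symm x ∈ A.obj _)
          (g : ⦋m'⦌ ⟶ ⦋m⦌) (y : ⦋m'⦌ ⟶ ⦋n⦌) (hy : stdSimplex.objEquiv.symm y ∈ A.obj _)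
          (h : g ≫ x = y)
          (w : (thick.{v}.obj ⦋m'⦌) _⦋d⦌) :
          (φ.app (op ⦋m'⦌) ⟨stdSimplex.objEquiv.symm y, hy⟩ : thick.obj ⦋m'⦌ ⟶ L).app (op ⦋d⦌) w =
          (φ.app (op ⦋m⦌) ⟨stdSimplex.objEquiv.symm x, hx⟩ : thick.obj ⦋m⦌ ⟶ L).app (op ⦋d⦌)
            ((thick.map g).app (op ⦋d⦌) w) := by
        subst h
        have h : (φ.app (op ⦋m'⦌) ⟨stdSimplex.objEquiv.symm (g ≫ x), hy⟩ :
              thick.obj ⦋m'⦌ ⟶ L) =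
            thick.map g ≫ (φ.app (op ⦋m⦌) ⟨stdSimplex.objEquiv.symm x, hx⟩ : thick.obj ⦋m⦌ ⟶ L) :=
          ConcreteCategory.congr_hom (φ.naturality g.op) ⟨stdSimplex.objEquiv.symm x, hx⟩
        rw [h]
        rfl
      -- The value of `φ` at `w` does not depend on the simplex used to reach `w`: composing with
      -- the retraction onto the vertices of `x` fixes both `x` and `retraction w`, so both values
      -- equal the one computed there.
      have key {m d : ℕ} (x : ⦋m⦌ ⟶ ⦋n⦌) (hx : stdSimplex.objEquiv.symm x ∈ A.obj _)
          (w : (thick.{v}.obj ⦋n⦌) _⦋d⦌) (hw : w ∈ (HigherCat.thickSub A).obj _)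
          (w' : (thick.{v}.obj ⦋m⦌) _⦋d⦌) (hww' : (thick.map x).app (op ⦋d⦌) w' = w) :
          (φ.app (op ⦋n⦌) ⟨stdSimplex.objEquiv.symm (retraction w), hw⟩ :
            thick.obj ⦋n⦌ ⟶ L).app (op ⦋d⦌) w =
          (φ.app (op ⦋m⦌) ⟨stdSimplex.objEquiv.symm x, hx⟩ : thick.obj ⦋m⦌ ⟶ L).app (op ⦋d⦌)
            w' := by
        let v : (thick.{v}.obj ⦋n⦌) _⦋m⦌ := fun j => ⟨x.toOrderHom j⟩
        have hv : stdSimplex.objEquiv.symm (retraction v) ∈ A.obj _ :=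
          mem_of_forall_exists A x _ (retraction_mem v) hx
        rw [key₀ (retraction v) hv (retraction w) _ hw, thick_map_retraction,
          key₀ (retraction v) hv x x hx, hww']
        · ext j
          exact congrArg _ (retraction_apply v j)
        · ext j
          obtain ⟨a, ha⟩ := retraction_mem w j
          subst hww'
          have := retraction_apply v (w' a).down
          refine congrArg Fin.val (?_ : (retraction v).toOrderHom ((retraction _).toOrderHom j) = _)
          rw [ha]
          exact this
      let ψ : (HigherCat.thickSub A : SSet.{v}) ⟶ L :=
        { app := fun d => TypeCat.ofHom fun y =>
            (φ.app (op ⦋n⦌) ⟨stdSimplex.objEquiv.symm (retraction (d := d.unop.len) y.1), y.2⟩ :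
              thick.obj ⦋n⦌ ⟶ L).app d y.1
          naturality := fun d d' a => by
            ext ⟨w, hw⟩
            refine (key (d := d'.unop.len) (retraction (d := d.unop.len) w) hw
              ((thick.obj ⦋n⦌).map a w) ((HigherCat.thickSub A).map a hw)
              ((thick.obj ⦋n⦌).map a w) ?_).trans ?_
            · refine (ConcreteCategory.congr_hom ((thick.map _).naturality a) w).trans ?_
              exact congrArg ((thick.obj ⦋n⦌).map a) (thick_map_retraction (d := d.unop.len) w)
            · exact ConcreteCategory.congr_hom ((φ.app (op ⦋n⦌) ⟨stdSimplex.objEquiv.symm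
                (retraction (d := d.unop.len) w), hw⟩ : thick.obj ⦋n⦌ ⟶ L).naturality a) w }
      refine ⟨ψ, ?_⟩
      ext ⟨m⟩ x
      refine NatTrans.ext (funext fun d => ?_)
      ext w
      exact key (m := m.len) (d := d.unop.len) (stdSimplex.objEquiv x.1) x.2 _ _ w rfl

lemma Realization.thickSub_naturality {n : ℕ} (A : (Δ[n] : SSet.{v}).Subcomplex) :
    (Realization.thickSub A).u ≫ (cosimpHom thick).map (HigherCat.thickSub A).ι =
      A.ι ≫ (Realization.stdSimplex thick n).u := by
  ext m x
  exact (Category.comp_id (thick.map (SSet.stdSimplex.objEquiv x.1))).symm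

lemma thickWord_iff {n : ℕ} {i : Fin (n + 1)} {d : ℕ} (w : (thick.{v}.obj ⦋n⦌) _⦋d⦌) :
    w ∉ (thickSub Λ[n, i]).obj _ ↔ ThickWord n i d ((thickWords n).letter w) := by
  rw [mem_thickSub_iff]
  refine (notMem_horn_iff _).trans (forall₃_congr fun j hj _ => ?_)
  refine Iff.trans ⟨?_, ?_⟩
    (exists_letterOf_iff (fun j => (w j).down.val) (fun y => y = j)).symm
  · rintro ⟨b, rfl⟩
    obtain ⟨a, ha⟩ := retraction_mem w b
    exact ⟨a, congrArg Fin.val ha.symm⟩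
  · rintro ⟨a, rfl⟩
    exact ⟨(w a).down, congrArg Fin.val (retraction_apply w a)⟩

end HigherCat

namespace HigherCat

open SSet MonoidalCategory

/-! ### Relative `k`-categories -/

section

variable {V : Type u} [Category.{v} V] [HasFiniteLimits V] {J : MorphismProperty V}
  [IsDescentCategory J] {k : ℕ}

lemma liftIn_iff_of_isIso_res {C : MorphismProperty (Vᵒᵖ ⥤ Type v)} [C.RespectsIso]
    {S T : SSet.{v}} {i : S ⟶ T} {X Y : SimplicialObject V} {f : X ⟶ Y} [IsIso (Map.res i Y)] :
    LiftIn C i f ↔ C (Map.res i X) :=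
  gapIn_iff_of_isPullback (fst := 𝟙 _) (snd := Map.post S f ≫ inv (Map.res i Y))
    (IsPullback.of_horiz_isIso ⟨by simp⟩) (Category.comp_id _) (by
      rw [← Category.assoc, IsIso.comp_inv_eq]
      exact Map.res_post i f)

variable (V) in
/-- The terminal simplicial space. -/
noncomputable def ptS : SimplicialObject V := (Functor.const _).obj (⊤_ V)

/-- The terminal simplicial space is terminal. -/
noncomputable def ptSIsTerminal : IsTerminal (ptS V) :=
  IsTerminal.ofUniqueHom (fun X =>
    { app := fun n => terminal.from (X.obj n)
      naturality := fun _ _ _ => terminal.hom_ext _ _ })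
    fun _ _ => NatTrans.ext (funext fun _ => terminal.hom_ext _ _)

instance isIso_res_ptS {S T : SSet.{v}} (i : S ⟶ T) : IsIso (Map.res i (ptS V)) := by
  rw [NatTrans.isIso_iff_isIso_app]
  intro U
  rw [isIso_iff_bijective]
  refine ⟨fun a b _ => ?_, fun a => ⟨
    { app := fun n => TypeCat.ofHom fun _ => terminal.from U.unop
      naturality := fun _ _ _ => ?_ }, ?_⟩⟩
  · exact NatTrans.ext (funext fun n => by ext x; exact terminal.hom_ext _ _)
  · ext x
    exact terminal.hom_ext _ _
  · exact NatTrans.ext (funext fun n => by ext x; exact terminal.hom_ext _ _)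

lemma liftIn_ptS_iff {C : MorphismProperty (Vᵒᵖ ⥤ Type v)} [C.RespectsIso]
    {S T : SSet.{v}} {i : S ⟶ T} {X : SimplicialObject V} (f : X ⟶ ptS V) :
    LiftIn C i f ↔ C (Map.res i X) :=
  liftIn_iff_of_isIso_res

variable (J k) in
/-- Quasi-fibrations whose fibres are `k`-categories. -/
def relKCategory : MorphismProperty (SimplicialObject V) := fun _ _ f =>
  quasiFibration J f ∧ ∀ (n : ℕ) (i : Fin (n + 1)), 0 < i → i < Fin.last n → k < n →
    LiftIn (.isomorphisms _) Λ[n, i].ι f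

lemma relKCategory_ptS_iff {X : SimplicialObject V} (f : X ⟶ ptS V) :
    relKCategory J k f ↔ IsKCategory J k X := by
  simp only [relKCategory, quasiFibration, ← liftIn_iff, liftIn_ptS_iff]
  exact ⟨fun h => ⟨h.1.1, h.2, h.1.2⟩, fun h => ⟨⟨h.1, h.3⟩, h.2⟩⟩

lemma relKCategory.comp {X Y Z : SimplicialObject V} {f : X ⟶ Y} {g : Y ⟶ Z}
    (hf : relKCategory J k f) (hg : relKCategory J k g) : relKCategory J k (f ≫ g) :=
  ⟨⟨fun n i h₀ h₁ => liftIn_iff.1 ((liftIn_iff.2 (hf.1.1 n i h₀ h₁)).comp_right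
      (liftIn_iff.2 (hg.1.1 n i h₀ h₁))),
    fun i => liftIn_iff.1 ((liftIn_iff.2 (hf.1.2 i)).comp_right (liftIn_iff.2 (hg.1.2 i)))⟩,
    fun n i h₀ h₁ h => (hf.2 n i h₀ h₁ h).comp_right (hg.2 n i h₀ h₁ h)⟩

lemma relKCategory.of_isPullback {P X Y Z : SimplicialObject V} {fst : P ⟶ X} {snd : P ⟶ Z}
    {f : X ⟶ Y} {g : Z ⟶ Y} (h : IsPullback fst snd f g) (hf : relKCategory J k f) :
    relKCategory J k snd :=
  ⟨⟨fun n i h₀ h₁ => liftIn_iff.1 ((liftIn_iff.2 (hf.1.1 n i h₀ h₁)).base_change h),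
    fun i => liftIn_iff.1 ((liftIn_iff.2 (hf.1.2 i)).base_change h)⟩,
    fun n i h₀ h₁ h' => (hf.2 n i h₀ h₁ h').base_change h⟩

lemma relKCategory.isKCategory {X Y : SimplicialObject V} {f : X ⟶ Y}
    (hf : relKCategory J k f) (hY : IsKCategory J k Y) : IsKCategory J k X :=
  (relKCategory_ptS_iff (f ≫ ptSIsTerminal.from Y)).1
    (hf.comp ((relKCategory_ptS_iff _).2 hY))

lemma relKCategory_of_quasiFibration {X Y : SimplicialObject V} {f : X ⟶ Y}
    (hf : quasiFibration J f) (hX : IsKCategory J k X) (hY : IsKCategory J k Y) :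
    relKCategory J k f :=
  ⟨hf, fun n i h₀ h₁ h => by
    have := hX.isIso n i h₀ h₁ h
    have := hY.isIso n i h₀ h₁ h
    exact LiftIn.of_isIso_res⟩

lemma isKCategory_ptS : IsKCategory J k (ptS V) :=
  ⟨fun _ _ _ _ => MorphismProperty.of_isIso J.presheaf _, fun _ _ _ _ _ => inferInstance,
    fun _ => MorphismProperty.of_isIso J.presheaf _⟩

variable (J k) in
/-- The terminal `k`-category. -/
noncomputable def KCat.pt : KCat J k := ⟨ptS V, isKCategory_ptS⟩

/-- The terminal `k`-category is terminal. -/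
noncomputable def KCat.ptIsTerminal : IsTerminal (KCat.pt J k) :=
  IsTerminal.ofUniqueHom (fun X => ObjectProperty.homMk (ptSIsTerminal.from X.obj))
    fun _ _ => ObjectProperty.hom_ext _ (ptSIsTerminal.hom_ext _ _)

lemma KCat.relKCategory_hom {X Y : KCat J k} {f : X ⟶ Y} (hf : KCat.quasiFib J k f) :
    relKCategory J k f.hom :=
  relKCategory_of_quasiFibration hf X.2 Y.2

lemma KCat.quasiFib_of_isTerminal {X Y : KCat J k} (hY : IsTerminal Y) (f : X ⟶ Y) :
    KCat.quasiFib J k f := by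
  have h : relKCategory J k (f ≫ KCat.ptIsTerminal.from Y).hom := (relKCategory_ptS_iff _).2 X.2
  have e := hY.uniqueUpToIso (KCat.ptIsTerminal (J := J) (k := k))
  have h' := h.1
  have : IsIso (KCat.ptIsTerminal.from Y) := by
    rw [KCat.ptIsTerminal.hom_ext (KCat.ptIsTerminal.from Y) e.hom]
    infer_instance
  have hc : f.hom = (f ≫ KCat.ptIsTerminal.from Y).hom ≫ (inv (KCat.ptIsTerminal.from Y)).hom :=
    congrArg InducedCategory.Hom.hom
      (show f = (f ≫ KCat.ptIsTerminal.from Y) ≫ inv (KCat.ptIsTerminal.from Y) by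
        rw [Category.assoc, IsIso.hom_inv_id, Category.comp_id])
  have hi : IsIso (inv (KCat.ptIsTerminal.from Y)).hom :=
    inferInstanceAs (IsIso ((KCat.incl J k).map (inv (KCat.ptIsTerminal.from Y))))
  change quasiFibration J f.hom
  rw [hc]
  exact ⟨fun n i h₀ h₁ => liftIn_iff.1 ((liftIn_iff.2 (h'.1 n i h₀ h₁)).comp_right
      (LiftIn.of_isIso_post _ _)),
    fun i => liftIn_iff.1 ((liftIn_iff.2 (h'.2 i)).comp_right (LiftIn.of_isIso_post _ _))⟩

/-- The levelwise pullback is again a `k`-category, because `relKCategory` is stable under base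
change and under composition with the map to the terminal object. -/
lemma KCat.exists_isPullback {X Y Z : KCat J k} (f : X ⟶ Y) (g : Z ⟶ Y)
    (hf : KCat.quasiFib J k f) : ∃ (P : KCat J k) (fst : P ⟶ X) (snd : P ⟶ Z),
      IsPullback fst snd f g ∧ IsPullback fst.hom snd.hom f.hom g.hom := by
  have h := IsPullback.of_hasPullback f.hom g.hom
  let P : KCat J k := ⟨_, ((KCat.relKCategory_hom hf).of_isPullback h).isKCategory Z.2⟩
  let fst : P ⟶ X := ObjectProperty.homMk (pullback.fst f.hom g.hom)
  let snd : P ⟶ Z := ObjectProperty.homMk (pullback.snd f.hom g.hom)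
  exact ⟨P, fst, snd, IsPullback.of_map (KCat.incl J k)
    (ObjectProperty.hom_ext _ h.w) h, h⟩

/-- One pullback in the subcategory is computed in simplicial spaces, and pullbacks are unique up to
isomorphism; hence the inclusion preserves them all. -/
lemma KCat.isPullback_hom {P X Y Z : KCat J k} {fst : P ⟶ X} {snd : P ⟶ Z} {f : X ⟶ Y}
    {g : Z ⟶ Y} (hf : KCat.quasiFib J k f) (h : IsPullback fst snd f g) :
    IsPullback fst.hom snd.hom f.hom g.hom := by
  obtain ⟨P', fst', snd', h₁, h₂⟩ := KCat.exists_isPullback f g hf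
  refine IsPullback.of_iso h₂ ((KCat.incl J k).mapIso (h₁.isoIsPullback _ _ h)) (Iso.refl _)
    (Iso.refl _) (Iso.refl _) ?_ ?_ (by simp) (by simp)
  · exact (Category.comp_id _).trans
      (congrArg InducedCategory.Hom.hom (h₁.isoIsPullback_hom_fst _ _ h).symm)
  · exact (Category.comp_id _).trans
      (congrArg InducedCategory.Hom.hom (h₁.isoIsPullback_hom_snd _ _ h).symm)

end

end HigherCat

namespace HigherCat

open SSet MonoidalCategory

/-! ### Powers of `k`-categories -/

section

variable {V : Type u} [Category.{v} V] [HasFiniteLimits V] {J : MorphismProperty V}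
  [IsDescentCategory J] {k : ℕ} [NeZero k]

section

variable {D D' D'' : CosimplicialObject SSet.{v}} [∀ n d, Finite ((D.obj n) _⦋d⦌)]
  [∀ n d, Finite ((D'.obj n) _⦋d⦌)] [∀ n d, Finite ((D''.obj n) _⦋d⦌)]

lemma cotNat_comp (τ : D' ⟶ D) (τ' : D'' ⟶ D') (X : KCat J k) :
    (cotNat J k τ).app X ≫ (cotNat J k τ').app X = (cotNat J k (τ' ≫ τ)).app X := by
  refine simplicialYoneda.map_injective ((cancel_mono ((cotIso J k D'').hom.app X)).1 ?_)
  rw [Functor.map_comp, Category.assoc, cotNat_spec, ← Category.assoc, cotNat_spec, cotNat_spec,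
    Category.assoc]
  rfl

lemma cotNat_spec_inv (τ : D' ⟶ D) (X : KCat J k) :
    (cotMapMap τ).app X.obj ≫ (cotIso J k D').inv.app X =
      (cotIso J k D).inv.app X ≫ simplicialYoneda.map ((cotNat J k τ).app X) := by
  refine (cancel_epi ((cotIso J k D).hom.app X)).1 ?_
  rw [← Category.assoc, ← cotNat_spec, Category.assoc, Iso.hom_inv_id_app, Iso.hom_inv_id_app_assoc]
  exact Category.comp_id _

lemma isIso_cotNat_app (τ : D' ⟶ D) (X : KCat J k)
    (h : ∀ n, IsIso (Map.res (τ.app n) X.obj)) : IsIso ((cotNat J k τ).app X) := by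
  have : IsIso ((cotMapMap τ).app X.obj) := by
    rw [NatTrans.isIso_iff_isIso_app]
    exact fun n => h n.unop
  have : IsIso (simplicialYoneda.map ((cotNat J k τ).app X)) := by
    rw [← isIso_comp_right_iff _ ((cotIso J k D').hom.app X), cotNat_spec]
    infer_instance
  exact isIso_of_reflects_iso _ simplicialYoneda

lemma isPullback_cotNat {D₀ D₁ D₂ D₃ : CosimplicialObject SSet.{v}}
    [∀ n d, Finite ((D₀.obj n) _⦋d⦌)] [∀ n d, Finite ((D₁.obj n) _⦋d⦌)]
    [∀ n d, Finite ((D₂.obj n) _⦋d⦌)] [∀ n d, Finite ((D₃.obj n) _⦋d⦌)]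
    {t : D₀ ⟶ D₁} {l : D₀ ⟶ D₂} {r : D₁ ⟶ D₃} {b : D₂ ⟶ D₃}
    (h : ∀ n, IsPushout (t.app n) (l.app n) (r.app n) (b.app n)) (X : KCat J k) :
    IsPullback ((cotNat J k r).app X) ((cotNat J k b).app X) ((cotNat J k t).app X)
      ((cotNat J k l).app X) := by
  have hw : t ≫ r = l ≫ b := NatTrans.ext (funext fun n => (h n).w)
  refine IsPullback.of_map simplicialYoneda (by rw [cotNat_comp, cotNat_comp, hw]) ?_
  have h' : IsPullback (C := SimplexCategoryᵒᵖ ⥤ (Vᵒᵖ ⥤ Type v)) ((cotMapMap r).app X.obj)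
      ((cotMapMap b).app X.obj)
      ((cotMapMap t).app X.obj) ((cotMapMap l).app X.obj) :=
    IsPullback.of_forall_isPullback_app fun n => isPullback_res_of_isPushout (h n.unop) X.obj
  exact IsPullback.of_iso h' ((cotIso J k D₃).app X).symm ((cotIso J k D₁).app X).symm
    ((cotIso J k D₂).app X).symm ((cotIso J k D₀).app X).symm
    (cotNat_spec_inv _ X) (cotNat_spec_inv _ X) (cotNat_spec_inv _ X) (cotNat_spec_inv _ X)

/-- `Y ↦ Map(D, Y)` preserves pullbacks. -/
lemma isPullback_cot {P X Y Z : KCat J k} {fst : P ⟶ X} {snd : P ⟶ Z} {f : X ⟶ Y} {g : Z ⟶ Y}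
    (h : IsPullback fst.hom snd.hom f.hom g.hom) :
    IsPullback ((cot J k D).map fst) ((cot J k D).map snd) ((cot J k D).map f)
      ((cot J k D).map g) := by
  have hw : fst ≫ f = snd ≫ g := ObjectProperty.hom_ext _ h.w
  refine IsPullback.of_map simplicialYoneda (by rw [← Functor.map_comp, hw, Functor.map_comp]) ?_
  have h' : IsPullback (C := SimplexCategoryᵒᵖ ⥤ (Vᵒᵖ ⥤ Type v)) ((cotMap D).map fst.hom)
      ((cotMap D).map snd.hom) ((cotMap D).map f.hom) ((cotMap D).map g.hom) :=
    IsPullback.of_forall_isPullback_app fun n => isPullback_post h _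
  have hn {A B : KCat J k} (f : A ⟶ B) : (cotMap D).map f.hom ≫ (cotIso J k D).inv.app B =
      (cotIso J k D).inv.app A ≫ simplicialYoneda.map ((cot J k D).map f) :=
    (cotIso J k D).inv.naturality f
  exact IsPullback.of_iso h' ((cotIso J k D).app P).symm ((cotIso J k D).app X).symm
    ((cotIso J k D).app Z).symm ((cotIso J k D).app Y).symm (hn _) (hn _) (hn _) (hn _)

end

variable (J k) in
/-- The functor sending a `k`-category `X` to the simplicial space of morphisms `K ⟶ X`. -/
noncomputable abbrev pow (K : SSet.{v}) [∀ d, Finite (K _⦋d⦌)] :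
    KCat J k ⥤ SimplicialObject V := cot J k (prodCosimp K)

variable (J k) in
/-- The functoriality of powers. -/
noncomputable abbrev powNat {K L : SSet.{v}} [∀ d, Finite (K _⦋d⦌)] [∀ d, Finite (L _⦋d⦌)]
    (l : L ⟶ K) : pow J k K ⟶ pow J k L := cotNat J k (prodCosimpMap l)

lemma powNat_comp {K L M : SSet.{v}} [∀ d, Finite (K _⦋d⦌)] [∀ d, Finite (L _⦋d⦌)]
    [∀ d, Finite (M _⦋d⦌)] (l : L ⟶ K) (m : M ⟶ L) (X : KCat J k) :
    (powNat J k l).app X ≫ (powNat J k m).app X = (powNat J k (m ≫ l)).app X := by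
  rw [cotNat_comp]
  congr 2

instance mono_whiskerRight {S T : SSet.{v}} (j : S ⟶ T) [Mono j] (K : SSet.{v}) :
    Mono (j ▷ K) := by
  rw [NatTrans.mono_iff_mono_app]
  intro n
  rw [mono_iff_injective]
  rintro ⟨x, y⟩ ⟨x', y'⟩ h
  have hj := (mono_iff_injective _).1 ((NatTrans.mono_iff_mono_app j).1 inferInstance n)
  exact Prod.ext (hj (congrArg Prod.fst h)) (congrArg Prod.snd h :)

section

variable {K : SSet.{v}} [∀ d, Finite (K _⦋d⦌)] {C : MorphismProperty (Vᵒᵖ ⥤ Type v)}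
  [C.IsStableUnderBaseChange]

/-- The inclusion of ∂Δ[d] ⊗ K in Δ[d] ⊗ K is bijective on simplices of dimension below `d`. -/
lemma pow_cosk (X : KCat J k) : Cosk (k + 1) ((pow J k K).obj X) := by
  intro d hd
  have h := Realization.res_iff (C := .isomorphisms _) _ _
    (Realization.prod_naturality K (∂Δ[d] : (Δ[d] : SSet.{v}).Subcomplex).ι) X
  refine h.2 (X.cosk.isIso_res _ fun e he x => ?_)
  have hx : x.1 ∈ (∂Δ[d] : (Δ[d] : SSet.{v}).Subcomplex).obj (op ⦋e⦌) := by
    rw [boundary_obj_eq_univ _ _ (by lia)]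
    exact Set.mem_univ _
  exact ⟨⟨⟨x.1, hx⟩, x.2⟩, rfl⟩

/-- Leibniz's rule for powers. -/
lemma liftIn_iff_liftIn_unionProd {T : SSet.{v}} (A : T.Subcomplex) (B : K.Subcomplex)
    {X Y : KCat J k} (f : X ⟶ Y) {W : SimplicialObject V} {a : W ⟶ (pow J k B).obj X}
    {b : W ⟶ (pow J k K).obj Y} (hW : IsPullback a b ((pow J k B).map f) ((powNat J k B.ι).app Y))
    {g : (pow J k K).obj X ⟶ W} (hga : g ≫ a = (powNat J k B.ι).app X)
    (hgb : g ≫ b = (pow J k K).map f) :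
    LiftIn C A.ι g ↔ LiftIn C (A.unionProd B).ι f.hom := by
  -- The union is the pushout of A ⊗ K and T ⊗ B along A ⊗ B. Maps out of it are rewritten as maps
  -- from `A` and `T` into powers.
  have hP (Z : KCat J k) : IsPullback
      (Map.res (Subcomplex.unionProd.ι₂ A B) Z.obj ≫ ((Realization.prod K A).iso Z).hom)
      (Map.res (Subcomplex.unionProd.ι₁ A B) Z.obj ≫ ((Realization.prod B T).iso Z).hom)
      (Map.post A ((powNat J k B.ι).app Z)) (Map.res A.ι ((pow J k B).obj Z)) :=
    IsPullback.of_iso (isPullback_res_of_isPushout (Subcomplex.unionProd.isPushout A B) Z.obj).flip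
      (Iso.refl _) ((Realization.prod K A).iso Z) ((Realization.prod B T).iso Z)
      ((Realization.prod B A).iso Z) (by simp) (by simp)
      (Realization.iso_cotNat _ _ _ (Realization.prod_prodCosimpMap B.ι A) Z)
      (Realization.iso_res _ _ (Realization.prod_naturality B A.ι) Z)
  have h₁ (Z : KCat J k) : (((Realization.prod K T).iso Z).inv ≫ Map.res (A.unionProd B).ι Z.obj) ≫
      Map.res (Subcomplex.unionProd.ι₂ A B) Z.obj ≫ ((Realization.prod K A).iso Z).hom =
        Map.res A.ι ((pow J k K).obj Z) := by
    rw [Category.assoc, Iso.inv_comp_eq]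
    exact Realization.iso_res _ _ (Realization.prod_naturality K A.ι) Z
  have h₂ (Z : KCat J k) : (((Realization.prod K T).iso Z).inv ≫ Map.res (A.unionProd B).ι Z.obj) ≫
      Map.res (Subcomplex.unionProd.ι₁ A B) Z.obj ≫ ((Realization.prod B T).iso Z).hom =
        Map.post T ((powNat J k B.ι).app Z) := by
    rw [Category.assoc, Iso.inv_comp_eq]
    exact Realization.iso_cotNat _ _ _ (Realization.prod_prodCosimpMap B.ι T) Z
  -- The cube has three directions: restriction along `A`, restriction along `B`, and `f`. The two
  -- sides of the equivalence take the total gap map in different orders.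
  refine (gapIn_cube (hP X) (hP Y) (isPullback_post hW T) (isPullback_post hW A)
    (h₁ X) (h₂ X) (h₁ Y) (h₂ Y) (pf := Map.post _ f.hom)
    (f₁₁ := Map.post T ((pow J k K).map f)) ?_ ?_ ?_ ?_ ?_ ?_
    (Map.res_post _ _) (Map.res_post _ _) ?_ (Map.res_post _ _)).trans ?_
  · rw [← Category.assoc, ← Map.res_post, Category.assoc, Realization.iso_post, Category.assoc]
  · rw [← Category.assoc, ← Map.res_post, Category.assoc, Realization.iso_post, Category.assoc]
  · rw [← Map.post_comp, hga]
  · rw [← Map.post_comp, hgb]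
  · rw [← Map.post_comp, hga]
  · rw [← Map.post_comp, hgb]
  · exact Map.res_post _ _
  · exact ⟨fun h => GapIn.of_iso (α := ((Realization.prod K T).iso X).hom) (β := 𝟙 _)
      (α' := ((Realization.prod K T).iso Y).hom) (β' := 𝟙 _) h (by simp)
      (Realization.iso_post _ f) (by simp) (by simp),
      fun h => GapIn.of_iso (α := ((Realization.prod K T).iso X).inv) (β := 𝟙 _)
      (α' := ((Realization.prod K T).iso Y).inv) (β' := 𝟙 _) h (by simp)
      (by rw [Iso.comp_inv_eq, Category.assoc, Realization.iso_post, Iso.inv_hom_id_assoc])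
      (by simp) (by simp)⟩

end

variable (V) in
/-- The simplicial form of Yoneda's lemma. -/
noncomputable def simplicialYonedaIso : simplicialYoneda (V := V) ≅ cotMap SSet.stdSimplex :=
  NatIso.ofComponents (fun X => NatIso.ofComponents (fun n => mapStdSimplexIso X n.unop.len)
    (fun {n m} a => by
      ext U x
      exact yonedaEquiv_symm_map (T := X ⋙ coyoneda.obj U) a.unop x))
    (fun {X Y} f => by
      ext n U x
      exact (SSet.yonedaEquiv_symm_comp (X := X ⋙ coyoneda.obj U) (n := n.unop) x
        (Functor.whiskerRight f (coyoneda.obj U))).symm)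

/-- The projections of the product with `K`. -/
def prodCosimpFst (K : SSet.{v}) : prodCosimp K ⟶ SSet.stdSimplex where
  app n := CartesianMonoidalCategory.fst _ _

section

variable {K L : SSet.{v}} [∀ d, Finite (K _⦋d⦌)] [∀ d, Finite (L _⦋d⦌)]

variable (J k K) in
/-- The diagonal morphism of powers. -/
noncomputable def constNat : KCat.incl J k ⟶ pow J k K :=
  ((Functor.FullyFaithful.ofFullyFaithful simplicialYoneda).whiskeringRight _).preimage
    (Functor.whiskerLeft _ ((simplicialYonedaIso V).hom ≫ cotMapMap (prodCosimpFst K)) ≫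
      (cotIso J k (prodCosimp K)).inv)

lemma constNat_spec (X : KCat J k) :
    simplicialYoneda.map ((constNat J k K).app X) ≫ (cotIso J k (prodCosimp K)).hom.app X =
      (simplicialYonedaIso V).hom.app X.obj ≫ (cotMapMap (prodCosimpFst K)).app X.obj := by
  have := ((Functor.FullyFaithful.ofFullyFaithful simplicialYoneda).whiskeringRight _).map_preimage
    (Functor.whiskerLeft (KCat.incl J k) ((simplicialYonedaIso V).hom ≫
      cotMapMap (prodCosimpFst K)) ≫ (cotIso J k (prodCosimp K)).inv)
  have := congr_app this X
  dsimp at this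
  erw [this]
  simp

lemma constNat_powNat (l : L ⟶ K) (X : KCat J k) :
    (constNat J k K).app X ≫ (powNat J k l).app X = (constNat J k L).app X := by
  refine simplicialYoneda.map_injective
    ((cancel_mono ((cotIso J k (prodCosimp L)).hom.app X)).1 ?_)
  rw [Functor.map_comp, Category.assoc, cotNat_spec, ← Category.assoc, constNat_spec,
    constNat_spec, Category.assoc]
  rfl

lemma isIso_constNat_app (hK : IsTerminal K) (X : KCat J k) :
    IsIso ((constNat J k K).app X) := by
  have (n : SimplexCategory) : IsIso ((prodCosimpFst K).app n) :=
    ⟨CartesianMonoidalCategory.lift (𝟙 _) (hK.from _),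
      CartesianMonoidalCategory.hom_ext _ _ rfl (hK.hom_ext _ _), rfl⟩
  have : IsIso (prodCosimpFst K) := NatIso.isIso_of_isIso_app _
  have (n : SimplexCategoryᵒᵖ) : IsIso ((NatTrans.op (prodCosimpFst K)).app n) :=
    inferInstanceAs (IsIso ((prodCosimpFst K).app n.unop).op)
  have : IsIso (NatTrans.op (prodCosimpFst K)) := NatIso.isIso_of_isIso_app _
  have : IsIso (Functor.whiskerRight (NatTrans.op (prodCosimpFst K)) (mapFunctor (V := V))) :=
    NatIso.isIso_of_isIso_app _
  have : IsIso (cotMapMap (V := V) (prodCosimpFst K)) := Functor.map_isIso _ _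
  have : IsIso (simplicialYoneda.map ((constNat J k K).app X)) := by
    rw [← isIso_comp_right_iff _ ((cotIso J k (prodCosimp K)).hom.app X), constNat_spec]
    infer_instance
  exact isIso_of_reflects_iso _ simplicialYoneda

/-- A power with empty exponent is terminal. -/
noncomputable def powIsTerminal (hK : ∀ d, IsEmpty (K.obj d)) (X : KCat J k) :
    IsTerminal ((pow J k K).obj X) := by
  have h (n : SimplexCategoryᵒᵖ) (U : V) : Nonempty (Unique (U ⟶ ((pow J k K).obj X).obj n)) := by
    have e : (U ⟶ ((pow J k K).obj X).obj n) ≃ ((prodCosimp K).obj n.unop ⟶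
        X.obj ⋙ coyoneda.obj (op U)) :=
      ((((cotIso J k (prodCosimp K)).app X).app n).app (op U)).toEquiv
    refine ⟨@Equiv.unique _ _ ?_ e⟩
    exact
      { default :=
          { app := fun d => TypeCat.ofHom fun x => ((hK d).false x.2).elim
            naturality := fun d _ _ => by ext x; exact ((hK d).false x.2).elim }
        uniq := fun _ => by ext d x; exact ((hK d).false x.2).elim }
  have ht (n : SimplexCategoryᵒᵖ) : IsTerminal (((pow J k K).obj X).obj n) :=
    IsTerminal.ofUniqueHom (fun U => (h n U).some.default) fun U m => (h n U).some.uniq m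
  exact IsTerminal.ofUniqueHom (fun Z =>
    { app := fun n => (ht n).from (Z.obj n)
      naturality := fun _ _ _ => (ht _).hom_ext _ _ })
    fun _ _ => NatTrans.ext (funext fun _ => (ht _).hom_ext _ _)

end

/-- The simplicial set `thickPt e` is a point. -/
noncomputable def thickPtIsTerminal (e : Fin 2) : IsTerminal (thickPt.{v} e : SSet.{v}) :=
  IsTerminal.ofIso stdSimplex.isTerminalObj₀ (asIso (Subcomplex.toRange (thickVertex e)))

lemma thickPt_inf : thickPt.{v} 0 ⊓ thickPt 1 = ⊥ := by
  refine le_bot_iff.1 ?_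
  rintro ⟨d⟩ x ⟨⟨y, hy⟩, ⟨z, hz⟩⟩
  have h : (0 : Fin 2) = 1 :=
    congrArg (fun s : Fin (d.len + 1) → ULift.{v} (Fin 2) => (s 0).down) (hy.trans hz.symm)
  simp at h

lemma isPushout_thickEnds : IsPushout
    (Subcomplex.homOfLE (bot_le : ⊥ ≤ thickPt.{v} 0))
    (Subcomplex.homOfLE (bot_le : ⊥ ≤ thickPt.{v} 1))
    (Subcomplex.homOfLE (le_sup_left : thickPt.{v} 0 ≤ thickEnds))
    (Subcomplex.homOfLE (le_sup_right : thickPt.{v} 1 ≤ thickEnds)) :=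
  Subcomplex.BicartSq.isPushout { sup_eq := rfl, inf_eq := thickPt_inf }

variable (J k) in
/-- The evaluation of morphisms from `thickEnds` at a vertex. -/
noncomputable def endsEv (e : Fin 2) (h : thickPt.{v} e ≤ thickEnds) (X : KCat J k) :
    (pow J k (thickEnds.{v} : SSet.{v})).obj X ⟶ X.obj :=
  have := isIso_constNat_app (thickPtIsTerminal.{v} e) X
  (powNat J k (Subcomplex.homOfLE h)).app X ≫ inv ((constNat J k (thickPt.{v} e)).app X)

variable (J k) in
/-- The evaluation of morphisms from the thick simplex at a vertex. -/
noncomputable def pathEv (e : Fin 2) (X : KCat J k) :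
    (pow J k (thick.{v}.obj ⦋1⦌)).obj X ⟶ X.obj :=
  have := isIso_constNat_app (thickPtIsTerminal.{v} e) X
  (powNat J k (thickPt e).ι).app X ≫ inv ((constNat J k (thickPt.{v} e)).app X)

lemma constNat_pathEv (e : Fin 2) (X : KCat J k) :
    (constNat J k (thick.obj ⦋1⦌)).app X ≫ pathEv J k e X = 𝟙 _ := by
  have := isIso_constNat_app (thickPtIsTerminal.{v} e) X
  rw [pathEv, ← Category.assoc, constNat_powNat, IsIso.hom_inv_id]

lemma powNat_endsEv (e : Fin 2) (h : thickPt.{v} e ≤ thickEnds) (X : KCat J k) :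
    (powNat J k thickEnds.ι).app X ≫ endsEv J k e h X = pathEv J k e X := by
  rw [endsEv, pathEv, ← Category.assoc, powNat_comp]
  rfl

lemma pathEv_naturality (e : Fin 2) {X Y : KCat J k} (f : X ⟶ Y) :
    (pow J k (thick.obj ⦋1⦌)).map f ≫ pathEv J k e Y = pathEv J k e X ≫ f.hom := by
  have := isIso_constNat_app (thickPtIsTerminal.{v} e) X
  have := isIso_constNat_app (thickPtIsTerminal.{v} e) Y
  rw [pathEv, pathEv, ← Category.assoc, NatTrans.naturality, Category.assoc, Category.assoc]
  congr 1
  rw [IsIso.comp_inv_eq, Category.assoc, IsIso.eq_inv_comp]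
  exact ((constNat J k (thickPt.{v} e)).naturality f).symm

lemma endsEv_naturality (e : Fin 2) (h : thickPt.{v} e ≤ thickEnds) {X Y : KCat J k} (f : X ⟶ Y) :
    (pow J k (thickEnds.{v} : SSet.{v})).map f ≫ endsEv J k e h Y = endsEv J k e h X ≫ f.hom := by
  have := isIso_constNat_app (thickPtIsTerminal.{v} e) X
  have := isIso_constNat_app (thickPtIsTerminal.{v} e) Y
  rw [endsEv, endsEv, ← Category.assoc, NatTrans.naturality, Category.assoc, Category.assoc]
  congr 1
  rw [IsIso.comp_inv_eq, Category.assoc, IsIso.eq_inv_comp]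
  exact ((constNat J k (thickPt.{v} e)).naturality f).symm

instance isEmpty_bot (T : SSet.{v}) (d : SimplexCategoryᵒᵖ) :
    IsEmpty (((⊥ : T.Subcomplex) : SSet.{v}).obj d) := ⟨fun x => x.2⟩

/-- The power of `X` by `thickEnds` is the product of `X` with itself. -/
lemma isPullback_endsEv (X : KCat J k) :
    IsPullback (endsEv J k 0 le_sup_left X) (endsEv J k 1 le_sup_right X)
      (ptSIsTerminal.from X.obj) (ptSIsTerminal.from X.obj) := by
  have := isIso_constNat_app (thickPtIsTerminal.{v} 0) X
  have := isIso_constNat_app (thickPtIsTerminal.{v} 1) X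
  have h : IsPullback ((powNat J k (Subcomplex.homOfLE (le_sup_left :
      thickPt.{v} 0 ≤ thickEnds))).app X) ((powNat J k (Subcomplex.homOfLE (le_sup_right :
      thickPt.{v} 1 ≤ thickEnds))).app X) ((powNat J k (Subcomplex.homOfLE bot_le)).app X)
      ((powNat J k (Subcomplex.homOfLE bot_le)).app X) :=
    isPullback_cotNat (fun n => isPushout_thickEnds.map (tensorLeft (SSet.stdSimplex.obj n))) X
  exact IsPullback.of_iso h (Iso.refl _)
    (asIso ((constNat J k (thickPt.{v} 0)).app X)).symm
    (asIso ((constNat J k (thickPt.{v} 1)).app X)).symm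
    ((powIsTerminal (isEmpty_bot _) X).uniqueUpToIso ptSIsTerminal)
    (Category.id_comp _).symm (Category.id_comp _).symm
    (ptSIsTerminal.hom_ext _ _) (ptSIsTerminal.hom_ext _ _)

end

end HigherCat

namespace HigherCat

open SSet MonoidalCategory

/-! ### Path spaces of `k`-categories -/

section

variable {V : Type u} [Category.{v} V] [HasFiniteLimits V] {J : MorphismProperty V}
  [IsDescentCategory J] {k : ℕ} [NeZero k]

/-- By Leibniz's rule for the vertex `e` in the thick interval, this is the lifting property of `f`
against ∂Δ[n] ⊗ thick 1 ∪ Δ[n] ⊗ {e}. -/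
lemma pathGap_hypercover {X Y : KCat J k} {f : X ⟶ Y} (hf : KCat.quasiFib J k f) {e : Fin 2}
    {W : SimplicialObject V} {a : W ⟶ X.obj} {b : W ⟶ (pow J k (thick.obj ⦋1⦌)).obj Y}
    (hW : IsPullback a b f.hom (pathEv J k e Y)) {g : (pow J k (thick.obj ⦋1⦌)).obj X ⟶ W}
    (hga : g ≫ a = pathEv J k e X) (hgb : g ≫ b = (pow J k (thick.obj ⦋1⦌)).map f) :
    hypercover J g := by
  have := isIso_constNat_app (thickPtIsTerminal.{v} e) X
  have := isIso_constNat_app (thickPtIsTerminal.{v} e) Y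
  have hW' : IsPullback (a ≫ (constNat J k (thickPt.{v} e)).app X) b
      ((pow J k (thickPt.{v} e)).map f) ((powNat J k (thickPt e).ι).app Y) :=
    IsPullback.of_iso hW (Iso.refl _) (asIso ((constNat J k (thickPt.{v} e)).app X)) (Iso.refl _)
      (asIso ((constNat J k (thickPt.{v} e)).app Y)) (by simp) (by simp)
      ((constNat J k (thickPt.{v} e)).naturality f) (by simp [pathEv])
  exact fun n => liftIn_iff.1 ((liftIn_iff_liftIn_unionProd _ _ f hW'
    (by rw [← Category.assoc, hga]; simp [pathEv]) hgb).2
    (liftIn_boundary_unionProd_thickPt X.cosk Y.cosk hf n e))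

lemma endsGap_hypercover {X Y : KCat J k} {f : X ⟶ Y} (hf : KCat.hyper J k f)
    {W : SimplicialObject V} {a : W ⟶ (pow J k (thickEnds.{v} : SSet.{v})).obj X}
    {b : W ⟶ (pow J k (thick.obj ⦋1⦌)).obj Y}
    (hW : IsPullback a b ((pow J k (thickEnds.{v} : SSet.{v})).map f)
      ((powNat J k thickEnds.ι).app Y)) {g : (pow J k (thick.obj ⦋1⦌)).obj X ⟶ W}
    (hga : g ≫ a = (powNat J k thickEnds.ι).app X)
    (hgb : g ≫ b = (pow J k (thick.obj ⦋1⦌)).map f) : hypercover J g := fun _ =>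
  liftIn_iff.1 ((liftIn_iff_liftIn_unionProd _ _ f hW hga hgb).2
    (hypercover.liftIn hf X.cosk Y.cosk _))

/-- Apply Leibniz's rule to the map from `X` to the point; restriction between powers of the point
is invertible. -/
lemma liftIn_powNat_iff {C : MorphismProperty (Vᵒᵖ ⥤ Type v)} [C.IsStableUnderBaseChange]
    {T K : SSet.{v}} [∀ d, Finite (K _⦋d⦌)] (A : T.Subcomplex) (B : K.Subcomplex) (X : KCat J k) :
    LiftIn C A.ι ((powNat J k B.ι).app X) ↔
      LiftIn C (A.unionProd B).ι (KCat.ptIsTerminal.from X).hom := by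
  have : IsIso ((powNat J k B.ι).app (KCat.pt J k)) :=
    isIso_cotNat_app _ _ fun n => isIso_res_ptS _
  refine liftIn_iff_liftIn_unionProd (a := 𝟙 _) (b := (pow J k (B : SSet.{v})).map
    (KCat.ptIsTerminal.from X) ≫ inv ((powNat J k B.ι).app (KCat.pt J k))) A B
    (KCat.ptIsTerminal.from X) (IsPullback.of_horiz_isIso ⟨by simp⟩) (Category.comp_id _) ?_
  rw [← Category.assoc, IsIso.comp_inv_eq]
  exact ((powNat J k B.ι).naturality _).symm

lemma hypercover_powNat_thickPt (e : Fin 2) (X : KCat J k) :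
    hypercover J ((powNat J k (thickPt e).ι).app X) := fun n =>
  liftIn_iff.1 ((liftIn_powNat_iff _ _ X).2 (liftIn_boundary_unionProd_thickPt X.cosk
    (KCat.cosk (KCat.pt J k)) (KCat.quasiFib_of_isTerminal KCat.ptIsTerminal _) n e))

lemma hypercover_pathEv (e : Fin 2) (X : KCat J k) : hypercover J (pathEv J k e X) := by
  have := isIso_constNat_app (thickPtIsTerminal.{v} e) X
  exact fun n => liftIn_iff.1 ((liftIn_iff.2 (hypercover_powNat_thickPt e X n)).comp_right
    (LiftIn.of_isIso_post _ _))

lemma LiftIn.unionProd_symm {C : MorphismProperty (Vᵒᵖ ⥤ Type v)} [C.IsStableUnderBaseChange]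
    [C.IsMultiplicative] {T K : SSet.{v}} {A : T.Subcomplex} {B : K.Subcomplex}
    {X Y : SimplicialObject V} {f : X ⟶ Y} (h : LiftIn C (A.unionProd B).ι f) :
    LiftIn C (B.unionProd A).ι f :=
  (liftIn_congr f (Arrow.isoMk' (A.unionProd B).ι (B.unionProd A).ι
    (Subcomplex.unionProd.symmIso A B) (β_ _ _) rfl)).1 h

/-- Exchange the two factors: the vertex condition for restriction to the ends is the lifting
condition of evaluation at a vertex against the inclusion of the ends, and evaluation is a
hypercover. -/
lemma liftIn_thickPt_powNat_thickEnds (X : KCat J k) (i : Fin 2) :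
    LiftIn J.presheaf (thickPt i).ι ((powNat J k thickEnds.ι).app X) :=
  (liftIn_powNat_iff _ _ X).2 (LiftIn.unionProd_symm
    ((liftIn_powNat_iff thickEnds (thickPt i) X).1
      ((hypercover_powNat_thickPt i X).liftIn (pow_cosk X) (pow_cosk X) _)))

lemma liftIn_thickPt_iff {C : MorphismProperty (Vᵒᵖ ⥤ Type v)} [C.IsStableUnderBaseChange]
    [C.IsMultiplicative] {X Y : SimplicialObject V} {f : X ⟶ Y} {i : Fin 2} :
    LiftIn C (thickPt i).ι f ↔ LiftIn C (thickVertex i) f := by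
  have h := (liftProp C f).cancel_left_of_respectsIso (Subcomplex.toRange (thickVertex i))
    (thickPt i).ι
  rw [Subcomplex.toRange_ι] at h
  exact h.symm

lemma liftIn_horn_powNat_thickEnds {C : MorphismProperty (Vᵒᵖ ⥤ Type v)} [C.IsMultiplicative]
    [C.IsStableUnderBaseChange] (X : KCat J k) {n : ℕ} {i : Fin (n + 1)} (h₀ : 0 < i)
    (h₁ : i < Fin.last n) (h : ∀ d, n ≤ d + 1 → ∀ p : Fin (d + 2), 0 < p → p < Fin.last (d + 1) →
      C (Map.res Λ[d + 1, p].ι X.obj)) :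
    LiftIn C Λ[n, i].ι ((powNat J k thickEnds.ι).app X) :=
  (liftIn_powNat_iff _ _ X).2 (liftIn_horn_unionProd_thickEnds X.cosk (KCat.cosk (KCat.pt J k))
    h₀ h₁ fun d hd p hp₀ hp₁ => (liftIn_ptS_iff _).2 (h d hd p hp₀ hp₁))

/-- The horn matching is used twice, with covers and, above `k`, with isomorphisms. In the second
case every horn used has dimension at least that of the given one, hence above `k`. -/
lemma relKCategory_powNat_thickEnds (X : KCat J k) :
    relKCategory J k ((powNat J k thickEnds.ι).app X) :=
  ⟨⟨fun _ _ h₀ h₁ => liftIn_iff.1 (liftIn_horn_powNat_thickEnds X h₀ h₁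
    fun _ _ p hp₀ hp₁ => X.2.cover _ p hp₀ hp₁),
    fun i => liftIn_iff.1 (liftIn_thickPt_iff.1 (liftIn_thickPt_powNat_thickEnds X i))⟩,
    fun _ _ h₀ h₁ hk => liftIn_horn_powNat_thickEnds X h₀ h₁
      fun _ hd p hp₀ hp₁ => X.2.isIso _ p hp₀ hp₁ (by lia)⟩

/-- This power is X × X, and its second projection is a base change of the map from `X` to the
point. -/
lemma isKCategory_pow_thickEnds (X : KCat J k) :
    IsKCategory J k ((pow J k (thickEnds.{v} : SSet.{v})).obj X) :=
  (relKCategory.of_isPullback (isPullback_endsEv X)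
    ((relKCategory_ptS_iff _).2 X.2)).isKCategory X.2

lemma isKCategory_pow_thick (X : KCat J k) :
    IsKCategory J k ((pow J k (thick.obj ⦋1⦌)).obj X) :=
  (relKCategory_powNat_thickEnds X).isKCategory (isKCategory_pow_thickEnds X)

end

end HigherCat

namespace HigherCat

/-! ### Categories of fibrant objects from path objects -/

section PathObjects

variable {D : Type u} [Category.{v} D]

/-- Functorial path objects `E X ⟶ B X` in a category with fibrations `F` and trivial
fibrations `H`, where `B X` is the product of `X` with itself. -/
structure PathObjects (F H : MorphismProperty D) where
  /-- the path object -/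
  E : D ⥤ D
  /-- the square -/
  B : D ⥤ D
  /-- the start of a path -/
  ev₀ : E ⟶ 𝟭 D
  /-- the end of a path -/
  ev₁ : E ⟶ 𝟭 D
  /-- the constant path -/
  σ : 𝟭 D ⟶ E
  /-- the first projection -/
  p₀ : B ⟶ 𝟭 D
  /-- the second projection -/
  p₁ : B ⟶ 𝟭 D
  /-- the start and the end of a path -/
  ev : E ⟶ B
  ev_p₀ : ev ≫ p₀ = ev₀
  ev_p₁ : ev ≫ p₁ = ev₁
  σ_ev₀ : σ ≫ ev₀ = 𝟙 _
  σ_ev₁ : σ ≫ ev₁ = 𝟙 _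
  exists_lift : ∀ {T X : D} (a b : T ⟶ X), ∃ l : T ⟶ B.obj X, l ≫ p₀.app X = a ∧ l ≫ p₁.app X = b
  hom_ext : ∀ {T X : D} (l l' : T ⟶ B.obj X), l ≫ p₀.app X = l' ≫ p₀.app X →
    l ≫ p₁.app X = l' ≫ p₁.app X → l = l'
  fib_ev : ∀ X, F (ev.app X)
  trivialFib_ev₀ : ∀ X, H (ev₀.app X)
  trivialFib_ev₁ : ∀ X, H (ev₁.app X)
  trivialFib_gap : ∀ {X Y W : D} {f : X ⟶ Y} {a : W ⟶ X} {b : W ⟶ E.obj Y} {g : E.obj X ⟶ W},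
    F f → IsPullback a b f (ev₀.app Y) → g ≫ a = ev₀.app X → g ≫ b = E.map f → H g
  trivialFib_ends_gap : ∀ {X Y W : D} {f : X ⟶ Y} {a : W ⟶ B.obj X} {b : W ⟶ E.obj Y}
    {g : E.obj X ⟶ W}, H f → IsPullback a b (B.map f) (ev.app Y) → g ≫ a = ev.app X →
      g ≫ b = E.map f → H g

namespace PathObjects

variable {F H : MorphismProperty D} (Q : PathObjects F H)

lemma ev_p₀_app (X : D) : Q.ev.app X ≫ Q.p₀.app X = Q.ev₀.app X := congr_app Q.ev_p₀ X

lemma ev_p₁_app (X : D) : Q.ev.app X ≫ Q.p₁.app X = Q.ev₁.app X := congr_app Q.ev_p₁ X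

lemma σ_ev₀_app (X : D) : Q.σ.app X ≫ Q.ev₀.app X = 𝟙 X := congr_app Q.σ_ev₀ X

lemma σ_ev₁_app (X : D) : Q.σ.app X ≫ Q.ev₁.app X = 𝟙 X := congr_app Q.σ_ev₁ X

lemma ev₀_naturality {X Y : D} (f : X ⟶ Y) : Q.E.map f ≫ Q.ev₀.app Y = Q.ev₀.app X ≫ f :=
  Q.ev₀.naturality f

lemma ev₁_naturality {X Y : D} (f : X ⟶ Y) : Q.E.map f ≫ Q.ev₁.app Y = Q.ev₁.app X ≫ f :=
  Q.ev₁.naturality f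

lemma p₀_naturality {X Y : D} (f : X ⟶ Y) : Q.B.map f ≫ Q.p₀.app Y = Q.p₀.app X ≫ f :=
  Q.p₀.naturality f

lemma p₁_naturality {X Y : D} (f : X ⟶ Y) : Q.B.map f ≫ Q.p₁.app Y = Q.p₁.app X ≫ f :=
  Q.p₁.naturality f

variable [H.IsMultiplicative] [H.IsStableUnderBaseChange]

lemma exists_pathSpace (hHF : H ≤ F) (hpb : ∀ {X Y Z : D} (f : X ⟶ Y) (g : Z ⟶ Y), F f →
      ∃ (P : D) (fst : P ⟶ X) (snd : P ⟶ Z), IsPullback fst snd f g)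
    {X Y : D} (f : X ⟶ Y) : ∃ (P : D) (a : P ⟶ X) (b : P ⟶ Q.E.obj Y),
    IsPullback a b f (Q.ev₀.app Y) := by
  obtain ⟨P, b, a, h⟩ := hpb (Q.ev₀.app Y) f (hHF _ (Q.trivialFib_ev₀ Y))
  exact ⟨P, a, b, h.flip⟩

lemma trivialFib_fst {X Y P : D} {f : X ⟶ Y} {a : P ⟶ X} {b : P ⟶ Q.E.obj Y}
    (h : IsPullback a b f (Q.ev₀.app Y)) : H a :=
  H.of_isPullback h.flip (Q.trivialFib_ev₀ Y)

/-- The section sends a point to the constant path at its image under `f`. -/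
lemma exists_section {X Y P : D} {f : X ⟶ Y} {a : P ⟶ X} {b : P ⟶ Q.E.obj Y}
    (h : IsPullback a b f (Q.ev₀.app Y)) :
    ∃ s : X ⟶ P, s ≫ a = 𝟙 X ∧ s ≫ b ≫ Q.ev₁.app Y = f := by
  refine ⟨h.lift (𝟙 X) (f ≫ Q.σ.app Y) ?_, h.lift_fst _ _ _, ?_⟩
  · rw [Category.id_comp, Category.assoc, σ_ev₀_app, Category.comp_id]
  · rw [h.lift_snd_assoc, Category.assoc, σ_ev₁_app, Category.comp_id]

/-- A morphism is a weak equivalence if its path space is a trivial fibration. -/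
lemma spanWeq_of_pathSpace {X Y P : D} {f : X ⟶ Y} {a : P ⟶ X} {b : P ⟶ Q.E.obj Y}
    (h : IsPullback a b f (Q.ev₀.app Y)) (hb : H (b ≫ Q.ev₁.app Y)) : spanWeq H f := by
  obtain ⟨s, h₁, h₂⟩ := Q.exists_section h
  exact ⟨P, a, _, s, Q.trivialFib_fst h, hb, h₁, h₂⟩

/-- The path space of a weak equivalence is a trivial fibration. -/
lemma pathSpace_of_spanWeq (hHF : H ≤ F) (hpb : ∀ {X Y Z : D} (f : X ⟶ Y) (g : Z ⟶ Y), F f →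
      ∃ (P : D) (fst : P ⟶ X) (snd : P ⟶ Z), IsPullback fst snd f g)
    (hcancel : ∀ {X Y Z : D} (f : X ⟶ Y) (g : Y ⟶ Z), H f → H (f ≫ g) → H g)
    {X Y Pf : D} {f : X ⟶ Y} {a : Pf ⟶ X} {b : Pf ⟶ Q.E.obj Y}
    (h : IsPullback a b f (Q.ev₀.app Y)) (hf : spanWeq H f) : H (b ≫ Q.ev₁.app Y) := by
  obtain ⟨P, p, q, s, hp, hq, hsp, hsq⟩ := hf
  obtain ⟨W, a', b', hW⟩ := Q.exists_pathSpace hHF hpb q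
  obtain ⟨g, hga, hgb⟩ := hW.exists_lift (Q.ev₀.app P) (Q.E.map q) (Q.ev₀_naturality q).symm
  have hg : H g := Q.trivialFib_gap (hHF _ hq) hW hga hgb
  -- A point of the path space of `f` is a pair (x, path in Y); `u` regards it as the pair (s x,
  -- path in Y) in the path space of `q`.
  obtain ⟨u, hua, hub⟩ := hW.exists_lift (a ≫ s) b (by rw [Category.assoc, hsq, h.w])
  -- `C` is the space of paths in `P` that start at a point s x. It lies over the path space of `f`
  -- by a trivial fibration.
  obtain ⟨C, c₁, c₂, hC⟩ := hpb g u (hHF _ hg)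
  have hc₂ : H c₂ := H.of_isPullback hC hg
  obtain ⟨V, v₂, v₁, hV⟩ := hpb (Q.ev.app X) (Q.B.map p) (Q.fib_ev X)
  obtain ⟨g', hga', hgb'⟩ := hV.flip.exists_lift (Q.ev.app P) (Q.E.map p) (Q.ev.naturality p).symm
  have hg' : H g' := Q.trivialFib_ends_gap hp hV.flip hga' hgb'
  -- `R` consists of a point of `P` and a path in `X` ending at its image under `p`. Lifting such a
  -- path to `P`, with its start prescribed by `s`, gives a point of `C`.
  obtain ⟨R, r₁, r₂, hR⟩ := hpb p (Q.ev₁.app X) (hHF _ hp)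
  have hr₁ : H r₁ := H.of_isPullback hR.flip (Q.trivialFib_ev₁ X)
  obtain ⟨m, hm₀, hm₁⟩ := Q.exists_lift (r₂ ≫ Q.ev₀.app X ≫ s) r₁
  obtain ⟨w, hw₂, hw₁⟩ := hV.exists_lift r₂ m (by
    apply Q.hom_ext
    · simp only [Category.assoc, Q.ev_p₀_app, Q.p₀_naturality, reassoc_of% hm₀, hsp,
        Category.comp_id]
    · simp only [Category.assoc, Q.ev_p₁_app, Q.p₁_naturality, reassoc_of% hm₁, hR.w])
  have hc₁ : c₁ ≫ Q.ev₀.app P = c₂ ≫ a ≫ s := by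
    rw [← hga, ← Category.assoc, hC.w, Category.assoc, hua]
  have hc₁' : c₁ ≫ Q.E.map q = c₂ ≫ b := by
    rw [← hgb, ← Category.assoc, hC.w, Category.assoc, hub]
  obtain ⟨t, ht₁, ht₂⟩ := hR.exists_lift (c₁ ≫ Q.ev₁.app P) (c₁ ≫ Q.E.map p) (by
    rw [Category.assoc, Category.assoc, Q.ev₁_naturality])
  have hc₁p : c₁ ≫ Q.ev₀.app P ≫ p = c₂ ≫ a := by
    rw [← Category.assoc, hc₁, Category.assoc, Category.assoc, hsp, Category.comp_id]
  -- Thus `C` over `R` is a base change of the trivial fibration `g'`, which sends a path in `P` to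
  -- its two ends and its image in `X`.
  have hT : IsPullback c₁ t g' w := by
    refine IsPullback.mk' ?_ ?_ ?_
    · apply hV.hom_ext
      · rw [Category.assoc, hgb', Category.assoc, hw₂, ht₂]
      · apply Q.hom_ext
        · simp only [Category.assoc]
          rw [reassoc_of% hga', reassoc_of% hw₁, hm₀, Q.ev_p₀_app, reassoc_of% ht₂,
            reassoc_of% (Q.ev₀_naturality p), reassoc_of% hc₁p, hc₁]
        · simp only [Category.assoc]
          rw [reassoc_of% hga', reassoc_of% hw₁, hm₁, Q.ev_p₁_app, ht₁]
    swap
    · intro T γ ρ hγ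
      have e₁ : γ ≫ Q.E.map p = ρ ≫ r₂ := by
        rw [← hgb', ← Category.assoc, hγ, Category.assoc, hw₂]
      have e₂ : γ ≫ Q.ev.app P = ρ ≫ m := by
        rw [← hga', ← Category.assoc, hγ, Category.assoc, hw₁]
      have e₃ : γ ≫ Q.ev₀.app P = (ρ ≫ r₂ ≫ Q.ev₀.app X) ≫ s := by
        rw [← Q.ev_p₀_app, ← Category.assoc, e₂, Category.assoc, hm₀]
        simp only [Category.assoc]
      have e₄ : γ ≫ Q.ev₁.app P = ρ ≫ r₁ := by
        rw [← Q.ev_p₁_app, ← Category.assoc, e₂, Category.assoc, hm₁]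
      obtain ⟨l, hl₁, hl₂⟩ := h.exists_lift (ρ ≫ r₂ ≫ Q.ev₀.app X) (γ ≫ Q.E.map q) (by
        rw [← hsq, ← Category.assoc, ← e₃, Category.assoc, Category.assoc, Q.ev₀_naturality])
      obtain ⟨l', hl'₁, hl'₂⟩ := hC.exists_lift γ l (by
        apply hW.hom_ext
        · simp only [Category.assoc, hga, hua, e₃, reassoc_of% hl₁]
        · rw [Category.assoc, hgb, Category.assoc, hub, hl₂])
      refine ⟨l', hl'₁, hR.hom_ext ?_ ?_⟩
      · rw [Category.assoc, ht₁, reassoc_of% hl'₁, e₄]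
      · rw [Category.assoc, ht₂, reassoc_of% hl'₁, e₁]
    · intro T l l' h₁ _
      refine hC.hom_ext h₁ (h.hom_ext ?_ ?_)
      · rw [Category.assoc, Category.assoc, ← hc₁p, reassoc_of% h₁]
      · rw [Category.assoc, Category.assoc, ← hc₁', reassoc_of% h₁]
  have ht : H t := H.of_isPullback hT hg'
  -- Composed with `c₂`, the projection to `Y` becomes `t ≫ r₁ ≫ q`, a composite of trivial
  -- fibrations.
  refine hcancel c₂ _ hc₂ ?_
  rw [← Category.assoc, ← hc₁', Category.assoc, Q.ev₁_naturality, ← Category.assoc, ← ht₁]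
  exact H.comp_mem _ _ (H.comp_mem _ _ ht hr₁) hq

end PathObjects

/-! ### Axioms of a category of fibrant objects from path spaces -/

lemma trivialFib_spanWeq {H : MorphismProperty D} [H.IsMultiplicative] {X Y : D} {f : X ⟶ Y}
    (hf : H f) : spanWeq H f :=
  ⟨X, 𝟙 X, f, 𝟙 X, H.id_mem X, hf, Category.id_comp _, Category.id_comp _⟩

section

variable {F H : MorphismProperty D} [H.IsMultiplicative] [H.IsStableUnderBaseChange]

lemma spanWeq_comp (hpb : ∀ {X Y Z : D} (f : X ⟶ Y) (g : Z ⟶ Y), H f →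
      ∃ (P : D) (fst : P ⟶ X) (snd : P ⟶ Z), IsPullback fst snd f g)
    {X Y Z : D} {f : X ⟶ Y} {g : Y ⟶ Z} (hf : spanWeq H f) (hg : spanWeq H g) :
    spanWeq H (f ≫ g) := by
  obtain ⟨P, p, q, s, hp, hq, hsp, rfl⟩ := hf
  obtain ⟨P', p', q', s', hp', hq', hsp', rfl⟩ := hg
  obtain ⟨R, a, b, h⟩ := hpb q p' hq
  obtain ⟨t, ht₁, ht₂⟩ := h.exists_lift s (s ≫ q ≫ s') (by
    rw [Category.assoc, Category.assoc, hsp', Category.comp_id])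
  refine ⟨R, a ≫ p, b ≫ q', t, H.comp_mem _ _ (H.of_isPullback h.flip hp') hp,
    H.comp_mem _ _ (H.of_isPullback h hq) hq', by rw [reassoc_of% ht₁, hsp], ?_⟩
  rw [reassoc_of% ht₂, Category.assoc]

/-- Run the span of `g` backwards: pull back the two legs over `Z` and compose with `p` and `p'`. -/
lemma spanWeq_of_comp_left (hpb : ∀ {X Y Z : D} (f : X ⟶ Y) (g : Z ⟶ Y), H f →
      ∃ (P : D) (fst : P ⟶ X) (snd : P ⟶ Z), IsPullback fst snd f g)
    {X Y Z : D} {f : X ⟶ Y} {g : Y ⟶ Z} (hfg : spanWeq H (f ≫ g)) (hg : spanWeq H g) :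
    spanWeq H f := by
  obtain ⟨P, p, q, s, hp, hq, hsp, hsq⟩ := hfg
  obtain ⟨P', p', q', s', hp', hq', hsp', rfl⟩ := hg
  obtain ⟨R, a, b, h⟩ := hpb q q' hq
  obtain ⟨t, ht₁, ht₂⟩ := h.exists_lift s (f ≫ s') (by rw [hsq, Category.assoc])
  exact ⟨R, a ≫ p, b ≫ p', t, H.comp_mem _ _ (H.of_isPullback h.flip hq') hp,
    H.comp_mem _ _ (H.of_isPullback h hq) hp', by rw [reassoc_of% ht₁, hsp],
    by rw [reassoc_of% ht₂, hsp', Category.comp_id]⟩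

/-- A category with path objects is a category of fibrant objects, and its trivial fibrations
are the given ones. -/
theorem PathObjects.isCategoryOfFibrantObjects (Q : PathObjects F H) [F.IsMultiplicative]
    [F.IsStableUnderBaseChange] (hHF : H ≤ F)
    (hpb : ∀ {X Y Z : D} (f : X ⟶ Y) (g : Z ⟶ Y), F f →
      ∃ (P : D) (fst : P ⟶ X) (snd : P ⟶ Z), IsPullback fst snd f g)
    (hcancel : ∀ {X Y Z : D} (f : X ⟶ Y) (g : Y ⟶ Z), H f → H (f ≫ g) → H g)
    {e : D} (he : IsTerminal e) (hfib : ∀ {X e : D}, IsTerminal e → ∀ f : X ⟶ e, F f) :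
    IsCategoryOfFibrantObjects (spanWeq H) F ∧
      ∀ {X Y : D} (f : X ⟶ Y), (F f ∧ spanWeq H f) ↔ H f := by
  have hpb' {X Y Z : D} (f : X ⟶ Y) (g : Z ⟶ Y) (hf : H f) :
      ∃ (P : D) (fst : P ⟶ X) (snd : P ⟶ Z), IsPullback fst snd f g := hpb f g (hHF _ hf)
  -- The composite from the path object of `X` through the path space of `f` to `Y` is a trivial
  -- fibration and equals `ev₁` followed by `f`; cancel `ev₁`.
  have key {X Y : D} (f : X ⟶ Y) (hf : F f) (hf' : spanWeq H f) : H f := by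
    obtain ⟨P, a, b, h⟩ := Q.exists_pathSpace hHF hpb f
    obtain ⟨g, hga, hgb⟩ := h.exists_lift (Q.ev₀.app X) (Q.E.map f) (Q.ev₀_naturality f).symm
    refine hcancel (Q.ev₁.app X) f (Q.trivialFib_ev₁ X) ?_
    rw [← Q.ev₁_naturality, ← hgb, Category.assoc]
    exact H.comp_mem _ _ (Q.trivialFib_gap hf h hga hgb)
      (Q.pathSpace_of_spanWeq hHF hpb hcancel h hf')
  have hFW : F ⊓ spanWeq H = H := by
    ext X Y f
    exact ⟨fun h => key f h.1 h.2, fun h => ⟨hHF _ h, trivialFib_spanWeq h⟩⟩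
  -- The path space is the base change of the fibration `ev` along X × Y → Y × Y, and the projection
  -- of X × Y to `Y` is a fibration because `X` is fibrant.
  have fib_pathSpace {X Y P : D} {f : X ⟶ Y} {a : P ⟶ X} {b : P ⟶ Q.E.obj Y}
      (h : IsPullback a b f (Q.ev₀.app Y)) : F (b ≫ Q.ev₁.app Y) := by
    obtain ⟨M, m₁, m₂, hM⟩ := hpb (he.from X) (he.from Y) (hfib he _)
    obtain ⟨n, hn₀, hn₁⟩ := Q.exists_lift (m₁ ≫ f) m₂
    obtain ⟨r, hr₁, hr₂⟩ := hM.exists_lift a (b ≫ Q.ev₁.app Y) (he.hom_ext _ _)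
    have hr : IsPullback b r (Q.ev.app Y) n := by
      refine IsPullback.mk' ?_ ?_ ?_
      · apply Q.hom_ext
        · rw [Category.assoc, Q.ev_p₀_app, Category.assoc, hn₀, reassoc_of% hr₁, h.w]
        · rw [Category.assoc, Q.ev_p₁_app, Category.assoc, hn₁, hr₂]
      swap
      · intro T β μ hβ
        obtain ⟨l, hl₁, hl₂⟩ := h.exists_lift (μ ≫ m₁) β (by
          rw [← Q.ev_p₀_app, reassoc_of% hβ, hn₀, Category.assoc])
        refine ⟨l, hl₂, hM.hom_ext ?_ ?_⟩
        · rw [Category.assoc, hr₁, hl₁]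
        · rw [Category.assoc, hr₂, reassoc_of% hl₂, ← Q.ev_p₁_app, reassoc_of% hβ, hn₁]
      · intro T l l' h₁ h₂
        refine h.hom_ext ?_ h₁
        rw [← hr₁, reassoc_of% h₂]
    rw [← hr₂]
    exact F.comp_mem _ _ (F.of_isPullback hr (Q.fib_ev Y)) (F.of_isPullback hM (hfib he _))
  -- The path space of `f` maps to that of `f ≫ g` by a base change of the gap map of the fibration
  -- `g`, so its composite to `Z` is a trivial fibration. That composite is also the trivial
  -- fibration to `Y` followed by `g`.
  have cancel_of_fib {X Y Z : D} (f : X ⟶ Y) (g : Y ⟶ Z) (hg : F g) (hf : spanWeq H f)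
      (hfg : spanWeq H (f ≫ g)) : H g := by
    obtain ⟨P, a, b, h⟩ := Q.exists_pathSpace hHF hpb f
    obtain ⟨P', a', b', h'⟩ := Q.exists_pathSpace hHF hpb (f ≫ g)
    obtain ⟨W, w₁, w₂, hW⟩ := Q.exists_pathSpace hHF hpb g
    obtain ⟨γ, hγ₁, hγ₂⟩ := hW.exists_lift (Q.ev₀.app Y) (Q.E.map g) (Q.ev₀_naturality g).symm
    obtain ⟨u, hu₁, hu₂⟩ := hW.exists_lift (a' ≫ f) b' (by rw [Category.assoc, h'.w])
    obtain ⟨t, ht₁, ht₂⟩ := h'.exists_lift a (b ≫ Q.E.map g) (by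
      rw [Category.assoc, Q.ev₀_naturality, ← Category.assoc, ← Category.assoc, h.w])
    have hT : IsPullback b t γ u := by
      refine IsPullback.mk' ?_ ?_ ?_
      · apply hW.hom_ext
        · rw [Category.assoc, hγ₁, Category.assoc, hu₁, reassoc_of% ht₁, h.w]
        · rw [Category.assoc, hγ₂, Category.assoc, hu₂, ht₂]
      swap
      · intro T β ρ hβ
        obtain ⟨l, hl₁, hl₂⟩ := h.exists_lift (ρ ≫ a') β (by
          rw [← hγ₁, reassoc_of% hβ, hu₁, Category.assoc])
        refine ⟨l, hl₂, h'.hom_ext ?_ ?_⟩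
        · rw [Category.assoc, ht₁, hl₁]
        · rw [Category.assoc, ht₂, reassoc_of% hl₂, ← hγ₂, reassoc_of% hβ, hu₂]
      · intro T l l' h₁ h₂
        refine h.hom_ext ?_ h₁
        rw [← ht₁, reassoc_of% h₂]
    refine hcancel (b ≫ Q.ev₁.app Y) g (Q.pathSpace_of_spanWeq hHF hpb hcancel h hf) ?_
    rw [Category.assoc, ← Q.ev₁_naturality, ← Category.assoc, ← ht₂, Category.assoc]
    exact H.comp_mem _ _ (H.of_isPullback hT (Q.trivialFib_gap hg hW hγ₁ hγ₂))
      (Q.pathSpace_of_spanWeq hHF hpb hcancel h' hfg)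
  refine ⟨{
    weq_multiplicative :=
      { id_mem := fun X => trivialFib_spanWeq (H.id_mem X)
        comp_mem := fun _ _ hf hg => spanWeq_comp hpb' hf hg }
    weq_of_isIso := fun f _ => trivialFib_spanWeq (H.of_isIso f)
    weq_iff := fun f g hfg => ⟨fun hf => ?_, fun hg => spanWeq_of_comp_left hpb' hfg hg⟩
    fib_multiplicative := inferInstance
    hasTerminal := he.hasTerminal
    fibrant := hfib
    hasPullback := fun f g hf => by
      obtain ⟨P, a, b, h⟩ := hpb f g hf
      exact h.hasPullback
    fib_pullback := inferInstance
    trivialFib_pullback := by rw [hFW]; infer_instance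
    factor := fun {X Y} f => ?_ }, fun f => ⟨fun h => key f h.1 h.2,
    fun h => ⟨hHF _ h, trivialFib_spanWeq h⟩⟩⟩
  -- A general `g` is replaced by the fibration out of its path space, and `f` by its composite with
  -- the section into that space.
  · obtain ⟨P, a, b, h⟩ := Q.exists_pathSpace hHF hpb g
    obtain ⟨s, hs₁, hs₂⟩ := Q.exists_section h
    have hs : spanWeq H s :=
      ⟨P, a, 𝟙 P, s, Q.trivialFib_fst h, H.id_mem P, hs₁, Category.comp_id s⟩
    refine Q.spanWeq_of_pathSpace h (cancel_of_fib (f ≫ s) _ (fib_pathSpace h)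
      (spanWeq_comp hpb' hf hs) ?_)
    rwa [Category.assoc, hs₂]
  · obtain ⟨P, a, b, h⟩ := Q.exists_pathSpace hHF hpb f
    obtain ⟨s, hs₁, hs₂⟩ := Q.exists_section h
    exact ⟨P, s, _, ⟨P, a, 𝟙 P, s, Q.trivialFib_fst h, H.id_mem P, hs₁, Category.comp_id s⟩,
      fib_pathSpace h, hs₂⟩

end

end PathObjects

end HigherCat

namespace HigherCat

open SSet MonoidalCategory

/-! ### The category of fibrant objects of `k`-categories -/

section

variable {V : Type u} [Category.{v} V] [HasFiniteLimits V] {J : MorphismProperty V}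
  [IsDescentCategory J] {k : ℕ}

instance quasiFibration_isMultiplicative : (quasiFibration J).IsMultiplicative where
  id_mem _ := ⟨fun _ _ _ _ => liftIn_iff.1 (LiftIn.of_isIso_post _ _),
    fun _ => liftIn_iff.1 (LiftIn.of_isIso_post _ _)⟩
  comp_mem _ _ hf hg := ⟨fun n i h₀ h₁ => liftIn_iff.1
    ((liftIn_iff.2 (hf.1 n i h₀ h₁)).comp_right (liftIn_iff.2 (hg.1 n i h₀ h₁))),
    fun i => liftIn_iff.1 ((liftIn_iff.2 (hf.2 i)).comp_right (liftIn_iff.2 (hg.2 i)))⟩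

instance quasiFibration_isStableUnderBaseChange :
    (quasiFibration J).IsStableUnderBaseChange where
  of_isPullback h hf := ⟨fun n i h₀ h₁ => liftIn_iff.1
    ((liftIn_iff.2 (hf.1 n i h₀ h₁)).base_change h),
    fun i => liftIn_iff.1 ((liftIn_iff.2 (hf.2 i)).base_change h)⟩

instance hypercover_isMultiplicative : (hypercover J).IsMultiplicative where
  id_mem _ := fun _ => liftIn_iff.1 (LiftIn.of_isIso_post _ _)
  comp_mem _ _ hf hg := fun n => liftIn_iff.1
    ((liftIn_iff.2 (hf n)).comp_right (liftIn_iff.2 (hg n)))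

instance hypercover_isStableUnderBaseChange : (hypercover J).IsStableUnderBaseChange where
  of_isPullback h hf := fun n => liftIn_iff.1 ((liftIn_iff.2 (hf n)).base_change h)

instance quasiFib_isStableUnderBaseChange : (KCat.quasiFib J k).IsStableUnderBaseChange where
  of_isPullback h hf :=
    (quasiFibration J).of_isPullback (KCat.isPullback_hom hf h) hf

variable [NeZero k]

lemma KCat.hyper_le_quasiFib : KCat.hyper J k ≤ KCat.quasiFib J k := fun X Y _ hf =>
  hypercover.quasiFibration hf X.cosk Y.cosk

instance hyper_isStableUnderBaseChange : (KCat.hyper J k).IsStableUnderBaseChange where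
  of_isPullback h hf :=
    (hypercover J).of_isPullback (KCat.isPullback_hom (KCat.hyper_le_quasiFib _ hf) h) hf

variable (J k) in
/-- The functor sending a `k`-category to the `k`-category of its paths. -/
noncomputable def KCat.pathFunctor : KCat J k ⥤ KCat J k :=
  ObjectProperty.lift _ (pow J k (thick.{v}.obj ⦋1⦌)) isKCategory_pow_thick

variable (J k) in
/-- The functor sending a `k`-category to its square. -/
noncomputable def KCat.endsFunctor : KCat J k ⥤ KCat J k :=
  ObjectProperty.lift _ (pow J k (thickEnds.{v} : SSet.{v})) isKCategory_pow_thickEnds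

variable (J k) in
/-- The evaluation of paths. -/
noncomputable def KCat.pathEvNat (e : Fin 2) : KCat.pathFunctor J k ⟶ 𝟭 _ where
  app X := ObjectProperty.homMk (pathEv J k e X)
  naturality _ _ f := ObjectProperty.hom_ext _ (pathEv_naturality e f)

variable (J k) in
/-- The projections of the square. -/
noncomputable def KCat.endsEvNat (e : Fin 2) (h : thickPt.{v} e ≤ thickEnds) :
    KCat.endsFunctor J k ⟶ 𝟭 _ where
  app X := ObjectProperty.homMk (endsEv J k e h X)
  naturality _ _ f := ObjectProperty.hom_ext _ (endsEv_naturality e h f)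

variable (J k) in
/-- The constant paths. -/
noncomputable def KCat.constPath : 𝟭 _ ⟶ KCat.pathFunctor J k where
  app X := ObjectProperty.homMk ((constNat J k (thick.obj ⦋1⦌)).app X)
  naturality _ _ f := ObjectProperty.hom_ext _ ((constNat J k (thick.obj ⦋1⦌)).naturality f)

variable (J k) in
/-- The map sending a path to its ends. -/
noncomputable def KCat.pathEnds : KCat.pathFunctor J k ⟶ KCat.endsFunctor J k where
  app X := ObjectProperty.homMk ((powNat J k thickEnds.ι).app X)
  naturality _ _ f := ObjectProperty.hom_ext _ ((powNat J k thickEnds.ι).naturality f)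

lemma KCat.pathFunctor_map_hom {X Y : KCat J k} (f : X ⟶ Y) :
    ((KCat.pathFunctor J k).map f).hom = (pow J k (thick.obj ⦋1⦌)).map f := rfl

lemma KCat.endsFunctor_map_hom {X Y : KCat J k} (f : X ⟶ Y) :
    ((KCat.endsFunctor J k).map f).hom = (pow J k (thickEnds.{v} : SSet.{v})).map f := rfl

lemma KCat.pathEvNat_app_hom (e : Fin 2) (X : KCat J k) :
    ((KCat.pathEvNat J k e).app X).hom = pathEv J k e X := rfl

lemma KCat.pathEnds_app_hom (X : KCat J k) :
    ((KCat.pathEnds J k).app X).hom = (powNat J k thickEnds.ι).app X := rfl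

lemma KCat.comp_hom {X Y Z : KCat J k} {f : X ⟶ Y} {g : Y ⟶ Z} {h : X ⟶ Z} (e : f ≫ g = h) :
    f.hom ≫ g.hom = h.hom := by subst e; rfl

lemma KCat.quasiFib_pathEnds (X : KCat J k) : KCat.quasiFib J k ((KCat.pathEnds J k).app X) :=
  (relKCategory_powNat_thickEnds X).1

lemma KCat.hyper_pathGap {X Y W : KCat J k} {f : X ⟶ Y} {a : W ⟶ X}
    {b : W ⟶ (KCat.pathFunctor J k).obj Y} {g : (KCat.pathFunctor J k).obj X ⟶ W} {e : Fin 2}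
    (hf : KCat.quasiFib J k f) (hW : IsPullback a b f ((KCat.pathEvNat J k e).app Y))
    (hga : g ≫ a = (KCat.pathEvNat J k e).app X) (hgb : g ≫ b = (KCat.pathFunctor J k).map f) :
    KCat.hyper J k g := by
  have h := KCat.isPullback_hom hf hW
  have h₀ := KCat.comp_hom hga
  have h₁ := KCat.comp_hom hgb
  rw [KCat.pathEvNat_app_hom] at h h₀
  rw [KCat.pathFunctor_map_hom] at h₁
  exact pathGap_hypercover hf h h₀ h₁

lemma KCat.hyper_endsGap {X Y W : KCat J k} {f : X ⟶ Y} {a : W ⟶ (KCat.endsFunctor J k).obj X}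
    {b : W ⟶ (KCat.pathFunctor J k).obj Y} {g : (KCat.pathFunctor J k).obj X ⟶ W}
    (hf : KCat.hyper J k f)
    (hW : IsPullback a b ((KCat.endsFunctor J k).map f) ((KCat.pathEnds J k).app Y))
    (hga : g ≫ a = (KCat.pathEnds J k).app X) (hgb : g ≫ b = (KCat.pathFunctor J k).map f) :
    KCat.hyper J k g := by
  have h := (KCat.isPullback_hom (KCat.quasiFib_pathEnds Y) hW.flip).flip
  have h₀ := KCat.comp_hom hga
  have h₁ := KCat.comp_hom hgb
  rw [KCat.endsFunctor_map_hom, KCat.pathEnds_app_hom] at h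
  rw [KCat.pathEnds_app_hom] at h₀
  rw [KCat.pathFunctor_map_hom] at h₁
  exact endsGap_hypercover hf h h₀ h₁

variable (J k) in
/-- The path objects of `k`-categories. -/
noncomputable def KCat.pathObjects : PathObjects (KCat.quasiFib J k) (KCat.hyper J k) where
  E := KCat.pathFunctor J k
  B := KCat.endsFunctor J k
  ev₀ := KCat.pathEvNat J k 0
  ev₁ := KCat.pathEvNat J k 1
  σ := KCat.constPath J k
  p₀ := KCat.endsEvNat J k 0 le_sup_left
  p₁ := KCat.endsEvNat J k 1 le_sup_right
  ev := KCat.pathEnds J k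
  ev_p₀ := NatTrans.ext (funext fun X => ObjectProperty.hom_ext _ (powNat_endsEv 0 _ X))
  ev_p₁ := NatTrans.ext (funext fun X => ObjectProperty.hom_ext _ (powNat_endsEv 1 _ X))
  σ_ev₀ := NatTrans.ext (funext fun X => ObjectProperty.hom_ext _ (constNat_pathEv 0 X))
  σ_ev₁ := NatTrans.ext (funext fun X => ObjectProperty.hom_ext _ (constNat_pathEv 1 X))
  exists_lift {T X} a b := by
    obtain ⟨l, h₀, h₁⟩ := (isPullback_endsEv X).exists_lift a.hom b.hom
      (ptSIsTerminal.hom_ext _ _)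
    exact ⟨ObjectProperty.homMk l, ObjectProperty.hom_ext _ h₀, ObjectProperty.hom_ext _ h₁⟩
  hom_ext {T X} l l' h₀ h₁ := ObjectProperty.hom_ext _ ((isPullback_endsEv X).hom_ext
    (congrArg InducedCategory.Hom.hom h₀) (congrArg InducedCategory.Hom.hom h₁))
  fib_ev X := KCat.quasiFib_pathEnds X
  trivialFib_ev₀ X := hypercover_pathEv 0 X
  trivialFib_ev₁ X := hypercover_pathEv 1 X
  trivialFib_gap hf hW hga hgb := KCat.hyper_pathGap hf hW hga hgb
  trivialFib_ends_gap hf hW hga hgb := KCat.hyper_endsGap hf hW hga hgb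

theorem KCat.isCategoryOfFibrantObjects :
    IsCategoryOfFibrantObjects (KCat.weq J k) (KCat.quasiFib J k) ∧
      ∀ {X Y : KCat J k} (f : X ⟶ Y),
        (KCat.quasiFib J k f ∧ KCat.weq J k f) ↔ KCat.hyper J k f :=
  (KCat.pathObjects J k).isCategoryOfFibrantObjects KCat.hyper_le_quasiFib
    (fun f g hf => by
      obtain ⟨P, fst, snd, h, -⟩ := KCat.exists_isPullback f g hf
      exact ⟨P, fst, snd, h⟩)
    (fun {X Y Z} _ _ hf hfg => hypercover_cancel X.cosk Y.cosk Z.cosk hf hfg)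
    KCat.ptIsTerminal KCat.quasiFib_of_isTerminal

/-! ### The groupoid of a `k`-category -/

/-- This identifies the one thick horn in positive dimension that the matching does not treat with
the vertex appearing in the definition of a quasi-fibration. -/
lemma thickSub_horn_one (i : Fin 2) : thickSub Λ[1, i] = thickPt.{v} i := by
  ext ⟨d⟩ w
  rw [← not_iff_not]
  refine (thickWord_iff (d := d.len) w).trans ?_
  refine Iff.trans ?_ (not_congr (mem_thickPt_iff (d := d.len) w)).symm
  rw [not_forall]
  have h (j : ℕ) : (∃ a ≤ d.len, (thickWords 1).letter w a = j) ↔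
      ∃ a : Fin (d.len + 1), (w a).down.val = j :=
    exists_letterOf_iff (fun j => (w j).down.val) (fun y => y = j)
  simp only [ThickWord, h]
  constructor
  · intro h
    obtain ⟨a, ha⟩ := h (1 - i) (by lia) (by lia)
    exact ⟨a, fun e => by rw [e] at ha; lia⟩
  · rintro ⟨a, ha⟩ j hj hji
    refine ⟨a, ?_⟩
    have := (w a).down.2
    have : ((w a).down : ℕ) ≠ i := fun e => ha (Fin.ext e)
    lia

lemma liftIn_thickSub_horn {C : MorphismProperty (Vᵒᵖ ⥤ Type v)} [C.IsStableUnderBaseChange]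
    [C.IsMultiplicative] {X Y : KCat J k} {f : X ⟶ Y} {n : ℕ} (hn : 2 ≤ n) (i : Fin (n + 1))
    (hf : ∀ d, n ≤ d + 1 → ∀ p : Fin (d + 2), 0 < p → p < Fin.last (d + 1) →
      LiftIn C Λ[d + 1, p].ι f.hom) : LiftIn C (thickSub Λ[n, i]).ι f.hom :=
  Words.ι_of_thickPivot (P := liftProp C f.hom) n i hn (by lia) (thickWords n) (k + 1)
    (liftIn_homOfLE_of_cosk X.cosk Y.cosk) _ (fun _ => thickWord_iff) hf

lemma KCat.quasiFib.liftIn_thickSub_horn {X Y : KCat J k} {f : X ⟶ Y}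
    (hf : KCat.quasiFib J k f) {n : ℕ} (hn : 0 < n) (i : Fin (n + 1)) :
    LiftIn J.presheaf (thickSub Λ[n, i]).ι f.hom := by
  obtain hn | hn := (show 1 ≤ n from hn).lt_or_eq
  · exact HigherCat.liftIn_thickSub_horn hn i
      fun d _ p h₀ h₁ => liftIn_iff.2 (hf.1 (d + 1) p h₀ h₁)
  · subst hn
    rw [thickSub_horn_one, liftIn_thickPt_iff]
    exact liftIn_iff.2 (hf.2 i)

lemma liftIn_cot_thick_iff {C : MorphismProperty (Vᵒᵖ ⥤ Type v)} [C.IsStableUnderBaseChange]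
    {n : ℕ} (A : (Δ[n] : SSet.{v}).Subcomplex) {X Y : KCat J k} (f : X ⟶ Y) :
    LiftIn C A.ι ((cot J k thick).map f) ↔ LiftIn C (thickSub A).ι f.hom :=
  Realization.liftIn_iff _ _ (Realization.thickSub_naturality A) f

lemma res_cot_thick_iff {C : MorphismProperty (Vᵒᵖ ⥤ Type v)} [C.IsStableUnderBaseChange]
    {n : ℕ} (A : (Δ[n] : SSet.{v}).Subcomplex) (X : KCat J k) :
    C (Map.res A.ι ((cot J k thick).obj X)) ↔
      LiftIn C (thickSub A).ι (KCat.ptIsTerminal.from X).hom :=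
  (Realization.res_iff _ _ (Realization.thickSub_naturality A) X).trans (liftIn_ptS_iff _).symm

lemma isKGroupoid_cot_thick (X : KCat J k) : IsKGroupoid J k ((cot J k thick).obj X) where
  cover n i hn := (res_cot_thick_iff _ X).2
    (KCat.quasiFib.liftIn_thickSub_horn (KCat.quasiFib_of_isTerminal KCat.ptIsTerminal _) hn i)
  isIso n i hn hk := (res_cot_thick_iff (C := .isomorphisms _) _ X).2
    -- From `n > k > 0` comes `2 ≤ n`, so the matching is available, and its horns have dimension at
    -- least `n`, hence above `k`.
    (liftIn_thickSub_horn (by have := NeZero.pos k; lia) i fun d hd p h₀ h₁ =>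
      (liftIn_ptS_iff _).2 (X.2.isIso _ p h₀ h₁ (by lia)))

variable (J k) in
/-- The functor sending a `k`-category `X` to the `k`-groupoid `n ↦ Map(thick ⦋n⦌, X)`. -/
noncomputable def KCat.groupoid : KCat J k ⥤ KGpd J k :=
  ObjectProperty.lift _ (cot J k thick) isKGroupoid_cot_thick

lemma KCat.groupoid_fib {X Y : KCat J k} {f : X ⟶ Y} (hf : KCat.quasiFib J k f) :
    KGpd.fib J k ((KCat.groupoid J k).map f) := fun _ i hn =>
  liftIn_iff.1 ((liftIn_cot_thick_iff _ f).2 (hf.liftIn_thickSub_horn hn i))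

lemma KCat.groupoid_hyper {X Y : KCat J k} {f : X ⟶ Y} (hf : KCat.hyper J k f) :
    KGpd.hyper J k ((KCat.groupoid J k).map f) := fun _ =>
  liftIn_iff.1 ((liftIn_cot_thick_iff _ f).2 (hypercover.liftIn hf X.cosk Y.cosk _))

lemma KCat.isPullback_groupoid {P X Y Z : KCat J k} {fst : P ⟶ X} {snd : P ⟶ Z} {f : X ⟶ Y}
    {g : Z ⟶ Y} (hf : KCat.quasiFib J k f) (h : IsPullback fst snd f g) :
    IsPullback ((KCat.groupoid J k).map fst) ((KCat.groupoid J k).map snd)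
      ((KCat.groupoid J k).map f) ((KCat.groupoid J k).map g) :=
  IsPullback.of_map (KGpd.incl J k) (by rw [← Functor.map_comp, h.w, Functor.map_comp])
    (isPullback_cot (KCat.isPullback_hom hf h))

end

lemma spanWeq_map {C D : Type*} [Category* C] [Category* D] (G : C ⥤ D) {H : MorphismProperty C}
    {H' : MorphismProperty D} (hG : ∀ {X Y : C} (f : X ⟶ Y), H f → H' (G.map f)) {X Y : C}
    {f : X ⟶ Y} (hf : spanWeq H f) : spanWeq H' (G.map f) := by
  obtain ⟨P, p, q, s, hp, hq, hsp, rfl⟩ := hf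
  exact ⟨G.obj P, G.map p, G.map q, G.map s, hG p hp, hG q hq,
    by rw [← G.map_comp, hsp, G.map_id], (G.map_comp _ _).symm⟩

end HigherCat

theorem mainTheorem3 {V : Type u} [Category.{v} V] (J : MorphismProperty V)
    [IsDescentCategory J] (k : ℕ) (hk : 0 < k) :
    IsCategoryOfFibrantObjects (HigherCat.KCat.weq J k) (HigherCat.KCat.quasiFib J k) ∧
    (∀ {X Y : HigherCat.KCat J k} (f : X ⟶ Y),
      (HigherCat.KCat.quasiFib J k f ∧ HigherCat.KCat.weq J k f) ↔ HigherCat.KCat.hyper J k f) ∧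
    ∃ GG : HigherCat.KCat J k ⥤ HigherCat.KGpd J k,
      Nonempty (GG ⋙ HigherCat.KGpd.incl J k ⋙ HigherCat.simplicialYoneda ≅
        HigherCat.KCat.incl J k ⋙ HigherCat.thickMap) ∧
      (∀ {X Y : HigherCat.KCat J k} (f : X ⟶ Y), HigherCat.KCat.quasiFib J k f →
        HigherCat.KGpd.fib J k (GG.map f)) ∧
      (∀ {P X Y Z : HigherCat.KCat J k} (fst : P ⟶ X) (snd : P ⟶ Z) (f : X ⟶ Y) (g : Z ⟶ Y),
        HigherCat.KCat.quasiFib J k f → IsPullback fst snd f g →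
          IsPullback (GG.map fst) (GG.map snd) (GG.map f) (GG.map g)) ∧
      (∀ {X Y : HigherCat.KCat J k} (f : X ⟶ Y), HigherCat.KCat.hyper J k f →
        HigherCat.KGpd.hyper J k (GG.map f)) ∧
      (∀ {X Y : HigherCat.KCat J k} (f : X ⟶ Y), HigherCat.KCat.weq J k f →
        HigherCat.KGpd.weq J k (GG.map f)) := by
  have : HasFiniteLimits V := IsDescentCategory.hasFiniteLimits J
  have : NeZero k := ⟨hk.ne'⟩
  obtain ⟨h₁, h₂⟩ := HigherCat.KCat.isCategoryOfFibrantObjects (J := J) (k := k)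
  exact ⟨h₁, h₂, HigherCat.KCat.groupoid J k, ⟨HigherCat.cotIso J k HigherCat.thick⟩,
    fun _ => HigherCat.KCat.groupoid_fib, fun _ _ _ _ => HigherCat.KCat.isPullback_groupoid,
    fun _ => HigherCat.KCat.groupoid_hyper,
    fun _ => HigherCat.spanWeq_map _ fun _ => HigherCat.KCat.groupoid_hyper⟩
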